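/- Let $\ell\in(0,1]$ and let $\mathcal G_\ell$ be the set of functions $\Phi:[0,\infty)\to[0,\infty)$ with $\Phi(0)=0$, $\lim_{r\to\infty}\Phi(r)=\infty$ and $\Phi(tr)\le c_\Phi\max\{t^{\ell},t\}\,\Phi(r)$ for all $t,r\ge 0$, for some constant $c_\Phi\ge1$. Let $\Phi\in\mathcal G_\ell$ be concave (hence a bijection of $[0,\infty)$, with convex inverse $\Phi^{-1}$), suppose that $$q_{\Phi^{-1}}=\sup_{t>0}\frac{t\,(\Phi^{-1})'(t)}{\Phi^{-1}(t)}<\infty$$ (right derivative), and put $\phi(r)=\dfrac{1}{r\,\Phi^{-1}(1/r)}$ for $r>0$. Let $(\Omega,\mathcal F,P)$ be a probability space with a non-decreasing sequence $(\mathcal F_n)_{n\ge0}$ of sub-$\sigma$-algebras such that $\mathcal F=\sigma(\bigcup_n\mathcal F_n)$, and write $E_n=E(\cdot\mid\mathcal F_n)$. For a measurable function $u$ put $$\|u\|_{wL_\Phi}=\inf\Big\{c>0:\ \sup_{t>0}\Phi(t/c)\,P(|u|>t)\le1\Big\}.$$ For a real martingale $f=(f_n)_{n\ge0}$ with $f_0=0$,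 put $df_n=f_n-f_{n-1}$ and $s(f)=\big(\sum_{n\ge1}E_{n-1}|df_n|^2\big)^{1/2}$. Let $w\mathscr H^s_\Phi$ be the space of all such martingales for which $$\|f\|_{wH^s_\Phi}:=\|s(f)\|_{wL_\Phi}<\infty\quad\text{and}\quad \lim_{P(A)\to0}\|s(f)\chi_A\|_{wL_\Phi}=0,$$ with the topology of the quasi-norm $\|\cdot\|_{wH^s_\Phi}$, and let $H_2^s$ be the set of such martingales with $E\,s(f)^2<\infty$. For a continuous linear functional $l$ on $w\mathscr H^s_\Phi$ let $\|l\|=\sup\{|l(f)|:\|f\|_{wH^s_\Phi}\le1\}$. Let $w\mathcal L_{2,\phi}$ be the space of all real $g\in L_2(\Omega,\mathcal F,P)$ with $E_0g=0$ and $$\|g\|_{w\mathcal L_{2,\phi}}=\int_0^\infty\frac{t_\phi^2(x)}{x}\,dx<\infty,\qquad t_\phi^2(x)=\frac{1}{\phi(x)}\,x^{-1/2}\sup_{P(\nu<\infty)\le x}\|g-g^\nu\|_2,$$ where the supremum is over stopping times $\nu:\Omega\to\{0,1,\dots,\infty\}$, $g^\nu=E_ng$ on $\{\nu=n\}$ and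 $g^\nu=g$ on $\{\nu=\infty\}$. For such $g$ put $dg_n=E_ng-E_{n-1}g$. Then $(w\mathscr H^s_\Phi)^*=w\mathcal L_{2,\phi}$ with equivalent norms. Precisely, there is a constant $C$ depending only on $\Phi$ such that, for every $(\Omega,\mathcal F,P;(\mathcal F_n))$ as above: for every $g\in w\mathcal L_{2,\phi}$ and $f\in H_2^s$ the series $\sum_{n\ge1}df_n\,dg_n$ converges absolutely almost surely and its sum is integrable; for every $g\in w\mathcal L_{2,\phi}$ there is exactly one continuous linear functional $l_g$ on $w\mathscr H^s_\Phi$ with $$l_g(f)=E\Big(\sum_{n=1}^\infty df_n\,dg_n\Big)\qquad\text{for all } f\in H_2^s;$$ the map $g\mapsto l_g$ is a linear bijection from $w\mathcal L_{2,\phi}$ onto the space $(w\mathscr H^s_\Phi)^*$ of all continuous linear functionals on $w\mathscr H^s_\Phi$; and $$C^{-1}\|g\|_{w\mathcal L_{2,\phi}}\le\|l_g\|\le C\|g\|_{w\mathcal L_{2,\phi}}\qquad\text{for all } g\in w\mathcal L_{2,\phi}.$$ -/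

import Mathlib

open MeasureTheory ProbabilityTheory Filter
open scoped ENNReal NNReal Topology

noncomputable section

namespace WeakOrlicz

/-! ## The classes of functions and their indices

A function on `[0, ∞)` is represented by a function on `ℝ`; only its values on `[0, ∞)` matter. -/

/-- The class `G_ℓ`: functions `Φ : [0, ∞) → [0, ∞)` with `Φ 0 = 0` and `Φ r → ∞` as `r → ∞`, of
lower type `ℓ ∈ (0, 1]` and upper type `1`. -/
structure MemG (ℓ : ℝ) (Φ : ℝ → ℝ) : Prop where
  exp_pos : 0 < ℓ
  exp_le_one : ℓ ≤ 1
  nonneg : ∀ r, 0 ≤ r → 0 ≤ Φ r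
  map_zero : Φ 0 = 0
  tendsto_atTop : Tendsto Φ atTop atTop
  type_bound : ∃ c : ℝ, 1 ≤ c ∧
    ∀ t r : ℝ, 0 ≤ t → 0 ≤ r → Φ (t * r) ≤ c * max (t ^ ℓ) t * Φ r

/-- The inverse function of (a bijection) `Φ : [0, ∞) → [0, ∞)`. -/
def inverse (Φ : ℝ → ℝ) : ℝ → ℝ := Function.invFunOn Φ (Set.Ici 0)

/-- The upper index `q_Ψ = sup_{t > 0} t Ψ'(t) / Ψ(t)`. The derivative is the right derivative,
which exists at every `t > 0` when `Ψ` is convex or concave on `[0, ∞)`. -/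
def upperIndex (Ψ : ℝ → ℝ) : EReal :=
  ⨆ t : Set.Ioi (0 : ℝ), ((t * derivWithin Ψ (Set.Ioi (t : ℝ)) t / Ψ t : ℝ) : EReal)

variable {Ω : Type*} [mΩ : MeasurableSpace Ω]

/-! ## Weak Orlicz spaces

Elements of the weak Orlicz space enter only through their absolute value,
so functions with values in `[0, ∞]` are used. -/

/-- The weak Orlicz quasi-norm `inf {r > 0 : sup_{t > 0} Φ(t / r) P(u > t) ≤ 1}`. -/
def weakNorm (Φ : ℝ → ℝ) (P : Measure Ω) (u : Ω → ℝ≥0∞) : ℝ≥0∞ :=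
  ⨅ (r : ℝ) (_ : 0 < r ∧
    ∀ t : ℝ, 0 < t → ENNReal.ofReal (Φ (t / r)) * P {ω | ENNReal.ofReal t < u ω} ≤ 1),
    ENNReal.ofReal r

/-- The space of functions in the weak Orlicz space with absolutely continuous quasi-norm:
`‖u χ_A‖ → 0` as `P(A) → 0`. -/
def HasAbsContNorm (Φ : ℝ → ℝ) (P : Measure Ω) (u : Ω → ℝ≥0∞) : Prop :=
  weakNorm Φ P u < ∞ ∧
    ∀ ε : ℝ≥0∞, 0 < ε → ∃ δ : ℝ≥0∞, 0 < δ ∧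
      ∀ A : Set Ω, MeasurableSet A → P A < δ → weakNorm Φ P (A.indicator u) < ε

/-! ## The conditional quadratic variation -/

/-- The conditional quadratic variation `s(f) = (∑_{n ≥ 1} E_{n-1} |f_n - f_{n-1}|²)^{1/2}`; the
conditional expectations are those of functions with values in `[0, ∞]`. The term of index `0` is
omitted, it is only used for martingales with `f_0 = 0`. -/
def condVar (𝓕 : Filtration ℕ mΩ) (P : Measure Ω) (f : ℕ → Ω → ℝ) (ω : Ω) : ℝ≥0∞ :=
  (∑' n, condLExp (𝓕 n) P (fun ω' => ‖f (n + 1) ω' - f n ω'‖ₑ ^ 2) ω) ^ (1 / 2 : ℝ)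

/-! ### Facts needed for the linear structure -/

lemma weakNorm_mono {Φ : ℝ → ℝ} {P : Measure Ω} {u v : Ω → ℝ≥0∞} (h : u ≤ᵐ[P] v) :
    weakNorm Φ P u ≤ weakNorm Φ P v := by
  refine le_iInf₂ fun r hr => iInf₂_le r ⟨hr.1, fun t ht => le_trans ?_ (hr.2 t ht)⟩
  have hsub : {ω | ENNReal.ofReal t < u ω} ≤ᵐ[P] {ω | ENNReal.ofReal t < v ω} := by
    filter_upwards [h] with ω hω h'
    exact lt_of_lt_of_le h' hω
  exact mul_le_mul_right (measure_mono_ae hsub) _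

lemma weakNorm_zero (Φ : ℝ → ℝ) (P : Measure Ω) : weakNorm Φ P (fun _ => 0) = 0 := by
  refine le_antisymm (ENNReal.le_of_forall_pos_le_add fun ε hε _ => ?_) bot_le
  refine (iInf₂_le (ε : ℝ) ⟨by exact_mod_cast hε, fun t _ => by simp⟩).trans ?_
  simp

lemma weakNorm_add_le {ℓ : ℝ} {Φ : ℝ → ℝ} (hΦ : MemG ℓ Φ) (P : Measure Ω) :
    ∃ K : ℝ≥0, ∀ u v : Ω → ℝ≥0∞,
      weakNorm Φ P (fun ω => u ω + v ω) ≤ K * (weakNorm Φ P u + weakNorm Φ P v) := by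
  obtain ⟨c, hc1, hc⟩ := hΦ.type_bound
  have hℓ := hΦ.exp_pos
  set k : ℝ := (2 * c) ^ (1 / ℓ) with hk
  have hk1 : 1 ≤ k := Real.one_le_rpow (by linarith) (by positivity)
  have hk0 : 0 < k := by linarith
  have hkℓ : k ^ ℓ = 2 * c := by
    rw [hk, ← Real.rpow_mul (by linarith), one_div, inv_mul_cancel₀ hℓ.ne', Real.rpow_one]
  have key : ∀ s x : ℝ, 0 < s → s ≤ 1 / k → 0 ≤ x → Φ (s * x) ≤ 1 / 2 * Φ x := by
    intro s x hs hsk hx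
    refine (hc s x hs.le hx).trans ?_
    have hs1 : s ≤ 1 := hsk.trans (by rw [div_le_one hk0]; exact hk1)
    have h1 : s ≤ s ^ ℓ := by
      simpa using Real.rpow_le_rpow_of_exponent_ge hs hs1 hΦ.exp_le_one
    have h2 : s ^ ℓ ≤ 1 / (2 * c) := by
      rw [← hkℓ, one_div, ← Real.inv_rpow hk0.le, ← one_div]
      exact Real.rpow_le_rpow hs.le hsk hℓ.le
    rw [max_eq_left h1]
    refine mul_le_mul_of_nonneg_right ?_ (hΦ.nonneg x hx)
    calc c * s ^ ℓ ≤ c * (1 / (2 * c)) := by gcongr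
      _ = 1 / 2 := by field_simp
  refine ⟨(2 * k).toNNReal, fun u v => ?_⟩
  have hK : (((2 * k).toNNReal : ℝ≥0) : ℝ≥0∞) = ENNReal.ofReal (2 * k) := rfl
  rw [hK]
  have main : ∀ r : ℝ, (0 < r ∧
      ∀ t : ℝ, 0 < t → ENNReal.ofReal (Φ (t / r)) * P {ω | ENNReal.ofReal t < u ω} ≤ 1) →
      ∀ r' : ℝ, (0 < r' ∧
      ∀ t : ℝ, 0 < t → ENNReal.ofReal (Φ (t / r')) * P {ω | ENNReal.ofReal t < v ω} ≤ 1) →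
      weakNorm Φ P (fun ω => u ω + v ω) ≤
        ENNReal.ofReal (2 * k) * (ENNReal.ofReal r + ENNReal.ofReal r') := by
    intro r hr r' hr'
    have h0 := hr.1
    have h0' := hr'.1
    rw [← ENNReal.ofReal_add h0.le h0'.le, ← ENNReal.ofReal_mul (by positivity)]
    refine iInf₂_le _ ⟨by positivity, fun t ht => ?_⟩
    have hsub : {ω | ENNReal.ofReal t < u ω + v ω} ⊆
        {ω | ENNReal.ofReal (t / 2) < u ω} ∪ {ω | ENNReal.ofReal (t / 2) < v ω} := by
      intro ω hω
      by_contra hcon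
      simp only [Set.mem_union, Set.mem_ofPred_eq, not_or, not_lt] at hcon hω
      refine absurd hω (not_lt.2 ((add_le_add hcon.1 hcon.2).trans ?_))
      rw [← ENNReal.ofReal_add (by positivity) (by positivity)]
      simp
    have b : ∀ (ρ ρ' : ℝ), 0 < ρ → 0 < ρ' →
        ENNReal.ofReal (Φ (t / (2 * k * (ρ + ρ')))) ≤
          ENNReal.ofReal (1 / 2) * ENNReal.ofReal (Φ (t / 2 / ρ)) := by
      intro ρ ρ' hρ hρ'
      rw [← ENNReal.ofReal_mul (by norm_num)]
      refine ENNReal.ofReal_le_ofReal ?_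
      have := key (ρ / (k * (ρ + ρ'))) (t / 2 / ρ) (by positivity)
        (by rw [div_le_div_iff₀ (by positivity) hk0]; nlinarith [mul_pos hk0 hρ'])
        (by positivity)
      convert this using 2
      field_simp
    calc ENNReal.ofReal (Φ (t / (2 * k * (r + r')))) * P {ω | ENNReal.ofReal t < u ω + v ω}
        ≤ ENNReal.ofReal (Φ (t / (2 * k * (r + r')))) *
          (P {ω | ENNReal.ofReal (t / 2) < u ω} + P {ω | ENNReal.ofReal (t / 2) < v ω}) := by
          gcongr
          exact (measure_mono hsub).trans (measure_union_le _ _)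
      _ = ENNReal.ofReal (Φ (t / (2 * k * (r + r')))) * P {ω | ENNReal.ofReal (t / 2) < u ω} +
          ENNReal.ofReal (Φ (t / (2 * k * (r' + r)))) * P {ω | ENNReal.ofReal (t / 2) < v ω} := by
          rw [mul_add, add_comm r r']
      _ ≤ ENNReal.ofReal (1 / 2) * 1 + ENNReal.ofReal (1 / 2) * 1 := by
          refine add_le_add ?_ ?_
          · refine (mul_le_mul_left (b r r' h0 h0') _).trans ?_
            rw [mul_assoc]
            exact mul_le_mul_right (hr.2 _ (by positivity)) _
          · refine (mul_le_mul_left (b r' r h0' h0) _).trans ?_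
            rw [mul_assoc]
            exact mul_le_mul_right (hr'.2 _ (by positivity)) _
      _ = 1 := by
          rw [mul_one, ← ENNReal.ofReal_add (by norm_num) (by norm_num)]
          norm_num
  have hK0 : ENNReal.ofReal (2 * k) ≠ 0 := by
    rw [Ne, ENNReal.ofReal_eq_zero, not_le]; positivity
  rw [mul_add]
  refine ENNReal.le_of_forall_pos_le_add fun ε hε hfin => ?_
  have hfu : weakNorm Φ P u ≠ ∞ := by
    intro h; rw [h, ENNReal.mul_top hK0] at hfin; simp at hfin
  have hfv : weakNorm Φ P v ≠ ∞ := by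
    intro h; rw [h, ENNReal.mul_top hK0] at hfin; simp at hfin
  set η : ℝ≥0∞ := ENNReal.ofReal (ε / (4 * k)) with hη
  have hη0 : η ≠ 0 := by
    rw [hη, Ne, ENNReal.ofReal_eq_zero, not_le]
    have : (0 : ℝ) < ε := hε
    positivity
  have hu : weakNorm Φ P u < weakNorm Φ P u + η := ENNReal.lt_add_right hfu hη0
  have hv : weakNorm Φ P v < weakNorm Φ P v + η := ENNReal.lt_add_right hfv hη0
  obtain ⟨r, hr, hru⟩ := (by simpa only [weakNorm, iInf_lt_iff, exists_prop] using
    (show weakNorm Φ P u < _ from hu) : ∃ r : ℝ, (0 < r ∧ ∀ t : ℝ, 0 < t →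
      ENNReal.ofReal (Φ (t / r)) * P {ω | ENNReal.ofReal t < u ω} ≤ 1) ∧
      ENNReal.ofReal r < weakNorm Φ P u + η)
  obtain ⟨r', hr', hrv⟩ := (by simpa only [weakNorm, iInf_lt_iff, exists_prop] using
    (show weakNorm Φ P v < _ from hv) : ∃ r : ℝ, (0 < r ∧ ∀ t : ℝ, 0 < t →
      ENNReal.ofReal (Φ (t / r)) * P {ω | ENNReal.ofReal t < v ω} ≤ 1) ∧
      ENNReal.ofReal r < weakNorm Φ P v + η)
  refine (main r hr r' hr').trans ?_
  have hηε : ENNReal.ofReal (2 * k) * (η + η) = ε := by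
    rw [hη, ← ENNReal.ofReal_add (by positivity) (by positivity),
      ← ENNReal.ofReal_mul (by positivity)]
    have : 2 * k * ((ε : ℝ) / (4 * k) + ε / (4 * k)) = ε := by field_simp; ring
    rw [this, ENNReal.ofReal_coe_nnreal]
  calc ENNReal.ofReal (2 * k) * (ENNReal.ofReal r + ENNReal.ofReal r')
      ≤ ENNReal.ofReal (2 * k) * ((weakNorm Φ P u + η) + (weakNorm Φ P v + η)) := by gcongr
    _ = ENNReal.ofReal (2 * k) * weakNorm Φ P u + ENNReal.ofReal (2 * k) * weakNorm Φ P v +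
        ENNReal.ofReal (2 * k) * (η + η) := by ring
    _ = _ := by rw [hηε]

lemma HasAbsContNorm.mono {Φ : ℝ → ℝ} {P : Measure Ω} {u v : Ω → ℝ≥0∞}
    (hv : HasAbsContNorm Φ P v) (h : u ≤ᵐ[P] v) : HasAbsContNorm Φ P u := by
  refine ⟨(weakNorm_mono h).trans_lt hv.1, fun ε hε => ?_⟩
  obtain ⟨δ, hδ, H⟩ := hv.2 ε hε
  refine ⟨δ, hδ, fun A hA hPA => (weakNorm_mono ?_).trans_lt (H A hA hPA)⟩
  filter_upwards [h] with ω hω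
  exact Set.indicator_le_indicator hω

lemma hasAbsContNorm_zero (Φ : ℝ → ℝ) (P : Measure Ω) : HasAbsContNorm Φ P (fun _ => 0) := by
  refine ⟨by simp [weakNorm_zero], fun ε hε => ⟨1, one_pos, fun A _ _ => ?_⟩⟩
  rw [Set.indicator_zero, weakNorm_zero]
  exact hε

lemma HasAbsContNorm.add {ℓ : ℝ} {Φ : ℝ → ℝ} (hΦ : MemG ℓ Φ) {P : Measure Ω}
    {u v : Ω → ℝ≥0∞} (hu : HasAbsContNorm Φ P u) (hv : HasAbsContNorm Φ P v) :
    HasAbsContNorm Φ P (fun ω => u ω + v ω) := by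
  obtain ⟨K, hK⟩ := weakNorm_add_le (Ω := Ω) hΦ P
  refine ⟨(hK u v).trans_lt (ENNReal.mul_lt_top ENNReal.coe_lt_top
    (ENNReal.add_lt_top.2 ⟨hu.1, hv.1⟩)), fun ε hε => ?_⟩
  obtain ⟨η, hη, hηε⟩ : ∃ η : ℝ≥0∞, 0 < η ∧ K * (η + η) < ε := by
    have ht : Tendsto (fun η : ℝ≥0∞ => (K : ℝ≥0∞) * (η + η)) (𝓝 0) (𝓝 (K * (0 + 0))) :=
      ENNReal.Tendsto.const_mul (tendsto_id.add tendsto_id) (Or.inr ENNReal.coe_ne_top)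
    have hev : ∀ᶠ η : ℝ≥0∞ in 𝓝[>] 0, (K : ℝ≥0∞) * (η + η) < ε :=
      (ht.mono_left nhdsWithin_le_nhds).eventually_lt_const (by simpa using hε)
    obtain ⟨η, h1, h2⟩ := (hev.and self_mem_nhdsWithin).exists
    exact ⟨η, h2, h1⟩
  obtain ⟨δ, hδ, H⟩ := hu.2 η hη
  obtain ⟨δ', hδ', H'⟩ := hv.2 η hη
  refine ⟨min δ δ', lt_min hδ hδ', fun A hA hPA => ?_⟩
  have e : A.indicator (fun ω => u ω + v ω) = fun ω => A.indicator u ω + A.indicator v ω :=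
    Set.indicator_add A u v
  rw [e]
  refine (hK _ _).trans_lt (lt_of_le_of_lt ?_ hηε)
  gcongr
  · exact (H A hA (hPA.trans_le (min_le_left _ _))).le
  · exact (H' A hA (hPA.trans_le (min_le_right _ _))).le

lemma HasAbsContNorm.nat_mul {ℓ : ℝ} {Φ : ℝ → ℝ} (hΦ : MemG ℓ Φ) {P : Measure Ω}
    {u : Ω → ℝ≥0∞} (hu : HasAbsContNorm Φ P u) (n : ℕ) :
    HasAbsContNorm Φ P (fun ω => n * u ω) := by
  induction n with
  | zero => simpa using hasAbsContNorm_zero Φ P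
  | succ n ih => simpa [add_mul] using ih.add hΦ hu

lemma condVar_add_le {P : Measure Ω} {𝓕 : Filtration ℕ mΩ} {f g : ℕ → Ω → ℝ}
    (hf : Martingale f 𝓕 P) :
    condVar 𝓕 P (f + g) ≤ᵐ[P] fun ω => (2 : ℕ) * (condVar 𝓕 P f ω + condVar 𝓕 P g ω) := by
  have h : ∀ n, condLExp (𝓕 n) P (fun ω' => ‖(f + g) (n + 1) ω' - (f + g) n ω'‖ₑ ^ 2) ≤ᵐ[P]
      fun ω => 4 * (condLExp (𝓕 n) P (fun ω' => ‖f (n + 1) ω' - f n ω'‖ₑ ^ 2) ω +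
        condLExp (𝓕 n) P (fun ω' => ‖g (n + 1) ω' - g n ω'‖ₑ ^ 2) ω) := by
    intro n
    set X : Ω → ℝ≥0∞ := fun ω' => ‖f (n + 1) ω' - f n ω'‖ₑ ^ 2
    set Y : Ω → ℝ≥0∞ := fun ω' => ‖g (n + 1) ω' - g n ω'‖ₑ ^ 2
    have hX : AEMeasurable X P := by
      have h1 : Measurable (f (n + 1)) :=
        ((hf.stronglyMeasurable (n + 1)).mono (𝓕.le _)).measurable
      have h2 : Measurable (f n) := ((hf.stronglyMeasurable n).mono (𝓕.le _)).measurable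
      exact ((h1.sub h2).enorm.pow_const 2).aemeasurable
    have hle : (fun ω' => ‖(f + g) (n + 1) ω' - (f + g) n ω'‖ₑ ^ 2) ≤ᵐ[P]
        (4 : ℝ≥0∞) • (X + Y) := by
      refine Eventually.of_forall fun ω => ?_
      simp only [Pi.add_apply, Pi.smul_apply, smul_eq_mul, X, Y]
      set a := f (n + 1) ω - f n ω
      set b := g (n + 1) ω - g n ω
      have e : f (n + 1) ω + g (n + 1) ω - (f n ω + g n ω) = a + b := by
        simp only [a, b]; ring
      rw [e]
      have h3 : ‖a + b‖ₑ ≤ 2 * max ‖a‖ₑ ‖b‖ₑ := by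
        refine (enorm_add_le a b).trans ?_
        rw [two_mul]
        exact add_le_add (le_max_left _ _) (le_max_right _ _)
      calc ‖a + b‖ₑ ^ 2 ≤ (2 * max ‖a‖ₑ ‖b‖ₑ) ^ 2 := by gcongr
        _ = 4 * (max ‖a‖ₑ ‖b‖ₑ) ^ 2 := by rw [mul_pow]; norm_num
        _ ≤ 4 * (‖a‖ₑ ^ 2 + ‖b‖ₑ ^ 2) := by
            gcongr
            rcases max_cases ‖a‖ₑ ‖b‖ₑ with h | h
            · rw [h.1]; exact le_self_add
            · rw [h.1]; exact le_add_self
    filter_upwards [condLExp_mono (mΩ := 𝓕 n) hle,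
      condLExp_smul' (mΩ := 𝓕 n) (P := P) (X + Y) (c := 4) (by norm_num),
      condLExp_add_left (mΩ := 𝓕 n) (P := P) Y hX] with ω h1 h2 h3
    rw [h2, Pi.smul_apply, h3] at h1
    simpa using h1
  filter_upwards [ae_all_iff.2 h] with ω hω
  simp only [condVar]
  set A : ℝ≥0∞ := ∑' n, condLExp (𝓕 n) P (fun ω' => ‖f (n + 1) ω' - f n ω'‖ₑ ^ 2) ω
  set B : ℝ≥0∞ := ∑' n, condLExp (𝓕 n) P (fun ω' => ‖g (n + 1) ω' - g n ω'‖ₑ ^ 2) ω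
  have h4 : ((4 : ℝ≥0∞)) ^ (1 / 2 : ℝ) = 2 := by
    rw [show (4 : ℝ≥0∞) = 2 ^ (2 : ℝ) by rw [ENNReal.rpow_two]; norm_num, ← ENNReal.rpow_mul]
    norm_num
  calc _ ≤ (4 * (A + B)) ^ (1 / 2 : ℝ) := by
        refine ENNReal.rpow_le_rpow ?_ (by norm_num)
        rw [← ENNReal.tsum_add, ← ENNReal.tsum_mul_left]
        exact ENNReal.tsum_le_tsum hω
    _ = 2 * (A + B) ^ (1 / 2 : ℝ) := by
        rw [ENNReal.mul_rpow_of_nonneg _ _ (by norm_num), h4]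
    _ ≤ _ := by
        push_cast
        gcongr
        exact ENNReal.rpow_add_le_add_rpow _ _ (by norm_num) (by norm_num)

lemma condVar_smul {P : Measure Ω} {𝓕 : Filtration ℕ mΩ} (a : ℝ) (f : ℕ → Ω → ℝ) :
    condVar 𝓕 P (a • f) =ᵐ[P] fun ω => ‖a‖ₑ * condVar 𝓕 P f ω := by
  have h : ∀ n, condLExp (𝓕 n) P (fun ω' => ‖(a • f) (n + 1) ω' - (a • f) n ω'‖ₑ ^ 2) =ᵐ[P]
      fun ω => ‖a‖ₑ ^ 2 * condLExp (𝓕 n) P (fun ω' => ‖f (n + 1) ω' - f n ω'‖ₑ ^ 2) ω := by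
    intro n
    have e : (fun ω' => ‖(a • f) (n + 1) ω' - (a • f) n ω'‖ₑ ^ 2) =
        (‖a‖ₑ ^ 2) • (fun ω' => ‖f (n + 1) ω' - f n ω'‖ₑ ^ 2) := by
      ext ω
      simp only [Pi.smul_apply, smul_eq_mul]
      rw [← mul_sub, enorm_mul, mul_pow]
    rw [e]
    exact condLExp_smul' _ (by finiteness)
  filter_upwards [ae_all_iff.2 h] with ω hω
  simp only [condVar]
  rw [tsum_congr hω, ENNReal.tsum_mul_left, ENNReal.mul_rpow_of_nonneg _ _ (by norm_num),
    ← ENNReal.rpow_natCast, ← ENNReal.rpow_mul]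
  norm_num

/-! ## The martingale Hardy space -/

/-- The martingales `f` with `f_0 = 0` such that `s(f)` has absolutely continuous weak Orlicz
quasi-norm, as a linear subspace of the space of all sequences of functions. -/
def hardySubmodule {ℓ : ℝ} {Φ : ℝ → ℝ} (hΦ : MemG ℓ Φ) (𝓕 : Filtration ℕ mΩ) (P : Measure Ω) :
    Submodule ℝ (ℕ → Ω → ℝ) where
  carrier := {f | Martingale f 𝓕 P ∧ f 0 =ᵐ[P] 0 ∧ HasAbsContNorm Φ P (condVar 𝓕 P f)}
  zero_mem' := by
    refine ⟨martingale_zero _ _ _, EventuallyEq.rfl, ?_⟩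
    refine (hasAbsContNorm_zero Φ P).mono ?_
    have := condVar_smul (P := P) (𝓕 := 𝓕) 0 0
    simp only [zero_smul, enorm_zero, zero_mul] at this
    exact this.le
  add_mem' := by
    rintro f g ⟨hf, hf0, hfs⟩ ⟨hg, hg0, hgs⟩
    refine ⟨hf.add hg, ?_, ((hfs.add hΦ hgs).nat_mul hΦ 2).mono (condVar_add_le hf)⟩
    filter_upwards [hf0, hg0] with ω h1 h2
    simp [h1, h2]
  smul_mem' := by
    rintro a f ⟨hf, hf0, hfs⟩
    refine ⟨hf.smul a, ?_, ?_⟩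
    · filter_upwards [hf0] with ω h1
      simp [h1]
    · obtain ⟨n, hn⟩ := exists_nat_ge ‖a‖₊
      refine (hfs.nat_mul hΦ n).mono ?_
      filter_upwards [condVar_smul (P := P) (𝓕 := 𝓕) a f] with ω h
      rw [h]
      gcongr
      rw [enorm_eq_nnnorm]
      exact_mod_cast hn

/-- The weak Orlicz-Hardy space of martingales `f` with `f_0 = 0` such that `s(f)` has absolutely
continuous weak Orlicz quasi-norm. Martingales are not identified when they agree almost surely;
such an identification would not change the continuous linear functionals. -/
def Hardy {ℓ : ℝ} {Φ : ℝ → ℝ} (hΦ : MemG ℓ Φ) (𝓕 : Filtration ℕ mΩ) (P : Measure Ω) : Type _ :=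
  hardySubmodule hΦ 𝓕 P

namespace Hardy

variable {ℓ : ℝ} {Φ : ℝ → ℝ} {hΦ : MemG ℓ Φ} {𝓕 : Filtration ℕ mΩ} {P : Measure Ω}

instance : AddCommGroup (Hardy hΦ 𝓕 P) := inferInstanceAs (AddCommGroup (hardySubmodule hΦ 𝓕 P))

instance : Module ℝ (Hardy hΦ 𝓕 P) := inferInstanceAs (Module ℝ (hardySubmodule hΦ 𝓕 P))

/-- The martingale underlying an element of the Hardy space. -/
def seq (f : Hardy hΦ 𝓕 P) : ℕ → Ω → ℝ := f.1

/-- The quasi-norm `‖f‖ = ‖s(f)‖` of the weak Orlicz-Hardy space. -/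
def quasiNorm (f : Hardy hΦ 𝓕 P) : ℝ≥0∞ := weakNorm Φ P (condVar 𝓕 P f.seq)

/-- The topology of the quasi-norm: a set is open if it contains a ball around each of its
points. -/
instance : TopologicalSpace (Hardy hΦ 𝓕 P) where
  IsOpen U := ∀ f ∈ U, ∃ ε : ℝ≥0∞, 0 < ε ∧ ∀ g, quasiNorm (g - f) < ε → g ∈ U
  isOpen_univ := fun _ _ => ⟨1, one_pos, fun _ _ => trivial⟩
  isOpen_inter := by
    intro U V hU hV f hf
    obtain ⟨ε, hε, h⟩ := hU f hf.1
    obtain ⟨ε', hε', h'⟩ := hV f hf.2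
    exact ⟨min ε ε', lt_min hε hε', fun g hg =>
      ⟨h g (hg.trans_le (min_le_left _ _)), h' g (hg.trans_le (min_le_right _ _))⟩⟩
  isOpen_sUnion := by
    intro S hS f hf
    obtain ⟨U, hU, hfU⟩ := hf
    obtain ⟨ε, hε, h⟩ := hS U hU f hfU
    exact ⟨ε, hε, fun g hg => ⟨U, hU, h g hg⟩⟩

/-- `f ∈ H_2^s`, that is, `E s(f)² < ∞`. -/
def MemH2 (f : Hardy hΦ 𝓕 P) : Prop := ∫⁻ ω, condVar 𝓕 P f.seq ω ^ 2 ∂P < ∞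

/-- The norm of a continuous linear functional, the supremum of `|l(f)|` over `‖f‖ ≤ 1`. -/
def dualNorm (l : Hardy hΦ 𝓕 P →L[ℝ] ℝ) : ℝ≥0∞ :=
  ⨆ (f : Hardy hΦ 𝓕 P) (_ : quasiNorm f ≤ 1), ‖l f‖ₑ

end Hardy

/-! ## The weak generalized Campanato space -/

/-- The function `φ(r) = 1 / (r Φ⁻¹(1 / r))`. -/
def phi (Φ : ℝ → ℝ) (r : ℝ) : ℝ := 1 / (r * inverse Φ (1 / r))

/-- The limit `g^ν` of the martingale `(E_n g)` stopped at `ν`: it is `g` where `ν = ∞` and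
`E_n g` where `ν = n < ∞`. -/
def stopped (𝓕 : Filtration ℕ mΩ) (P : Measure Ω) (g : Ω → ℝ) (ν : Ω → WithTop ℕ) (ω : Ω) : ℝ :=
  if ν ω = ⊤ then g ω else stoppedValue (fun n => P[g | 𝓕 n]) ν ω

/-- `sup ‖g - g^ν‖_2` over all stopping times `ν` with `P(ν < ∞) ≤ x`. -/
def oscillation (𝓕 : Filtration ℕ mΩ) (P : Measure Ω) (g : Ω → ℝ) (x : ℝ) : ℝ≥0∞ :=
  ⨆ (ν : Ω → WithTop ℕ) (_ : IsStoppingTime 𝓕 ν ∧ P {ω | ν ω < ⊤} ≤ ENNReal.ofReal x),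
    eLpNorm (fun ω => g ω - stopped 𝓕 P g ν ω) 2 P

/-- `t²_φ(x) = φ(x)⁻¹ x^{-1/2} sup ‖g - g^ν‖_2`. -/
def tFun (𝓕 : Filtration ℕ mΩ) (P : Measure Ω) (φ : ℝ → ℝ) (g : Ω → ℝ) (x : ℝ) : ℝ≥0∞ :=
  ENNReal.ofReal (1 / φ x * x ^ (-(1 / 2) : ℝ)) * oscillation 𝓕 P g x

/-- `∫_0^∞ t²_φ(x) / x dx`. -/
def campanatoNorm (𝓕 : Filtration ℕ mΩ) (P : Measure Ω) (φ : ℝ → ℝ) (g : Ω → ℝ) : ℝ≥0∞ :=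
  ∫⁻ x in Set.Ioi (0 : ℝ), tFun 𝓕 P φ g x / ENNReal.ofReal x

lemma measurable_stopped {𝓕 : Filtration ℕ mΩ} {P : Measure Ω} {g : Ω → ℝ}
    (hg : Measurable g) {ν : Ω → WithTop ℕ} (hν : IsStoppingTime 𝓕 ν) :
    Measurable (stopped 𝓕 P g ν) := by
  have hn : ∀ n : ℕ, MeasurableSet {ω | ν ω = n} := fun n => 𝓕.le n _ (hν.measurableSet_eq n)
  have htop : MeasurableSet {ω | ν ω = ⊤} := by
    have : {ω | ν ω = ⊤} = (⋃ n : ℕ, {ω | ν ω = n})ᶜ := by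
      ext ω
      simp only [Set.mem_ofPred_eq, Set.mem_compl_iff, Set.mem_iUnion, not_exists]
      refine ⟨fun h n => by simp [h], fun h => ?_⟩
      by_contra hne
      obtain ⟨n, hn⟩ := WithTop.ne_top_iff_exists.1 hne
      exact h n hn.symm
    rw [this]
    exact (MeasurableSet.iUnion hn).compl
  intro s hs
  have : stopped 𝓕 P g ν ⁻¹' s = ({ω | ν ω = ⊤} ∩ g ⁻¹' s) ∪
      ⋃ n : ℕ, ({ω | ν ω = n} ∩ (P[g | 𝓕 n]) ⁻¹' s) := by
    ext ω
    simp only [Set.mem_preimage, Set.mem_union, Set.mem_inter_iff, Set.mem_ofPred_eq,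
      Set.mem_iUnion, stopped, stoppedValue]
    by_cases h : ν ω = ⊤
    · simp [h]
    · obtain ⟨n, hn⟩ := WithTop.ne_top_iff_exists.1 h
      have hu : ((n : WithTop ℕ)).untopA = n := WithTop.untopD_coe _ n
      simp [← hn, hu]
  rw [this]
  refine (htop.inter (hg hs)).union (MeasurableSet.iUnion fun n => (hn n).inter ?_)
  exact (stronglyMeasurable_condExp.mono (𝓕.le n)).measurable hs

lemma stopped_congr {𝓕 : Filtration ℕ mΩ} {P : Measure Ω} {g h : Ω → ℝ} (hgh : g =ᵐ[P] h)
    (ν : Ω → WithTop ℕ) : stopped 𝓕 P g ν =ᵐ[P] stopped 𝓕 P h ν := by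
  have : ∀ n, P[g | 𝓕 n] =ᵐ[P] P[h | 𝓕 n] := fun n => condExp_congr_ae hgh
  filter_upwards [hgh, ae_all_iff.2 this] with ω h1 h2
  simp only [stopped, stoppedValue, h1, h2]

lemma stopped_add {𝓕 : Filtration ℕ mΩ} {P : Measure Ω} {g h : Ω → ℝ} (hg : Integrable g P)
    (hh : Integrable h P) (ν : Ω → WithTop ℕ) :
    stopped 𝓕 P (g + h) ν =ᵐ[P] fun ω => stopped 𝓕 P g ν ω + stopped 𝓕 P h ν ω := by
  have : ∀ n, P[g + h | 𝓕 n] =ᵐ[P] P[g | 𝓕 n] + P[h | 𝓕 n] := fun n => condExp_add hg hh _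
  filter_upwards [ae_all_iff.2 this] with ω h1
  simp only [stopped, stoppedValue, h1, Pi.add_apply]
  split_ifs <;> rfl

lemma stopped_smul {𝓕 : Filtration ℕ mΩ} {P : Measure Ω} (a : ℝ) (g : Ω → ℝ)
    (ν : Ω → WithTop ℕ) :
    stopped 𝓕 P (a • g) ν =ᵐ[P] fun ω => a * stopped 𝓕 P g ν ω := by
  have : ∀ n, P[a • g | 𝓕 n] =ᵐ[P] a • P[g | 𝓕 n] := fun n => condExp_smul a g _
  filter_upwards [ae_all_iff.2 this] with ω h1
  simp only [stopped, stoppedValue, h1, Pi.smul_apply, smul_eq_mul]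
  split_ifs <;> rfl

lemma oscillation_congr {𝓕 : Filtration ℕ mΩ} {P : Measure Ω} {g h : Ω → ℝ} (hgh : g =ᵐ[P] h)
    (x : ℝ) : oscillation 𝓕 P g x = oscillation 𝓕 P h x := by
  refine iSup_congr fun ν => iSup_congr fun _ => eLpNorm_congr_ae ?_
  filter_upwards [hgh, stopped_congr (𝓕 := 𝓕) hgh ν] with ω h1 h2
  rw [h1, h2]

lemma oscillation_add_le {𝓕 : Filtration ℕ mΩ} {P : Measure Ω} {g h : Ω → ℝ}
    (hg : Integrable g P) (hh : Integrable h P) (hgm : Measurable g) (hhm : Measurable h) (x : ℝ) :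
    oscillation 𝓕 P (g + h) x ≤ oscillation 𝓕 P g x + oscillation 𝓕 P h x := by
  refine iSup₂_le fun ν hν => ?_
  have e : (fun ω => (g + h) ω - stopped 𝓕 P (g + h) ν ω) =ᵐ[P]
      (fun ω => g ω - stopped 𝓕 P g ν ω) + (fun ω => h ω - stopped 𝓕 P h ν ω) := by
    filter_upwards [stopped_add (𝓕 := 𝓕) hg hh ν] with ω h1
    simp only [Pi.add_apply, h1]
    ring
  rw [eLpNorm_congr_ae e]
  refine (eLpNorm_add_le (hgm.sub (measurable_stopped hgm hν.1)).aestronglyMeasurable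
    (hhm.sub (measurable_stopped hhm hν.1)).aestronglyMeasurable (by norm_num)).trans ?_
  exact add_le_add (le_iSup₂_of_le ν hν le_rfl) (le_iSup₂_of_le ν hν le_rfl)

lemma oscillation_smul_le {𝓕 : Filtration ℕ mΩ} {P : Measure Ω} (a : ℝ) (g : Ω → ℝ) (x : ℝ) :
    oscillation 𝓕 P (a • g) x ≤ ‖a‖ₑ * oscillation 𝓕 P g x := by
  refine iSup₂_le fun ν hν => ?_
  have e : (fun ω => (a • g) ω - stopped 𝓕 P (a • g) ν ω) =ᵐ[P]
      a • (fun ω => g ω - stopped 𝓕 P g ν ω) := by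
    filter_upwards [stopped_smul (P := P) (𝓕 := 𝓕) a g ν] with ω h1
    simp only [Pi.smul_apply, smul_eq_mul, h1]
    ring
  rw [eLpNorm_congr_ae e, eLpNorm_const_smul]
  gcongr
  exact le_iSup₂_of_le ν hν le_rfl

lemma measurable_oscillation (𝓕 : Filtration ℕ mΩ) (P : Measure Ω) (g : Ω → ℝ) :
    Measurable (oscillation 𝓕 P g) := by
  refine Monotone.measurable fun x y hxy => iSup₂_le fun ν hν => ?_
  exact le_iSup₂_of_le ν ⟨hν.1, hν.2.trans (ENNReal.ofReal_le_ofReal hxy)⟩ le_rfl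

lemma campanatoNorm_add_lt_top {𝓕 : Filtration ℕ mΩ} {P : Measure Ω} {φ : ℝ → ℝ} {g h k : Ω → ℝ}
    (hk : ∀ x, oscillation 𝓕 P k x ≤ oscillation 𝓕 P g x + oscillation 𝓕 P h x)
    (hg : campanatoNorm 𝓕 P φ g < ∞) (hh : campanatoNorm 𝓕 P φ h < ∞) :
    campanatoNorm 𝓕 P φ k < ∞ := by
  simp only [campanatoNorm, tFun] at *
  set w : ℝ → ℝ≥0∞ := fun x => ENNReal.ofReal (1 / φ x * x ^ (-(1 / 2) : ℝ))
  set A : Set ℝ := {x | oscillation 𝓕 P g x ≤ oscillation 𝓕 P h x}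
  have hA : MeasurableSet A :=
    measurableSet_le (measurable_oscillation 𝓕 P g) (measurable_oscillation 𝓕 P h)
  rw [← lintegral_add_compl _ hA, ENNReal.add_lt_top]
  have h2 : ∀ x, ∀ a b c : ℝ≥0∞, c ≤ a + b → a ≤ b → w x * c / ENNReal.ofReal x ≤
      2 * (w x * b / ENNReal.ofReal x) := by
    intro x a b c hc hab
    have : c ≤ 2 * b := hc.trans (by rw [two_mul]; gcongr)
    calc w x * c / ENNReal.ofReal x ≤ w x * (2 * b) / ENNReal.ofReal x := by gcongr
      _ = _ := by simp only [div_eq_mul_inv]; ring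
  constructor
  · calc _ ≤ ∫⁻ x in A, 2 * (w x * oscillation 𝓕 P h x / ENNReal.ofReal x)
          ∂(volume.restrict (Set.Ioi 0)) :=
          setLIntegral_mono' hA fun x hx => h2 x _ _ _ (hk x) hx
      _ ≤ ∫⁻ x in Set.Ioi (0 : ℝ), 2 * (w x * oscillation 𝓕 P h x / ENNReal.ofReal x) :=
          setLIntegral_le_lintegral _ _
      _ = 2 * ∫⁻ x in Set.Ioi (0 : ℝ), w x * oscillation 𝓕 P h x / ENNReal.ofReal x :=
          lintegral_const_mul' _ _ (by norm_num)
      _ < ∞ := ENNReal.mul_lt_top (by norm_num) hh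
  · calc _ ≤ ∫⁻ x in Aᶜ, 2 * (w x * oscillation 𝓕 P g x / ENNReal.ofReal x)
          ∂(volume.restrict (Set.Ioi 0)) :=
          setLIntegral_mono' hA.compl fun x hx =>
            h2 x _ _ _ ((hk x).trans_eq (add_comm _ _)) (le_of_not_ge hx)
      _ ≤ ∫⁻ x in Set.Ioi (0 : ℝ), 2 * (w x * oscillation 𝓕 P g x / ENNReal.ofReal x) :=
          setLIntegral_le_lintegral _ _
      _ = 2 * ∫⁻ x in Set.Ioi (0 : ℝ), w x * oscillation 𝓕 P g x / ENNReal.ofReal x :=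
          lintegral_const_mul' _ _ (by norm_num)
      _ < ∞ := ENNReal.mul_lt_top (by norm_num) hg

/-- The weak generalized Campanato space: the `g ∈ L_2` with `E_0 g = 0` and
`∫_0^∞ t²_φ(x) / x dx < ∞`. -/
def Campanato (𝓕 : Filtration ℕ mΩ) (P : Measure Ω) [IsFiniteMeasure P] (φ : ℝ → ℝ) :
    Submodule ℝ (Lp ℝ 2 P) where
  carrier := {g | P[g | 𝓕 0] =ᵐ[P] 0 ∧ campanatoNorm 𝓕 P φ g < ∞}
  zero_mem' := by
    have h0 := Lp.coeFn_zero ℝ 2 P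
    refine ⟨(condExp_congr_ae h0).trans (by rw [condExp_zero]), ?_⟩
    have h : ∀ x, oscillation 𝓕 P ((0 : Lp ℝ 2 P) : Ω → ℝ) x = 0 := by
      intro x
      rw [oscillation_congr h0]
      have := oscillation_smul_le (𝓕 := 𝓕) (P := P) 0 0 x
      simpa using this
    simp only [campanatoNorm, tFun, h, mul_zero, ENNReal.zero_div, lintegral_zero]
    exact ENNReal.zero_lt_top
  add_mem' := by
    rintro g h ⟨hg0, hg⟩ ⟨hh0, hh⟩
    have hgi : Integrable g P := (Lp.memLp g).integrable (by norm_num)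
    have hhi : Integrable h P := (Lp.memLp h).integrable (by norm_num)
    have hc := Lp.coeFn_add g h
    refine ⟨?_, campanatoNorm_add_lt_top (g := g) (h := h) (fun x => ?_) hg hh⟩
    · refine ((condExp_congr_ae hc).trans (condExp_add hgi hhi _)).trans ?_
      filter_upwards [hg0, hh0] with ω h1 h2
      simp [h1, h2]
    · rw [oscillation_congr hc]
      exact oscillation_add_le hgi hhi (Lp.stronglyMeasurable g).measurable
        (Lp.stronglyMeasurable h).measurable x
  smul_mem' := by
    rintro a g ⟨hg0, hg⟩
    have hc := Lp.coeFn_smul a g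
    refine ⟨?_, ?_⟩
    · refine ((condExp_congr_ae hc).trans (condExp_smul a _ _)).trans ?_
      filter_upwards [hg0] with ω h1
      simp [h1]
    · refine lt_of_le_of_lt ?_ (ENNReal.mul_lt_top (enorm_lt_top (x := a)) hg)
      rw [campanatoNorm, campanatoNorm, ← lintegral_const_mul' _ _ enorm_ne_top]
      refine lintegral_mono fun x => ?_
      simp only [tFun]
      rw [oscillation_congr hc]
      calc _ ≤ ENNReal.ofReal (1 / φ x * x ^ (-(1 / 2) : ℝ)) *
            (‖a‖ₑ * oscillation 𝓕 P g x) / ENNReal.ofReal x := by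
            gcongr
            exact oscillation_smul_le a _ x
        _ = _ := by simp only [div_eq_mul_inv]; ring

/-- The integrand `∑_{n ≥ 1} df_n dg_n` of the duality pairing; here `dg_n = E_n g - E_{n-1} g`. -/
def pairingTerm (𝓕 : Filtration ℕ mΩ) (P : Measure Ω) (f : ℕ → Ω → ℝ) (g : Ω → ℝ) (n : ℕ)
    (ω : Ω) : ℝ :=
  (f (n + 1) ω - f n ω) * ((P[g | 𝓕 (n + 1)]) ω - (P[g | 𝓕 n]) ω)

end WeakOrlicz

end

open WeakOrlicz

/-!
# The dual of a weak Orlicz-Hardy space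

The proof works at dyadic scales. Put `level Φ k = Φ⁻¹(2 ^ k)` and
`weight Φ k = level Φ k * √(2 ^ (-k))`. Since `Φ` is concave and of lower type `ℓ`, its inverse is
doubling (`MemG.exists_doubling`), and the weights grow at least like the powers of `√2`
(`sum_weight_le`). Consequently

* up to constants, the weak quasi-norm of `u` is at most `1` if and only if
  `P(u > level Φ k) ≤ 2 ^ (-k)` for all `k` (`measure_lt_level_le` and
  `weakNorm_le_of_measure_lt_level_le`);
* the Campanato norm of `g` is comparable to `∑ k, weight Φ k * oscillation (2 ^ (-k))`
  (`tsum_weight_mul_oscillation_le` and `campanatoNorm_le_tsum`).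

**Boundedness of the pairing.** Let `f` have quasi-norm less than `1`, and sort the pairs `(n, ω)`
by the dyadic level at which the predictable quantity `s_{n+1}(f)` lies. The pairs with
`s_{n+1}(f) > level Φ k` are those with `n ≥ ν`, where the stopping time `ν` satisfies
`P(ν < ∞) ≤ P(s(f) > level Φ k) ≤ 2 ^ (-k)`. On the pairs between two consecutive levels the
Cauchy-Schwarz inequality bounds `∑ |df_n dg_n|` by the `L_2` norm of `s(f)` stopped at the upper
level, which is at most a multiple of `level Φ k * √(2 ^ (-k))`, times `‖g - g^ν‖_2`. Summation over
`k` gives the Campanato norm (`tsum_lintegral_mul_le_tsum_weight`). This applies to every `f` in the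
Hardy space, so that the functional `l_g` is given by the same absolutely convergent formula on the
whole space (`Hardy.dualMap`).

**Density.** If the increments of `f` are dropped from the time when `s_{n+1}(f)` exceeds a large
constant, then only a part of `s(f)` carried by a set of small probability is lost, and the absolute
continuity of the quasi-norm makes it small. So square integrable martingales that are constant from
some time on are dense, and a continuous functional that vanishes on them vanishes
(`Hardy.eq_zero_of_forall_ofMemLp`). This gives the uniqueness of `l_g`.

**Every functional is represented.** A functional `l` is continuous for the `L_2` norm on square
integrable functions, and there it is the inner product with some `g ∈ L_2` by the Riesz theorem
(`Hardy.exists_riesz`). To bound the Campanato norm of `g`, choose stopping times `ν_k` with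
`P(ν_k < ∞) ≤ 2 ^ (-k)` that almost attain the oscillation at `2 ^ (-k)`, and apply `l` to
`h = ∑ k < N, weight Φ k * (g - g^{ν_k}) / ‖g - g^{ν_k}‖_2`. As `g - g^{ν_k}` is an orthogonal
projection of `g`, the value is `∑ k < N, weight Φ k * ‖g - g^{ν_k}‖_2`. The quasi-norm of `h` is
bounded independently of `N`: at level `j` the terms with `k > j + 1` have no variation outside the
union of the sets `{ν_k < ∞}`, which has probability at most `2 ^ (-j - 1)`, and the other terms
have `L_2` norm at most `∑ k ≤ j + 1, weight Φ k`, a geometric sum controlled by its last term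
(`quasiNorm_sum_sub_stopped_le`, `campanatoNorm_le_dualNorm`).

Finally `g ↦ l_g` is injective since `l_g` determines every `E_N g` (`Hardy.dualMap_injective`).
-/

noncomputable section

namespace WeakOrlicz

/-! ### Concave functions of lower type and their inverses -/

section OrliczFunction

variable {ℓ : ℝ} {Φ : ℝ → ℝ}

lemma MemG.strictMonoOn (hΦ : MemG ℓ Φ) (hconc : ConcaveOn ℝ (Set.Ici 0) Φ) :
    StrictMonoOn Φ (Set.Ici 0) := by
  intro x hx y hy hxy
  by_contra! hle
  obtain ⟨z, hz, hzy⟩ := ((hΦ.tendsto_atTop.eventually_gt_atTop (Φ x)).and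
    (eventually_gt_atTop y)).exists
  have h := hconc.slope_anti_adjacent hx (le_trans (Set.mem_Ici.1 hy) hzy.le) hxy hzy
  have h1 : (Φ y - Φ x) / (y - x) ≤ 0 :=
    div_nonpos_of_nonpos_of_nonneg (by linarith) (by linarith)
  have h2 : 0 < (Φ z - Φ y) / (z - y) := div_pos (by linarith) (by linarith)
  linarith

lemma MemG.exists_apply_lt (hΦ : MemG ℓ Φ) {y : ℝ} (hy : 0 < y) :
    ∃ x, 0 < x ∧ Φ x < y := by
  obtain ⟨c, hc1, hc⟩ := hΦ.type_bound
  have ht : Tendsto (fun t : ℝ => c * max (t ^ ℓ) t * Φ 1) (𝓝 0)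
      (𝓝 (c * max ((0 : ℝ) ^ ℓ) 0 * Φ 1)) := by
    refine ((Tendsto.max ?_ tendsto_id).const_mul c).mul_const _
    exact (Real.continuousAt_rpow_const 0 ℓ (Or.inr hΦ.exp_pos.le)).tendsto
  rw [Real.zero_rpow hΦ.exp_pos.ne', max_self, mul_zero, zero_mul] at ht
  obtain ⟨x, h1, h2⟩ := (((ht.mono_left (nhdsWithin_le_nhds (s := Set.Ioi 0))).eventually_lt_const
    hy).and self_mem_nhdsWithin).exists
  have h2' : (0 : ℝ) < x := h2
  refine ⟨x, h2', lt_of_le_of_lt ?_ h1⟩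
  simpa using hc x 1 h2'.le zero_le_one

lemma MemG.exists_apply_eq (hΦ : MemG ℓ Φ) (hconc : ConcaveOn ℝ (Set.Ici 0) Φ) {y : ℝ}
    (hy : 0 ≤ y) : ∃ x ∈ Set.Ici (0 : ℝ), Φ x = y := by
  rcases hy.eq_or_lt with rfl | hy
  · exact ⟨0, Set.mem_Ici.2 le_rfl, hΦ.map_zero⟩
  obtain ⟨a, ha, hay⟩ := hΦ.exists_apply_lt hy
  obtain ⟨b, hb, hab⟩ := ((hΦ.tendsto_atTop.eventually_gt_atTop y).and
    (eventually_gt_atTop a)).exists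
  have hcont : ContinuousOn Φ (Set.Icc a b) := by
    have h := (hconc.subset Set.Ioi_subset_Ici_self (convex_Ioi 0)).continuousOn isOpen_Ioi
    exact h.mono fun x hx => ha.trans_le hx.1
  obtain ⟨x, hx, rfl⟩ := intermediate_value_Icc hab.le hcont ⟨hay.le, hb.le⟩
  exact ⟨x, ha.le.trans hx.1, rfl⟩

lemma MemG.inverse_nonneg (hΦ : MemG ℓ Φ) (hconc : ConcaveOn ℝ (Set.Ici 0) Φ) {y : ℝ}
    (hy : 0 ≤ y) : 0 ≤ inverse Φ y :=
  Function.invFunOn_mem (hΦ.exists_apply_eq hconc hy)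

lemma MemG.apply_inverse (hΦ : MemG ℓ Φ) (hconc : ConcaveOn ℝ (Set.Ici 0) Φ) {y : ℝ}
    (hy : 0 ≤ y) : Φ (inverse Φ y) = y :=
  Function.invFunOn_eq (hΦ.exists_apply_eq hconc hy)

lemma MemG.inverse_le (hΦ : MemG ℓ Φ) (hconc : ConcaveOn ℝ (Set.Ici 0) Φ) {x y : ℝ}
    (hy : 0 ≤ y) (hx : 0 ≤ x) (h : y ≤ Φ x) : inverse Φ y ≤ x := by
  rw [← hΦ.apply_inverse hconc hy] at h
  exact ((hΦ.strictMonoOn hconc).le_iff_le (hΦ.inverse_nonneg hconc hy) hx).1 h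

lemma MemG.le_inverse (hΦ : MemG ℓ Φ) (hconc : ConcaveOn ℝ (Set.Ici 0) Φ) {x y : ℝ}
    (hy : 0 ≤ y) (hx : 0 ≤ x) (h : Φ x ≤ y) : x ≤ inverse Φ y := by
  rw [← hΦ.apply_inverse hconc hy] at h
  exact ((hΦ.strictMonoOn hconc).le_iff_le hx (hΦ.inverse_nonneg hconc hy)).1 h

lemma MemG.inverse_mono (hΦ : MemG ℓ Φ) (hconc : ConcaveOn ℝ (Set.Ici 0) Φ) {x y : ℝ}
    (hx : 0 ≤ x) (h : x ≤ y) : inverse Φ x ≤ inverse Φ y :=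
  hΦ.inverse_le hconc hx (hΦ.inverse_nonneg hconc (hx.trans h))
    (by rwa [hΦ.apply_inverse hconc (hx.trans h)])

lemma MemG.inverse_pos (hΦ : MemG ℓ Φ) (hconc : ConcaveOn ℝ (Set.Ici 0) Φ) {y : ℝ}
    (hy : 0 < y) : 0 < inverse Φ y := by
  refine (hΦ.inverse_nonneg hconc hy.le).lt_of_ne fun h => ?_
  have := hΦ.apply_inverse hconc hy.le
  rw [← h, hΦ.map_zero] at this
  exact hy.ne this

lemma MemG.mul_apply_le (hΦ : MemG ℓ Φ) (hconc : ConcaveOn ℝ (Set.Ici 0) Φ) {a x : ℝ}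
    (ha : 0 ≤ a) (ha1 : a ≤ 1) (hx : 0 ≤ x) : a * Φ x ≤ Φ (a * x) := by
  have := hconc.2 (Set.mem_Ici.2 hx) (Set.mem_Ici.2 le_rfl) ha (sub_nonneg.2 ha1) (by ring)
  simpa [hΦ.map_zero] using this

/-- The inverse is convex and vanishes at `0`, hence it is star-shaped. -/
lemma MemG.inverse_mul_le (hΦ : MemG ℓ Φ) (hconc : ConcaveOn ℝ (Set.Ici 0) Φ) {a s : ℝ}
    (ha : 0 ≤ a) (ha1 : a ≤ 1) (hs : 0 ≤ s) : inverse Φ (a * s) ≤ a * inverse Φ s := by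
  refine hΦ.inverse_le hconc (by positivity) (mul_nonneg ha (hΦ.inverse_nonneg hconc hs)) ?_
  simpa [hΦ.apply_inverse hconc hs] using
    hΦ.mul_apply_le hconc ha ha1 (hΦ.inverse_nonneg hconc hs)

/-- The lower type of `Φ` makes the inverse doubling. -/
lemma MemG.exists_doubling (hΦ : MemG ℓ Φ) (hconc : ConcaveOn ℝ (Set.Ici 0) Φ) :
    ∃ D : ℝ, 1 ≤ D ∧ ∀ s, 0 ≤ s → inverse Φ (2 * s) ≤ D * inverse Φ s := by
  obtain ⟨c, hc1, hc⟩ := hΦ.type_bound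
  have hℓ := hΦ.exp_pos
  -- `t` solves `c t ^ ℓ = 1 / 2`
  set t : ℝ := (1 / (2 * c)) ^ (1 / ℓ) with ht
  have hb : 1 / (2 * c) ≤ 1 := by rw [div_le_one (by linarith)]; linarith
  have ht0 : 0 < t := by positivity
  have ht1 : t ≤ 1 := Real.rpow_le_one (by positivity) hb (by positivity)
  have htℓ : t ^ ℓ = 1 / (2 * c) := by
    rw [ht, ← Real.rpow_mul (by positivity), one_div ℓ, inv_mul_cancel₀ hℓ.ne', Real.rpow_one]
  have htt : t ≤ t ^ ℓ := by
    simpa using Real.rpow_le_rpow_of_exponent_ge ht0 ht1 hΦ.exp_le_one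
  refine ⟨1 / t, by rw [le_div_iff₀ ht0]; linarith, fun s hs => ?_⟩
  have h2 : 0 ≤ 2 * s := by linarith
  have h := hc t (inverse Φ (2 * s)) ht0.le (hΦ.inverse_nonneg hconc h2)
  rw [max_eq_left htt, htℓ, hΦ.apply_inverse hconc h2] at h
  have h' : t * inverse Φ (2 * s) ≤ inverse Φ s := by
    refine hΦ.le_inverse hconc hs (mul_nonneg ht0.le (hΦ.inverse_nonneg hconc h2)) (h.trans_eq ?_)
    field_simp
  rw [div_mul_eq_mul_div, one_mul, le_div_iff₀ ht0]
  linarith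

/-- The dyadic levels `Φ⁻¹(2 ^ k)`. -/
def level (Φ : ℝ → ℝ) (k : ℕ) : ℝ := inverse Φ (2 ^ k)

lemma level_pos (hΦ : MemG ℓ Φ) (hconc : ConcaveOn ℝ (Set.Ici 0) Φ) (k : ℕ) : 0 < level Φ k :=
  hΦ.inverse_pos hconc (by positivity)

lemma apply_level (hΦ : MemG ℓ Φ) (hconc : ConcaveOn ℝ (Set.Ici 0) Φ) (k : ℕ) :
    Φ (level Φ k) = 2 ^ k :=
  hΦ.apply_inverse hconc (by positivity)

lemma level_le_pow_mul (hΦ : MemG ℓ Φ) (hconc : ConcaveOn ℝ (Set.Ici 0) Φ) {k j : ℕ}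
    (h : k ≤ j) : level Φ k ≤ (1 / 2) ^ (j - k) * level Φ j := by
  have := hΦ.inverse_mul_le hconc (a := (1 / 2) ^ (j - k)) (s := 2 ^ j) (by positivity)
    (pow_le_one₀ (by norm_num) (by norm_num)) (by positivity)
  refine le_of_eq_of_le ?_ this
  rw [level]
  congr 1
  obtain ⟨i, rfl⟩ := Nat.exists_eq_add_of_le h
  rw [Nat.add_sub_cancel_left, pow_add, mul_left_comm, ← mul_pow]
  norm_num

lemma tendsto_level (hΦ : MemG ℓ Φ) (hconc : ConcaveOn ℝ (Set.Ici 0) Φ) :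
    Tendsto (level Φ) atTop atTop := by
  refine tendsto_atTop_mono (f := fun k => 2 ^ k * level Φ 0) (fun k => ?_)
    ((tendsto_pow_atTop_atTop_of_one_lt one_lt_two).atTop_mul_const (level_pos hΦ hconc 0))
  have := level_le_pow_mul hΦ hconc (Nat.zero_le k)
  calc 2 ^ k * level Φ 0 ≤ 2 ^ k * ((1 / 2) ^ (k - 0) * level Φ k) := by gcongr
    _ = level Φ k := by
      rw [Nat.sub_zero, ← mul_assoc, ← mul_pow]
      norm_num

lemma level_succ_le {D : ℝ} (hD : ∀ s, 0 ≤ s → inverse Φ (2 * s) ≤ D * inverse Φ s) (k : ℕ) :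
    level Φ (k + 1) ≤ D * level Φ k := by
  have := hD (2 ^ k) (by positivity)
  rwa [← pow_succ'] at this

end OrliczFunction

/-! ### The weak Orlicz quasi-norm -/

section WeakNorm

variable {Ω : Type*} [mΩ : MeasurableSpace Ω] {ℓ : ℝ} {Φ : ℝ → ℝ} {P : Measure Ω}
  {u : Ω → ℝ≥0∞}

lemma exists_of_weakNorm_lt {ρ : ℝ≥0∞} (h : weakNorm Φ P u < ρ) :
    ∃ r : ℝ, (0 < r ∧ ∀ t : ℝ, 0 < t →
      ENNReal.ofReal (Φ (t / r)) * P {ω | ENNReal.ofReal t < u ω} ≤ 1) ∧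
      ENNReal.ofReal r < ρ := by
  simpa only [weakNorm, iInf_lt_iff, exists_prop] using h

lemma weakNorm_const_mul_le {a : ℝ} (ha : 0 < a) :
    weakNorm Φ P (fun ω => ENNReal.ofReal a * u ω) ≤ ENNReal.ofReal a * weakNorm Φ P u := by
  refine ENNReal.le_of_forall_pos_le_add fun ε hε hfin => ?_
  have ha0 : ENNReal.ofReal a ≠ 0 := by simpa using ha
  have hη : ENNReal.ofReal (ε / a) ≠ 0 := by
    rw [Ne, ENNReal.ofReal_eq_zero, not_le]
    exact div_pos (by exact_mod_cast hε) ha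
  have hu : weakNorm Φ P u ≠ ∞ := by
    intro h
    rw [h, ENNReal.mul_top ha0] at hfin
    exact lt_irrefl _ hfin
  obtain ⟨r, ⟨hr, H⟩, hlt⟩ := exists_of_weakNorm_lt (ENNReal.lt_add_right hu hη)
  have h1 : weakNorm Φ P (fun ω => ENNReal.ofReal a * u ω) ≤ ENNReal.ofReal (a * r) := by
    refine iInf₂_le _ ⟨by positivity, fun t ht => ?_⟩
    have := H (t / a) (by positivity)
    rw [div_div] at this
    convert this using 4
    ext ω
    rw [ENNReal.ofReal_div_of_pos ha, ENNReal.div_lt_iff (Or.inl ha0)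
      (Or.inl ENNReal.ofReal_ne_top), mul_comm]
  calc _ ≤ ENNReal.ofReal (a * r) := h1
    _ = ENNReal.ofReal a * ENNReal.ofReal r := ENNReal.ofReal_mul ha.le
    _ ≤ ENNReal.ofReal a * (weakNorm Φ P u + ENNReal.ofReal (ε / a)) := by gcongr
    _ = ENNReal.ofReal a * weakNorm Φ P u + ε := by
      rw [mul_add, ← ENNReal.ofReal_mul ha.le, mul_div_cancel₀ _ ha.ne', ENNReal.ofReal_coe_nnreal]

/-- The tail bound at the dyadic levels that a bound of the weak quasi-norm gives. -/
lemma measure_lt_level_le (hΦ : MemG ℓ Φ) (hconc : ConcaveOn ℝ (Set.Ici 0) Φ) {ρ : ℝ}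
    (h : weakNorm Φ P u < ENNReal.ofReal ρ) (k : ℕ) :
    P {ω | ENNReal.ofReal (ρ * level Φ k) < u ω} ≤ (1 / 2) ^ k := by
  obtain ⟨r, ⟨hr, H⟩, hlt⟩ := exists_of_weakNorm_lt h
  have hrρ : r < ρ := (ENNReal.ofReal_lt_ofReal_iff_of_nonneg hr.le).1 hlt
  have hl := level_pos hΦ hconc k
  have := H (r * level Φ k) (by positivity)
  rw [mul_div_cancel_left₀ _ hr.ne', apply_level hΦ hconc, ENNReal.ofReal_pow (by norm_num),
    ENNReal.ofReal_ofNat] at this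
  calc P {ω | ENNReal.ofReal (ρ * level Φ k) < u ω}
      ≤ P {ω | ENNReal.ofReal (r * level Φ k) < u ω} := by
        refine measure_mono fun ω hω => ?_
        rw [Set.mem_ofPred_eq] at hω ⊢
        exact lt_of_le_of_lt (ENNReal.ofReal_le_ofReal (by gcongr)) hω
    _ ≤ (1 / 2) ^ k := by
        rw [one_div, ← ENNReal.inv_pow, ← one_div]
        rw [ENNReal.le_div_iff_mul_le (by simp) (by simp), mul_comm]
        exact this

/-- Conversely, dyadic tail bounds control the weak quasi-norm. -/
lemma weakNorm_le_of_measure_lt_level_le [IsProbabilityMeasure P] (hΦ : MemG ℓ Φ)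
    (hconc : ConcaveOn ℝ (Set.Ici 0) Φ) {D : ℝ} (hD1 : 1 ≤ D)
    (hD : ∀ s, 0 ≤ s → inverse Φ (2 * s) ≤ D * inverse Φ s) {a : ℝ} (ha : 0 < a)
    (h : ∀ k : ℕ, P {ω | ENNReal.ofReal (a * level Φ k) < u ω} ≤ (1 / 2) ^ k) :
    weakNorm Φ P u ≤ ENNReal.ofReal (D * a) := by
  have hD0 : 0 < D := by linarith
  refine iInf₂_le _ ⟨by positivity, fun t ht => ?_⟩
  have hmono := (hΦ.strictMonoOn hconc).monotoneOn
  by_cases h0 : t < a * level Φ 0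
  · have : Φ (t / (D * a)) ≤ 1 := by
      rw [← pow_zero (2 : ℝ), ← apply_level hΦ hconc 0]
      refine hmono (by positivity : (0 : ℝ) ≤ _) (level_pos hΦ hconc 0).le ?_
      rw [div_le_iff₀ (by positivity)]
      nlinarith [level_pos hΦ hconc 0, mul_pos ha (level_pos hΦ hconc 0)]
    calc _ ≤ ENNReal.ofReal 1 * 1 := by
          gcongr
          exact prob_le_one
      _ = 1 := by simp
  -- `k` is the index with `a Φ⁻¹(2 ^ k) ≤ t < a Φ⁻¹(2 ^ (k + 1))`
  have hex : ∃ k : ℕ, t < a * level Φ k :=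
    (((tendsto_level hΦ hconc).const_mul_atTop ha).eventually_gt_atTop t).exists
  classical
  obtain ⟨k, hk⟩ : ∃ k, Nat.find hex = k + 1 :=
    Nat.exists_eq_succ_of_ne_zero fun h' => h0 (h' ▸ Nat.find_spec hex)
  have h1 : t < a * level Φ (k + 1) := hk ▸ Nat.find_spec hex
  have h2 : a * level Φ k ≤ t := not_lt.1 (Nat.find_min hex (by omega))
  have h3 : Φ (t / (D * a)) ≤ 2 ^ k := by
    rw [← apply_level hΦ hconc k]
    refine hmono (by positivity : (0 : ℝ) ≤ _) (level_pos hΦ hconc k).le ?_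
    rw [div_le_iff₀ (by positivity)]
    nlinarith [level_succ_le hD k]
  calc ENNReal.ofReal (Φ (t / (D * a))) * P {ω | ENNReal.ofReal t < u ω}
      ≤ ENNReal.ofReal (2 ^ k) * (1 / 2) ^ k := by
        gcongr
        refine le_trans (measure_mono fun ω hω => ?_) (h k)
        rw [Set.mem_ofPred_eq] at hω ⊢
        exact lt_of_le_of_lt (ENNReal.ofReal_le_ofReal h2) hω
    _ = 1 := by
        rw [ENNReal.ofReal_pow (by norm_num), ENNReal.ofReal_ofNat, ← mul_pow, one_div,
          ENNReal.mul_inv_cancel (by simp) (by simp), one_pow]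

lemma measure_lt_le_of_lintegral_sq_le (hu : AEMeasurable u P) {a t : ℝ} (ha : 0 ≤ a)
    (ht : 0 < t) (h : ∫⁻ ω, u ω ^ 2 ∂P ≤ ENNReal.ofReal a ^ 2) :
    P {ω | ENNReal.ofReal t < u ω} ≤ ENNReal.ofReal ((a / t) ^ 2) := by
  have h1 : P {ω | ENNReal.ofReal t < u ω} ≤ P {ω | ENNReal.ofReal t ^ 2 ≤ u ω ^ 2} := by
    refine measure_mono fun ω hω => ?_
    have hω' : ENNReal.ofReal t < u ω := hω
    show ENNReal.ofReal t ^ 2 ≤ u ω ^ 2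
    gcongr
  refine h1.trans ((meas_ge_le_lintegral_div (hu.pow_const 2) ?_ ?_).trans ?_)
  · simpa using ht
  · simp
  · rw [div_pow, ENNReal.ofReal_div_of_pos (by positivity), ENNReal.ofReal_pow ha,
      ENNReal.ofReal_pow ht.le]
    gcongr

/-- `L_2` embeds continuously into the weak Orlicz space, because `Φ` grows at most linearly. -/
lemma weakNorm_le_of_lintegral_sq_le [IsProbabilityMeasure P] (hΦ : MemG ℓ Φ)
    (hconc : ConcaveOn ℝ (Set.Ici 0) Φ) (hu : AEMeasurable u P) {a : ℝ} (ha : 0 < a)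
    (h : ∫⁻ ω, u ω ^ 2 ∂P ≤ ENNReal.ofReal a ^ 2) :
    weakNorm Φ P u ≤ ENNReal.ofReal (a / level Φ 0) := by
  have hl := level_pos hΦ hconc 0
  refine iInf₂_le _ ⟨by positivity, fun t ht => ?_⟩
  have e : t / (a / level Φ 0) = t / a * level Φ 0 := by field_simp
  rw [e]
  rcases le_or_gt t a with hta | hta
  · have : Φ (t / a * level Φ 0) ≤ 1 := by
      rw [← pow_zero (2 : ℝ), ← apply_level hΦ hconc 0]
      refine (hΦ.strictMonoOn hconc).monotoneOn (by positivity : (0 : ℝ) ≤ _) hl.le ?_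
      exact mul_le_of_le_one_left hl.le ((div_le_one ha).2 hta)
    calc _ ≤ ENNReal.ofReal 1 * 1 := by
          gcongr
          exact prob_le_one
      _ = 1 := by simp
  · have h1 : Φ (t / a * level Φ 0) ≤ t / a := by
      have := hΦ.mul_apply_le hconc (a := a / t) (x := t / a * level Φ 0) (by positivity)
        ((div_le_one ht).2 hta.le) (by positivity)
      rw [show a / t * (t / a * level Φ 0) = level Φ 0 by field_simp, apply_level hΦ hconc,
        pow_zero, div_mul_eq_mul_div, div_le_one ht] at this
      rwa [le_div_iff₀ ha, mul_comm]
    calc _ ≤ ENNReal.ofReal (t / a) * ENNReal.ofReal ((a / t) ^ 2) := by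
          gcongr
          exact measure_lt_le_of_lintegral_sq_le hu ha.le ht h
      _ = ENNReal.ofReal (a / t) := by
          rw [← ENNReal.ofReal_mul (by positivity)]
          congr 1
          field_simp
      _ ≤ 1 := by
          rw [ENNReal.ofReal_le_one, div_le_one ht]
          exact hta.le

lemma weakNorm_lt_of_lintegral_sq_lt [IsProbabilityMeasure P] (hΦ : MemG ℓ Φ)
    (hconc : ConcaveOn ℝ (Set.Ici 0) Φ) {ε : ℝ≥0∞} (hε : 0 < ε) :
    ∃ η : ℝ≥0∞, 0 < η ∧ ∀ v : Ω → ℝ≥0∞, AEMeasurable v P → ∫⁻ ω, v ω ^ 2 ∂P < η →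
      weakNorm Φ P v < ε := by
  have hl := level_pos hΦ hconc 0
  obtain ⟨a, ha, haε⟩ : ∃ a : ℝ, 0 < a ∧ ENNReal.ofReal (a / level Φ 0) < ε := by
    obtain ⟨b, hb0, hb⟩ := ENNReal.lt_iff_exists_nnreal_btwn.1 hε
    refine ⟨b * level Φ 0, mul_pos (by exact_mod_cast hb0) hl, ?_⟩
    rwa [mul_div_cancel_right₀ _ hl.ne', ENNReal.ofReal_coe_nnreal]
  refine ⟨ENNReal.ofReal a ^ 2, ?_, fun v hv h => ?_⟩
  · exact ENNReal.pow_pos (by simpa using ha) 2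
  · exact (weakNorm_le_of_lintegral_sq_le hΦ hconc hv ha h.le).trans_lt haε

lemma hasAbsContNorm_of_lintegral_sq_lt_top [IsProbabilityMeasure P] (hΦ : MemG ℓ Φ)
    (hconc : ConcaveOn ℝ (Set.Ici 0) Φ) (hu : AEMeasurable u P)
    (h : ∫⁻ ω, u ω ^ 2 ∂P < ∞) : HasAbsContNorm Φ P u := by
  constructor
  · refine (weakNorm_le_of_lintegral_sq_le hΦ hconc hu
      (a := (∫⁻ ω, u ω ^ 2 ∂P).toReal + 1) (by positivity) ?_).trans_lt ENNReal.ofReal_lt_top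
    rw [← ENNReal.ofReal_pow (by positivity), ENNReal.le_ofReal_iff_toReal_le h.ne (by positivity)]
    nlinarith [ENNReal.toReal_nonneg (a := ∫⁻ ω, u ω ^ 2 ∂P)]
  · intro ε hε
    obtain ⟨η, hη, H⟩ := weakNorm_lt_of_lintegral_sq_lt (Ω := Ω) (P := P) hΦ hconc hε
    obtain ⟨δ, hδ, hδη⟩ := exists_pos_setLIntegral_lt_of_measure_lt h.ne hη.ne'
    refine ⟨δ, hδ, fun A hA hPA => H _ (hu.indicator hA) ?_⟩
    have e : (fun ω => A.indicator u ω ^ 2) = A.indicator (fun ω => u ω ^ 2) := by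
      ext ω
      by_cases hω : ω ∈ A <;> simp [hω]
    rw [e, lintegral_indicator hA]
    exact hδη A hPA

end WeakNorm

/-! ### Discretization of the Campanato norm -/

section Dyadic

variable {Ω : Type*} [mΩ : MeasurableSpace Ω] {ℓ : ℝ} {Φ : ℝ → ℝ} {P : Measure Ω}
  {𝓕 : Filtration ℕ mΩ} {g : Ω → ℝ}

/-- The weight `Φ⁻¹(2 ^ k) 2 ^ (-k / 2)` of the dyadic form of the Campanato norm. -/
def weight (Φ : ℝ → ℝ) (k : ℕ) : ℝ := level Φ k * √((1 / 2) ^ k)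

lemma weight_pos (hΦ : MemG ℓ Φ) (hconc : ConcaveOn ℝ (Set.Ici 0) Φ) (k : ℕ) : 0 < weight Φ k :=
  mul_pos (level_pos hΦ hconc k) (Real.sqrt_pos.2 (by positivity))

/-- The weights grow geometrically, because the inverse of `Φ` is convex. -/
lemma sum_weight_le (hΦ : MemG ℓ Φ) (hconc : ConcaveOn ℝ (Set.Ici 0) Φ) (j : ℕ) :
    ∑ k ∈ Finset.range (j + 1), weight Φ k ≤ 4 * weight Φ j := by
  induction j with
  | zero =>
    simp only [zero_add, Finset.range_one, Finset.sum_singleton]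
    linarith [weight_pos hΦ hconc 0]
  | succ j ih =>
    rw [Finset.sum_range_succ]
    have h1 : level Φ j ≤ (1 / 2) * level Φ (j + 1) := by
      simpa using level_le_pow_mul hΦ hconc (Nat.le_succ j)
    have h2 : √((1 / 2 : ℝ) ^ j) = √2 * √((1 / 2) ^ (j + 1)) := by
      rw [← Real.sqrt_mul (by norm_num), pow_succ]
      congr 1
      ring
    have h3 : √2 ≤ 3 / 2 := by
      rw [Real.sqrt_le_left (by norm_num)]
      norm_num
    have h4 : weight Φ j ≤ 3 / 4 * weight Φ (j + 1) := by
      simp only [weight]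
      rw [h2]
      calc level Φ j * (√2 * √((1 / 2) ^ (j + 1)))
          ≤ (1 / 2 * level Φ (j + 1)) * (3 / 2 * √((1 / 2) ^ (j + 1))) := by
            have := (level_pos hΦ hconc (j + 1)).le
            gcongr
        _ = _ := by ring
    linarith

lemma oscillation_mono {x y : ℝ} (h : x ≤ y) : oscillation 𝓕 P g x ≤ oscillation 𝓕 P g y :=
  iSup₂_le fun ν hν => le_iSup₂_of_le ν ⟨hν.1, hν.2.trans (ENNReal.ofReal_le_ofReal h)⟩ le_rfl

lemma oscillation_le_one [IsProbabilityMeasure P] (x : ℝ) :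
    oscillation 𝓕 P g x ≤ oscillation 𝓕 P g 1 :=
  iSup₂_le fun ν hν => le_iSup₂_of_le ν ⟨hν.1, by simpa using prob_le_one⟩ le_rfl

/-- The density of `t²_φ(x) / x` with respect to the oscillation, in closed form. -/
lemma tFun_div_eq {x : ℝ} (hx : 0 < x) :
    tFun 𝓕 P (phi Φ) g x / ENNReal.ofReal x =
      ENNReal.ofReal (inverse Φ (1 / x) / √x) * oscillation 𝓕 P g x := by
  rw [tFun, mul_comm, mul_div_assoc, ← ENNReal.ofReal_div_of_pos hx, mul_comm]
  congr 2
  rw [phi, one_div_one_div, Real.rpow_neg hx.le, ← Real.sqrt_eq_rpow]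
  field_simp

lemma weight_mul_oscillation_le (hΦ : MemG ℓ Φ) (hconc : ConcaveOn ℝ (Set.Ici 0) Φ) {D : ℝ}
    (hD1 : 1 ≤ D) (hD : ∀ s, 0 ≤ s → inverse Φ (2 * s) ≤ D * inverse Φ s) (k : ℕ) :
    ENNReal.ofReal (weight Φ k) * oscillation 𝓕 P g ((1 / 2) ^ k) ≤
      ENNReal.ofReal (2 * D) * ∫⁻ x in Set.Ioc ((1 / 2 : ℝ) ^ k) (2 * (1 / 2) ^ k),
        tFun 𝓕 P (phi Φ) g x / ENNReal.ofReal x := by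
  set X : ℝ := (1 / 2) ^ k with hX
  have hX0 : 0 < X := by positivity
  have hXk : 1 / X = 2 ^ k := by rw [hX, one_div_pow, one_div_one_div]
  have hsX : 0 < √X := Real.sqrt_pos.2 hX0
  have h1 : ∀ x ∈ Set.Ioc X (2 * X),
      ENNReal.ofReal (level Φ k / (2 * D * √X)) * oscillation 𝓕 P g X ≤
        tFun 𝓕 P (phi Φ) g x / ENNReal.ofReal x := by
    intro x hx
    have hx0 : 0 < x := hX0.trans hx.1
    rw [tFun_div_eq hx0]
    refine mul_le_mul' (ENNReal.ofReal_le_ofReal ?_) (oscillation_mono hx.1.le)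
    have hs : √x ≤ 2 * √X := by
      rw [Real.sqrt_le_left (by positivity), mul_pow, Real.sq_sqrt hX0.le]
      linarith [hx.2]
    have hl : level Φ k ≤ D * inverse Φ (1 / x) := by
      rw [level, ← hXk]
      have e : 1 / X = 2 * (1 / (2 * X)) := by field_simp
      rw [e]
      refine (hD _ (by positivity)).trans ?_
      gcongr
      exact hΦ.inverse_mono hconc (by positivity) (one_div_le_one_div_of_le hx0 hx.2)
    rw [div_le_div_iff₀ (by positivity) (Real.sqrt_pos.2 hx0)]
    calc level Φ k * √x ≤ (D * inverse Φ (1 / x)) * (2 * √X) := by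
          have := hΦ.inverse_nonneg hconc (one_div_pos.2 hx0).le
          gcongr
      _ = _ := by ring
  have h2 := setLIntegral_mono' (μ := volume) measurableSet_Ioc h1
  rw [setLIntegral_const, Real.volume_Ioc] at h2
  calc _ = ENNReal.ofReal (2 * D) * (ENNReal.ofReal (level Φ k / (2 * D * √X)) *
        oscillation 𝓕 P g X * ENNReal.ofReal (2 * X - X)) := by
        have := level_pos hΦ hconc k
        rw [mul_right_comm, ← mul_assoc, ← ENNReal.ofReal_mul (by positivity),
          ← ENNReal.ofReal_mul (by positivity)]
        congr 2
        rw [weight, ← hX]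
        have : X = √X * √X := (Real.mul_self_sqrt hX0.le).symm
        field_simp
        rw [Real.sq_sqrt hX0.le]
        ring
    _ ≤ _ := by gcongr

lemma pairwise_disjoint_dyadic :
    Pairwise (Function.onFun Disjoint fun k : ℕ =>
      Set.Ioc ((1 / 2 : ℝ) ^ k) (2 * (1 / 2) ^ k)) := by
  have h : Antitone fun k : ℕ => 2 * (1 / 2 : ℝ) ^ k := fun i j hij => by
    have := pow_le_pow_of_le_one (by norm_num : (0 : ℝ) ≤ 1 / 2) (by norm_num) hij
    simpa using this
  have h' := h.pairwise_disjoint_on_Ioc_succ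
  convert h' using 3 with k
  simp only [Order.succ_eq_add_one, pow_succ]
  ring_nf

/-- The dyadic sum is bounded by the Campanato norm. -/
lemma tsum_weight_mul_oscillation_le (hΦ : MemG ℓ Φ) (hconc : ConcaveOn ℝ (Set.Ici 0) Φ) {D : ℝ}
    (hD1 : 1 ≤ D) (hD : ∀ s, 0 ≤ s → inverse Φ (2 * s) ≤ D * inverse Φ s) :
    ∑' k, ENNReal.ofReal (weight Φ k) * oscillation 𝓕 P g ((1 / 2) ^ k) ≤
      ENNReal.ofReal (2 * D) * campanatoNorm 𝓕 P (phi Φ) g := by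
  calc _ ≤ ∑' k : ℕ, ENNReal.ofReal (2 * D) *
        ∫⁻ x in Set.Ioc ((1 / 2 : ℝ) ^ k) (2 * (1 / 2) ^ k),
          tFun 𝓕 P (phi Φ) g x / ENNReal.ofReal x :=
        ENNReal.tsum_le_tsum (weight_mul_oscillation_le hΦ hconc hD1 hD)
    _ = ENNReal.ofReal (2 * D) * ∫⁻ x in ⋃ k : ℕ, Set.Ioc ((1 / 2 : ℝ) ^ k) (2 * (1 / 2) ^ k),
          tFun 𝓕 P (phi Φ) g x / ENNReal.ofReal x := by
        rw [ENNReal.tsum_mul_left,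
          lintegral_iUnion (fun _ => measurableSet_Ioc) pairwise_disjoint_dyadic]
    _ ≤ _ := by
        rw [campanatoNorm]
        gcongr
        exact Set.iUnion_subset fun k x hx =>
          (show (0 : ℝ) < (1 / 2) ^ k by positivity).trans hx.1

lemma setLIntegral_dyadic_le [IsProbabilityMeasure P] (hΦ : MemG ℓ Φ)
    (hconc : ConcaveOn ℝ (Set.Ici 0) Φ) {D : ℝ}
    (hD : ∀ s, 0 ≤ s → inverse Φ (2 * s) ≤ D * inverse Φ s) (k : ℕ) :
    ∫⁻ x in Set.Ioc ((1 / 2 : ℝ) ^ (k + 1)) (2 * (1 / 2) ^ (k + 1)),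
        tFun 𝓕 P (phi Φ) g x / ENNReal.ofReal x ≤
      ENNReal.ofReal D * (ENNReal.ofReal (weight Φ k) * oscillation 𝓕 P g ((1 / 2) ^ k)) := by
  set X : ℝ := (1 / 2) ^ (k + 1) with hX
  have hX0 : 0 < X := by positivity
  have hXk : 1 / X = 2 ^ (k + 1) := by rw [hX, one_div_pow, one_div_one_div]
  have hX2 : 2 * X = (1 / 2) ^ k := by rw [hX, pow_succ]; ring
  have hsX : 0 < √X := Real.sqrt_pos.2 hX0
  have h1 : ∀ x ∈ Set.Ioc X (2 * X), tFun 𝓕 P (phi Φ) g x / ENNReal.ofReal x ≤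
      ENNReal.ofReal (level Φ (k + 1) / √X) * oscillation 𝓕 P g (2 * X) := by
    intro x hx
    have hx0 : 0 < x := hX0.trans hx.1
    rw [tFun_div_eq hx0]
    refine mul_le_mul' (ENNReal.ofReal_le_ofReal ?_) (oscillation_mono hx.2)
    have : inverse Φ (1 / x) ≤ level Φ (k + 1) := by
      rw [level, ← hXk]
      exact hΦ.inverse_mono hconc (by positivity) (one_div_le_one_div_of_le hX0 hx.1.le)
    have h3 := (level_pos hΦ hconc (k + 1)).le
    gcongr
    exact hx.1.le
  have h2 := setLIntegral_mono' (μ := volume) measurableSet_Ioc h1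
  rw [setLIntegral_const, Real.volume_Ioc] at h2
  refine h2.trans ?_
  rw [hX2, ← hX2, mul_right_comm, ← ENNReal.ofReal_mul
    (by have := level_pos hΦ hconc (k + 1); positivity), ← mul_assoc,
    ← ENNReal.ofReal_mul' (weight_pos hΦ hconc k).le]
  refine mul_le_mul' (ENNReal.ofReal_le_ofReal ?_) le_rfl
  rw [weight, ← hX2]
  have e : level Φ (k + 1) / √X * (2 * X - X) = level Φ (k + 1) * √X := by
    have : X = √X * √X := (Real.mul_self_sqrt hX0.le).symm
    field_simp
    rw [Real.sq_sqrt hX0.le]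
    ring
  rw [e, ← mul_assoc]
  have h4 := (level_pos hΦ hconc (k + 1)).le
  refine mul_le_mul (level_succ_le hD k) (Real.sqrt_le_sqrt (by linarith)) hsX.le ?_
  exact h4.trans (level_succ_le hD k)

lemma setLIntegral_Ioi_one_le [IsProbabilityMeasure P] (hΦ : MemG ℓ Φ)
    (hconc : ConcaveOn ℝ (Set.Ici 0) Φ) :
    ∫⁻ x in Set.Ioi (1 : ℝ), tFun 𝓕 P (phi Φ) g x / ENNReal.ofReal x ≤
      2 * (ENNReal.ofReal (weight Φ 0) * oscillation 𝓕 P g 1) := by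
  have hl := (level_pos hΦ hconc 0).le
  have h1 : ∀ x ∈ Set.Ioi (1 : ℝ), tFun 𝓕 P (phi Φ) g x / ENNReal.ofReal x ≤
      ENNReal.ofReal (x ^ (-(3 / 2) : ℝ)) *
        (ENNReal.ofReal (level Φ 0) * oscillation 𝓕 P g 1) := by
    intro x hx
    have hx1 : 1 < x := hx
    have hx0 : 0 < x := one_pos.trans hx1
    rw [tFun_div_eq hx0, ← mul_assoc, ← ENNReal.ofReal_mul (by positivity)]
    refine mul_le_mul' (ENNReal.ofReal_le_ofReal ?_) (oscillation_le_one x)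
    have h2 : inverse Φ (1 / x) ≤ 1 / x * level Φ 0 := by
      have := hΦ.inverse_mul_le hconc (a := 1 / x) (s := 1) (by positivity)
        ((div_le_one hx0).2 hx1.le) zero_le_one
      simpa [level] using this
    calc inverse Φ (1 / x) / √x ≤ 1 / x * level Φ 0 / √x := by gcongr
      _ = x ^ (-(3 / 2) : ℝ) * level Φ 0 := by
        rw [show (-(3 / 2) : ℝ) = -1 - 1 / 2 by norm_num, Real.rpow_sub hx0, Real.rpow_neg_one,
          ← Real.sqrt_eq_rpow]
        ring
  have hint : ∫⁻ x in Set.Ioi (1 : ℝ), ENNReal.ofReal (x ^ (-(3 / 2) : ℝ)) = 2 := by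
    rw [← ofReal_integral_eq_lintegral_ofReal
      (integrableOn_Ioi_rpow_of_lt (by norm_num) one_pos)]
    · rw [integral_Ioi_rpow_of_lt (by norm_num) one_pos]
      norm_num
    · exact (ae_restrict_iff' measurableSet_Ioi).2 (ae_of_all _ fun x hx =>
        Real.rpow_nonneg (zero_le_one.trans (Set.mem_Ioi.1 hx).le) _)
  refine (setLIntegral_mono' measurableSet_Ioi h1).trans ?_
  rw [lintegral_mul_const _ (by fun_prop), hint]
  simp [weight]

/-- The Campanato norm is bounded by the dyadic sum. -/
lemma campanatoNorm_le_tsum [IsProbabilityMeasure P] (hΦ : MemG ℓ Φ)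
    (hconc : ConcaveOn ℝ (Set.Ici 0) Φ) {D : ℝ} (hD1 : 1 ≤ D)
    (hD : ∀ s, 0 ≤ s → inverse Φ (2 * s) ≤ D * inverse Φ s) :
    campanatoNorm 𝓕 P (phi Φ) g ≤ ENNReal.ofReal (D + 2) *
      ∑' k, ENNReal.ofReal (weight Φ k) * oscillation 𝓕 P g ((1 / 2) ^ k) := by
  have hcover : Set.Ioi (0 : ℝ) ⊆ (⋃ k : ℕ, Set.Ioc ((1 / 2 : ℝ) ^ (k + 1))
      (2 * (1 / 2) ^ (k + 1))) ∪ Set.Ioi 1 := by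
    intro x hx
    rcases lt_or_ge 1 x with h1 | h1
    · exact Or.inr h1
    obtain ⟨n, hn, hn'⟩ := exists_nat_pow_near_of_lt_one (Set.mem_Ioi.1 hx) h1
      (by norm_num : (0 : ℝ) < 1 / 2) (by norm_num)
    refine Or.inl (Set.mem_iUnion.2 ⟨n, hn, hn'.trans_eq ?_⟩)
    rw [pow_succ]
    ring
  set S := ∑' k, ENNReal.ofReal (weight Φ k) * oscillation 𝓕 P g ((1 / 2) ^ k) with hS
  calc campanatoNorm 𝓕 P (phi Φ) g
      ≤ ∫⁻ x in (⋃ k : ℕ, Set.Ioc ((1 / 2 : ℝ) ^ (k + 1)) (2 * (1 / 2) ^ (k + 1))) ∪ Set.Ioi 1,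
          tFun 𝓕 P (phi Φ) g x / ENNReal.ofReal x := lintegral_mono_set hcover
    _ ≤ _ := lintegral_union_le _ _ _
    _ ≤ (∑' k : ℕ, ∫⁻ x in Set.Ioc ((1 / 2 : ℝ) ^ (k + 1)) (2 * (1 / 2) ^ (k + 1)),
          tFun 𝓕 P (phi Φ) g x / ENNReal.ofReal x) + 2 * S := by
        refine add_le_add (lintegral_iUnion_le _ _) ((setLIntegral_Ioi_one_le hΦ hconc).trans ?_)
        gcongr
        simpa only [pow_zero] using ENNReal.le_tsum
          (f := fun k => ENNReal.ofReal (weight Φ k) * oscillation 𝓕 P g ((1 / 2) ^ k)) 0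
    _ ≤ ENNReal.ofReal D * S + 2 * S := by
        gcongr
        rw [hS, ← ENNReal.tsum_mul_left]
        exact ENNReal.tsum_le_tsum (setLIntegral_dyadic_le hΦ hconc hD)
    _ = _ := by
        rw [← add_mul, ENNReal.ofReal_add (by linarith) (by norm_num), ENNReal.ofReal_ofNat]

end Dyadic

/-! ### Square integrable functions and conditional expectations -/

section SquareIntegrable

variable {Ω : Type*} {m : MeasurableSpace Ω} [mΩ : MeasurableSpace Ω] {P : Measure Ω}
  {f g : Ω → ℝ}

lemma lintegral_enorm_sq_eq_eLpNorm (f : Ω → ℝ) :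
    ∫⁻ ω, ‖f ω‖ₑ ^ 2 ∂P = eLpNorm f 2 P ^ 2 := by
  have := eLpNorm_nnreal_pow_eq_lintegral (μ := P) (f := f) (p := 2) two_ne_zero
  simpa using this.symm

lemma lintegral_enorm_sq_lt_top (hf : MemLp f 2 P) : ∫⁻ ω, ‖f ω‖ₑ ^ 2 ∂P < ∞ := by
  rw [lintegral_enorm_sq_eq_eLpNorm]
  exact ENNReal.pow_lt_top hf.2

lemma lintegral_enorm_sq_eq_ofReal (hf : MemLp f 2 P) :
    ∫⁻ ω, ‖f ω‖ₑ ^ 2 ∂P = ENNReal.ofReal (∫ ω, f ω ^ 2 ∂P) := by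
  rw [ofReal_integral_eq_lintegral_ofReal hf.integrable_sq (ae_of_all _ fun ω => sq_nonneg _)]
  refine lintegral_congr fun ω => ?_
  rw [← ofReal_norm, ← ENNReal.ofReal_pow (norm_nonneg _), Real.norm_eq_abs, sq_abs]

lemma memLp_two_of_lintegral_lt_top (hf : AEStronglyMeasurable f P)
    (h : ∫⁻ ω, ‖f ω‖ₑ ^ 2 ∂P < ∞) : MemLp f 2 P := by
  refine ⟨hf, ?_⟩
  rw [lintegral_enorm_sq_eq_eLpNorm] at h
  by_contra! htop
  rw [top_le_iff.1 htop] at h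
  simp at h

variable [IsProbabilityMeasure P]

lemma integral_mul_condExp (hm : m ≤ mΩ) (hf : MemLp f 2 P) (hg : MemLp g 2 P) :
    ∫ ω, f ω * (P[g | m]) ω ∂P = ∫ ω, (P[f | m]) ω * (P[g | m]) ω ∂P := by
  have hg' : MemLp (P[g | m]) 2 P := hg.condExp one_le_two
  have h1 : ∫ ω, (P[f * P[g | m] | m]) ω ∂P = ∫ ω, (f * P[g | m]) ω ∂P := integral_condExp hm
  have h2 : P[f * P[g | m] | m] =ᵐ[P] P[f | m] * P[g | m] :=
    condExp_mul_of_stronglyMeasurable_right stronglyMeasurable_condExp (hf.integrable_mul hg')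
      (hf.integrable one_le_two)
  rw [integral_congr_ae h2] at h1
  exact h1.symm

/-- Pythagoras for the orthogonal projection `f ↦ E(f | m)`. -/
lemma integral_sub_condExp_sq (hm : m ≤ mΩ) (hf : MemLp f 2 P) :
    ∫ ω, (f ω - (P[f | m]) ω) ^ 2 ∂P = ∫ ω, f ω ^ 2 ∂P - ∫ ω, (P[f | m]) ω ^ 2 ∂P := by
  have hf' : MemLp (P[f | m]) 2 P := hf.condExp one_le_two
  have h := integral_mul_condExp hm hf hf
  have e : ∀ ω, (f ω - (P[f | m]) ω) ^ 2 =
      f ω ^ 2 - (2 * (f ω * (P[f | m]) ω) - (P[f | m]) ω ^ 2) := fun ω => by ring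
  have hi : Integrable (fun ω => f ω * (P[f | m]) ω) P := hf.integrable_mul hf'
  simp_rw [e]
  have h2 : Integrable (fun ω => 2 * (f ω * (P[f | m]) ω) - (P[f | m]) ω ^ 2) P :=
    (hi.const_mul 2).sub hf'.integrable_sq
  rw [integral_sub hf.integrable_sq h2, integral_sub (hi.const_mul 2) hf'.integrable_sq,
    integral_const_mul, h]
  simp_rw [pow_two]
  ring

lemma integral_sub_condExp_mul_self (hm : m ≤ mΩ) (hf : MemLp f 2 P) :
    ∫ ω, (f ω - (P[f | m]) ω) * f ω ∂P = ∫ ω, (f ω - (P[f | m]) ω) ^ 2 ∂P := by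
  have hf' : MemLp (P[f | m]) 2 P := hf.condExp one_le_two
  have h := integral_mul_condExp hm hf hf
  rw [integral_sub_condExp_sq hm hf]
  have e : ∀ ω, (f ω - (P[f | m]) ω) * f ω = f ω ^ 2 - f ω * (P[f | m]) ω := fun ω => by ring
  have hi : Integrable (fun ω => f ω * (P[f | m]) ω) P := hf.integrable_mul hf'
  simp_rw [e]
  rw [integral_sub hf.integrable_sq hi, h]
  simp_rw [pow_two]

/-- Bessel's inequality for the orthogonal increments of the martingale `E_n f`. -/
lemma tsum_lintegral_condExp_sub_sq_le (𝓕 : Filtration ℕ mΩ) (hf : MemLp f 2 P) :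
    ∑' n, ∫⁻ ω, ‖(P[f | 𝓕 (n + 1)]) ω - (P[f | 𝓕 n]) ω‖ₑ ^ 2 ∂P ≤ ∫⁻ ω, ‖f ω‖ₑ ^ 2 ∂P := by
  have hE : ∀ n, MemLp (P[f | 𝓕 n]) 2 P := fun n => hf.condExp one_le_two
  have hstep : ∀ n, ∫ ω, ((P[f | 𝓕 (n + 1)]) ω - (P[f | 𝓕 n]) ω) ^ 2 ∂P =
      ∫ ω, (P[f | 𝓕 (n + 1)]) ω ^ 2 ∂P - ∫ ω, (P[f | 𝓕 n]) ω ^ 2 ∂P := by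
    intro n
    have ht : P[P[f | 𝓕 (n + 1)] | 𝓕 n] =ᵐ[P] P[f | 𝓕 n] :=
      condExp_condExp_of_le (𝓕.mono n.le_succ) (𝓕.le _)
    have h := integral_sub_condExp_sq (𝓕.le n) (hE (n + 1))
    have e1 : ∫ ω, (P[P[f | 𝓕 (n + 1)] | 𝓕 n]) ω ^ 2 ∂P = ∫ ω, (P[f | 𝓕 n]) ω ^ 2 ∂P :=
      integral_congr_ae (by filter_upwards [ht] with ω hω; rw [hω])
    rw [← e1, ← h]
    exact integral_congr_ae (by filter_upwards [ht] with ω hω; rw [hω])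
  refine ENNReal.tsum_le_of_sum_range_le fun N => ?_
  calc _ = ∑ n ∈ Finset.range N, ENNReal.ofReal
        (∫ ω, ((P[f | 𝓕 (n + 1)]) ω - (P[f | 𝓕 n]) ω) ^ 2 ∂P) :=
        Finset.sum_congr rfl fun n _ =>
          lintegral_enorm_sq_eq_ofReal ((hE (n + 1)).sub (hE n))
    _ = ENNReal.ofReal (∑ n ∈ Finset.range N,
        ∫ ω, ((P[f | 𝓕 (n + 1)]) ω - (P[f | 𝓕 n]) ω) ^ 2 ∂P) :=
        (ENNReal.ofReal_sum_of_nonneg fun n _ => integral_nonneg fun ω => sq_nonneg _).symm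
    _ ≤ ENNReal.ofReal (∫ ω, f ω ^ 2 ∂P) := by
        simp_rw [hstep]
        rw [Finset.sum_range_sub (fun n => ∫ ω, (P[f | 𝓕 n]) ω ^ 2 ∂P)]
        refine ENNReal.ofReal_le_ofReal ?_
        have h1 := integral_sub_condExp_sq (𝓕.le N) hf
        have h2 : 0 ≤ ∫ ω, (f ω - (P[f | 𝓕 N]) ω) ^ 2 ∂P := integral_nonneg fun ω => sq_nonneg _
        have h3 : 0 ≤ ∫ ω, (P[f | 𝓕 0]) ω ^ 2 ∂P := integral_nonneg fun ω => sq_nonneg _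
        linarith
    _ = _ := (lintegral_enorm_sq_eq_ofReal hf).symm

end SquareIntegrable

/-! ### Stopped functions -/

section Stopped

variable {Ω : Type*} [mΩ : MeasurableSpace Ω] {P : Measure Ω} [IsProbabilityMeasure P]
  {𝓕 : Filtration ℕ mΩ} {g : Ω → ℝ} {ν : Ω → WithTop ℕ}

/-- The stopped function `g^ν` is the conditional expectation with respect to the `σ`-algebra of
`ν`, also when `ν` takes the value `∞`. -/
lemma stopped_ae_eq_condExp (h𝓕 : ⨆ n, 𝓕 n = mΩ) (hν : IsStoppingTime 𝓕 ν)
    (hg : MemLp g 2 P) : stopped 𝓕 P g ν =ᵐ[P] P[g | hν.measurableSpace] := by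
  have htop : MeasurableSet[hν.measurableSpace] {ω | ν ω = ⊤} := by
    refine (hν.measurableSet _).2 ⟨?_, fun i => ?_⟩
    · rw [h𝓕]
      have : {ω | ν ω = ⊤} = (⋃ n : ℕ, {ω | ν ω ≤ WithTop.some n})ᶜ := by
        ext ω
        simp only [Set.mem_ofPred_eq, Set.mem_compl_iff, Set.mem_iUnion, not_exists]
        refine ⟨fun h n => by simp [h], fun h => ?_⟩
        by_contra hne
        obtain ⟨n, hn⟩ := WithTop.ne_top_iff_exists.1 hne
        exact h n hn.symm.le
      rw [this]
      exact (MeasurableSet.iUnion fun n => 𝓕.le n _ (hν.measurableSet_le n)).compl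
    · have : {ω | ν ω = ⊤} ∩ {ω | ν ω ≤ WithTop.some i} = ∅ := by
        ext ω
        simp only [Set.mem_inter_iff, Set.mem_ofPred_eq, Set.mem_empty_iff_false, iff_false,
          not_and]
        intro h h'
        rw [h] at h'
        simp at h'
      rw [this]
      exact @MeasurableSet.empty _ (𝓕 i)
  have h1 : P[g | hν.measurableSpace] =ᵐ[P.restrict {ω | ν ω = ⊤}] P[g | mΩ] := by
    refine condExp_ae_eq_restrict_of_measurableSpace_eq_on hν.measurableSpace_le le_rfl htop
      fun t => ⟨fun h => hν.measurableSpace_le _ h,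
        fun h => (hν.measurableSet _).2 ⟨?_, fun i => ?_⟩⟩
    · rwa [h𝓕]
    · have : {ω | ν ω = ⊤} ∩ t ∩ {ω | ν ω ≤ WithTop.some i} = ∅ := by
        ext ω
        simp only [Set.mem_inter_iff, Set.mem_ofPred_eq, Set.mem_empty_iff_false, iff_false,
          not_and, and_imp]
        intro h _ h'
        rw [h] at h'
        simp at h'
      rw [this]
      exact @MeasurableSet.empty _ (𝓕 i)
  have h2 : P[g | mΩ] =ᵐ[P] g := condExp_of_aestronglyMeasurable' le_rfl hg.1
    (hg.integrable one_le_two)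
  have h3 : ∀ n : ℕ, ∀ᵐ ω ∂P, ν ω = n → (P[g | hν.measurableSpace]) ω = (P[g | 𝓕 n]) ω :=
    fun n => (ae_restrict_iff' (𝓕.le n _ (hν.measurableSet_eq n))).1
      (condExp_stopping_time_ae_eq_restrict_eq hν n)
  have h4 := (ae_restrict_iff' (hν.measurableSpace_le _ htop)).1 h1
  filter_upwards [h2, ae_all_iff.2 h3, h4] with ω h2 h3 h4
  by_cases h : ν ω = ⊤
  · rw [h4 h, h2]
    simp [stopped, h]
  · obtain ⟨n, hn⟩ := WithTop.ne_top_iff_exists.1 h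
    have hu : ((n : WithTop ℕ)).untopA = n := WithTop.untopD_coe _ n
    rw [h3 n hn.symm]
    simp [stopped, stoppedValue, ← hn, hu]

lemma memLp_sub_stopped (h𝓕 : ⨆ n, 𝓕 n = mΩ) (hν : IsStoppingTime 𝓕 ν) (hg : MemLp g 2 P) :
    MemLp (fun ω => g ω - stopped 𝓕 P g ν ω) 2 P :=
  hg.sub ((memLp_congr_ae (stopped_ae_eq_condExp h𝓕 hν hg)).2 (hg.condExp one_le_two))

lemma integral_sub_stopped_mul (h𝓕 : ⨆ n, 𝓕 n = mΩ) (hν : IsStoppingTime 𝓕 ν)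
    (hg : MemLp g 2 P) :
    ∫ ω, (g ω - stopped 𝓕 P g ν ω) * g ω ∂P = ∫ ω, (g ω - stopped 𝓕 P g ν ω) ^ 2 ∂P := by
  have h := stopped_ae_eq_condExp h𝓕 hν hg
  have := integral_sub_condExp_mul_self hν.measurableSpace_le hg
  refine (integral_congr_ae ?_).trans (this.trans (integral_congr_ae ?_))
  · filter_upwards [h] with ω hω
    rw [hω]
  · filter_upwards [h] with ω hω
    rw [hω]

/-- Before `ν`, the martingale of `g - g^ν` vanishes. -/
lemma condExp_sub_stopped_eq_zero (h𝓕 : ⨆ n, 𝓕 n = mΩ) (hν : IsStoppingTime 𝓕 ν)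
    (hg : MemLp g 2 P) (m : ℕ) :
    ∀ᵐ ω ∂P, WithTop.some m ≤ ν ω → (P[fun ω => g ω - stopped 𝓕 P g ν ω | 𝓕 m]) ω = 0 := by
  set b : Ω → ℝ := fun ω => g ω - stopped 𝓕 P g ν ω with hb
  have hgi : Integrable g P := hg.integrable one_le_two
  have hbi : Integrable b P := (memLp_sub_stopped h𝓕 hν hg).integrable one_le_two
  have hs := hν.measurableSet_ge m
  have h1 := condExp_indicator hbi hs
  have h2 : (0 : Ω → ℝ) =ᵐ[P] P[{ω | WithTop.some m ≤ ν ω}.indicator b | 𝓕 m] := by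
    refine ae_eq_condExp_of_forall_setIntegral_eq (𝓕.le m) (hbi.indicator (𝓕.le m _ hs))
      (fun _ _ _ => integrable_zero _ _ _) (fun s hms _ => ?_) aestronglyMeasurable_zero
    have hms' : MeasurableSet[hν.measurableSpace] (s ∩ {ω | WithTop.some m ≤ ν ω}) := by
      refine (hν.measurableSet _).2 ⟨?_, fun i => ?_⟩
      · rw [h𝓕]
        exact 𝓕.le m _ (hms.inter hs)
      · rcases lt_or_ge i m with him | him
        · have : s ∩ {ω | WithTop.some m ≤ ν ω} ∩ {ω | ν ω ≤ WithTop.some i} = ∅ := by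
            ext ω
            simp only [Set.mem_inter_iff, Set.mem_ofPred_eq, Set.mem_empty_iff_false, iff_false,
              not_and, and_imp]
            intro _ h h'
            exact absurd (WithTop.coe_le_coe.1 (h.trans h')) (not_le.2 him)
          rw [this]
          exact @MeasurableSet.empty _ (𝓕 i)
        · exact (𝓕.mono him _ (hms.inter hs)).inter (hν.measurableSet_le i)
    rw [setIntegral_indicator (𝓕.le m _ hs)]
    have e : ∫ ω in s ∩ {ω | WithTop.some m ≤ ν ω}, b ω ∂P =
        ∫ ω in s ∩ {ω | WithTop.some m ≤ ν ω}, (g ω - (P[g | hν.measurableSpace]) ω) ∂P := by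
      refine integral_congr_ae (ae_restrict_of_ae ?_)
      filter_upwards [stopped_ae_eq_condExp h𝓕 hν hg] with ω hω
      simp only [hb, hω]
    rw [e, integral_sub hgi.integrableOn integrable_condExp.integrableOn,
      setIntegral_condExp hν.measurableSpace_le hgi hms']
    simp
  filter_upwards [h1, h2] with ω h1 h2 hω
  rw [← h2, Set.indicator_of_mem (s := {ω | WithTop.some m ≤ ν ω}) hω] at h1
  exact h1.symm

/-- From `ν` on, the martingales of `g - g^ν` and of `g` have the same increments. -/
lemma condExp_sub_stopped_increment (h𝓕 : ⨆ n, 𝓕 n = mΩ) (hν : IsStoppingTime 𝓕 ν)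
    (hg : MemLp g 2 P) (n : ℕ) :
    ∀ᵐ ω ∂P, ν ω ≤ WithTop.some n →
      (P[fun ω => g ω - stopped 𝓕 P g ν ω | 𝓕 (n + 1)]) ω -
        (P[fun ω => g ω - stopped 𝓕 P g ν ω | 𝓕 n]) ω =
      (P[g | 𝓕 (n + 1)]) ω - (P[g | 𝓕 n]) ω := by
  have hgi : Integrable g P := hg.integrable one_le_two
  set k : Ω → ℝ := P[g | hν.measurableSpace] with hk
  have hki : Integrable k P := integrable_condExp
  have hs := hν.measurableSet_le n
  set s : Set Ω := {ω | ν ω ≤ WithTop.some n} with hsdef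
  have hkm : StronglyMeasurable[𝓕 n] (s.indicator k) := by
    refine Measurable.stronglyMeasurable ?_
    intro t ht
    have hkt : MeasurableSet[𝓕 n] (k ⁻¹' t ∩ s) :=
      ((hν.measurableSet _).1 (stronglyMeasurable_condExp.measurable ht)).2 n
    by_cases h0 : (0 : ℝ) ∈ t
    · have : s.indicator k ⁻¹' t = (k ⁻¹' t ∩ s) ∪ sᶜ := by
        ext ω
        by_cases hω : ω ∈ s <;> simp [hω, h0]
      rw [this]
      exact hkt.union hs.compl
    · have : s.indicator k ⁻¹' t = k ⁻¹' t ∩ s := by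
        ext ω
        by_cases hω : ω ∈ s <;> simp [hω, h0]
      rw [this]
      exact hkt
  have hlevel : ∀ j, n ≤ j → ∀ᵐ ω ∂P, ω ∈ s →
      (P[fun ω => g ω - stopped 𝓕 P g ν ω | 𝓕 j]) ω = (P[g | 𝓕 j]) ω - k ω := by
    intro j hj
    have h1 : P[fun ω => g ω - stopped 𝓕 P g ν ω | 𝓕 j] =ᵐ[P] P[g - k | 𝓕 j] := by
      refine condExp_congr_ae ?_
      filter_upwards [stopped_ae_eq_condExp h𝓕 hν hg] with ω hω
      simp only [hω, Pi.sub_apply, hk]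
    have h2 : P[g - k | 𝓕 j] =ᵐ[P] P[g | 𝓕 j] - P[k | 𝓕 j] := condExp_sub hgi hki _
    have h3 : P[s.indicator k | 𝓕 j] =ᵐ[P] s.indicator (P[k | 𝓕 j]) :=
      condExp_indicator hki (𝓕.mono hj _ hs)
    rw [condExp_of_stronglyMeasurable (𝓕.le j) (hkm.mono (𝓕.mono hj))
      (hki.indicator (𝓕.le n _ hs))] at h3
    filter_upwards [h1, h2, h3] with ω h1 h2 h3 hω
    rw [h1, h2, Pi.sub_apply]
    rw [Set.indicator_of_mem hω, Set.indicator_of_mem hω] at h3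
    rw [h3]
  filter_upwards [hlevel n le_rfl, hlevel (n + 1) n.le_succ] with ω h1 h2 hω
  rw [h1 hω, h2 hω]
  ring

lemma tsum_setLIntegral_increment_le (h𝓕 : ⨆ n, 𝓕 n = mΩ) (hν : IsStoppingTime 𝓕 ν)
    (hg : MemLp g 2 P) :
    ∑' n : ℕ, ∫⁻ ω in {ω | ν ω ≤ WithTop.some n}, ‖(P[g | 𝓕 (n + 1)]) ω - (P[g | 𝓕 n]) ω‖ₑ ^ 2 ∂P ≤
      eLpNorm (fun ω => g ω - stopped 𝓕 P g ν ω) 2 P ^ 2 := by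
  rw [← lintegral_enorm_sq_eq_eLpNorm]
  refine le_trans (ENNReal.tsum_le_tsum fun n => ?_)
    (tsum_lintegral_condExp_sub_sq_le 𝓕 (memLp_sub_stopped h𝓕 hν hg))
  refine le_trans (le_of_eq ?_) (setLIntegral_le_lintegral {ω | ν ω ≤ WithTop.some n} _)
  refine setLIntegral_congr_fun_ae (𝓕.le n _ (hν.measurableSet_le n)) ?_
  filter_upwards [condExp_sub_stopped_increment h𝓕 hν hg n] with ω h hω
  rw [h hω]

end Stopped

/-! ### The conditional quadratic variation -/

section CondVar

variable {Ω : Type*} [mΩ : MeasurableSpace Ω] {P : Measure Ω} {𝓕 : Filtration ℕ mΩ}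
  {f f' : ℕ → Ω → ℝ}

/-- The `n`-th term `E_n |f_{n+1} - f_n|²` of the conditional quadratic variation. -/
def condIncr (𝓕 : Filtration ℕ mΩ) (P : Measure Ω) (f : ℕ → Ω → ℝ) (n : ℕ) : Ω → ℝ≥0∞ :=
  condLExp (𝓕 n) P (fun ω => ‖f (n + 1) ω - f n ω‖ₑ ^ 2)

/-- The partial sums `s_{n+1}(f)² = ∑_{i ≤ n} E_i |f_{i+1} - f_i|²`, a predictable sequence. -/
def partialVar (𝓕 : Filtration ℕ mΩ) (P : Measure Ω) (f : ℕ → Ω → ℝ) (n : ℕ) (ω : Ω) : ℝ≥0∞ :=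
  ∑ i ∈ Finset.range (n + 1), condIncr 𝓕 P f i ω

lemma measurable_condIncr (n : ℕ) : Measurable (condIncr 𝓕 P f n) :=
  measurable_condLExp' _ _ _

lemma condVar_sq (ω : Ω) : condVar 𝓕 P f ω ^ 2 = ∑' n, condIncr 𝓕 P f n ω := by
  rw [condVar, ← ENNReal.rpow_natCast, ← ENNReal.rpow_mul]
  norm_num
  rfl

lemma condVar_le_of_tsum_le {ω : Ω} {c : ℝ≥0∞} (h : ∑' n, condIncr 𝓕 P f n ω ≤ c ^ 2) :
    condVar 𝓕 P f ω ≤ c := by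
  rw [← condVar_sq] at h
  exact (ENNReal.pow_le_pow_left_iff two_ne_zero).1 h

lemma measurable_condVar : Measurable (condVar 𝓕 P f) :=
  (Measurable.tsum fun n => measurable_condIncr n).pow_const _

lemma measurable_partialVar (n : ℕ) : Measurable[𝓕 n] (partialVar 𝓕 P f n) := by
  refine Finset.measurable_fun_sum (m := 𝓕 n) _ fun i hi => ?_
  exact (measurable_condLExp _ _ _).mono (𝓕.mono (Nat.lt_succ_iff.1 (Finset.mem_range.1 hi)))
    le_rfl

lemma partialVar_mono (ω : Ω) : Monotone fun n => partialVar 𝓕 P f n ω := fun _ _ h =>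
  Finset.sum_le_sum_of_subset (Finset.range_mono (Nat.succ_le_succ h))

lemma partialVar_le_condVar_sq (n : ℕ) (ω : Ω) :
    partialVar 𝓕 P f n ω ≤ condVar 𝓕 P f ω ^ 2 := by
  rw [condVar_sq]
  exact ENNReal.sum_le_tsum _

lemma condVar_congr (h : ∀ n, (fun ω => f (n + 1) ω - f n ω) =ᵐ[P]
    fun ω => f' (n + 1) ω - f' n ω) : condVar 𝓕 P f =ᵐ[P] condVar 𝓕 P f' := by
  have h1 : ∀ n, condIncr 𝓕 P f n =ᵐ[P] condIncr 𝓕 P f' n := by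
    intro n
    refine condLExp_congr_ae ?_
    filter_upwards [h n] with ω hω
    rw [hω]
  filter_upwards [ae_all_iff.2 h1] with ω hω
  simp only [condVar]
  exact congrArg (· ^ (1 / 2 : ℝ)) (tsum_congr hω)

lemma condVar_congr_of_ae_eq (h : ∀ n, f n =ᵐ[P] f' n) :
    condVar 𝓕 P f =ᵐ[P] condVar 𝓕 P f' :=
  condVar_congr fun n => by
    filter_upwards [h n, h (n + 1)] with ω h1 h2
    rw [h1, h2]

variable [IsProbabilityMeasure P]

lemma lintegral_condVar_sq :
    ∫⁻ ω, condVar 𝓕 P f ω ^ 2 ∂P = ∑' n, ∫⁻ ω, ‖f (n + 1) ω - f n ω‖ₑ ^ 2 ∂P := by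
  simp_rw [condVar_sq]
  rw [lintegral_tsum fun n => (measurable_condIncr n).aemeasurable]
  exact tsum_congr fun n => lintegral_condLExp (𝓕.le n) P _

lemma condLExp_indicator {m : MeasurableSpace Ω} (hm : m ≤ mΩ) (X : Ω → ℝ≥0∞) {s : Set Ω}
    (hs : MeasurableSet[m] s) :
    condLExp m P (s.indicator X) =ᵐ[P] s.indicator (condLExp m P X) := by
  refine (ae_eq_condLExp hm P _ ((measurable_condLExp m P X).indicator hs) fun t ht => ?_).symm
  rw [setLIntegral_indicator (hm s hs), setLIntegral_indicator (hm s hs),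
    setLIntegral_condLExp hm P X (hs.inter ht)]

/-- The variation does not charge the event that no increment lives on. -/
lemma condVar_eq_zero {A : ℕ → Set Ω} (hA : ∀ n, MeasurableSet[𝓕 n] (A n))
    (h : ∀ n, ∀ᵐ ω ∂P, ω ∈ A n → f (n + 1) ω = f n ω) :
    ∀ᵐ ω ∂P, (∀ n, ω ∈ A n) → condVar 𝓕 P f ω = 0 := by
  have h1 : ∀ n, ∀ᵐ ω ∂P, ω ∈ A n → condIncr 𝓕 P f n ω = 0 := by
    intro n
    have h2 := condLExp_indicator (P := P) (𝓕.le n) (fun ω => ‖f (n + 1) ω - f n ω‖ₑ ^ 2) (hA n)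
    have h3 : (A n).indicator (fun ω => ‖f (n + 1) ω - f n ω‖ₑ ^ 2) =ᵐ[P] 0 := by
      filter_upwards [h n] with ω hω
      by_cases hωA : ω ∈ A n
      · simp [hωA, hω hωA]
      · simp [hωA]
    have h4 := condLExp_congr_ae (mΩ := 𝓕 n) h3
    rw [condLExp_zero] at h4
    filter_upwards [h2, h4] with ω h2 h4 hω
    rw [h4, Set.indicator_of_mem hω] at h2
    exact h2.symm
  filter_upwards [ae_all_iff.2 h1] with ω hω hall
  have : condVar 𝓕 P f ω ≤ 0 := condVar_le_of_tsum_le (by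
    rw [ENNReal.tsum_eq_zero.2 fun n => hω n (hall n)]
    exact bot_le)
  exact le_antisymm this bot_le

/-! ### Martingale transforms by predictable events -/

/-- The transform `∑_{i < n} χ_{A_i} (f_{i+1} - f_i)`. -/
def transform (A : ℕ → Set Ω) (f : ℕ → Ω → ℝ) (n : ℕ) (ω : Ω) : ℝ :=
  ∑ i ∈ Finset.range n, (A i).indicator (fun ω => f (i + 1) ω - f i ω) ω

lemma transform_succ_sub {Ω : Type*} (A : ℕ → Set Ω) (f : ℕ → Ω → ℝ) (n : ℕ) (ω : Ω) :
    transform A f (n + 1) ω - transform A f n ω =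
      (A n).indicator (fun ω => f (n + 1) ω - f n ω) ω := by
  simp only [transform, Finset.sum_range_succ]
  ring

lemma martingale_transform {A : ℕ → Set Ω} (hA : ∀ n, MeasurableSet[𝓕 n] (A n))
    (hf : Martingale f 𝓕 P) : Martingale (transform A f) 𝓕 P := by
  have hincr : ∀ i, Integrable ((A i).indicator (fun ω => f (i + 1) ω - f i ω)) P := fun i =>
    ((hf.integrable (i + 1)).sub (hf.integrable i)).indicator (𝓕.le i _ (hA i))
  refine martingale_of_condExp_sub_eq_zero_nat (fun n => ?_) (fun n => ?_) fun n => ?_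
  · refine Finset.stronglyMeasurable_fun_sum (m := 𝓕 n) _ fun i hi => ?_
    have hi' := Finset.mem_range.1 hi
    exact (((hf.stronglyMeasurable (i + 1)).mono (𝓕.mono hi')).sub
      ((hf.stronglyMeasurable i).mono (𝓕.mono hi'.le))).indicator (𝓕.mono hi'.le _ (hA i))
  · exact integrable_finsetSum _ fun i _ => hincr i
  · have e : transform A f (n + 1) - transform A f n =
        (A n).indicator (f (n + 1) - f n) := by
      ext ω
      exact transform_succ_sub A f n ω
    rw [e]
    have h1 := condExp_indicator (m := 𝓕 n) ((hf.integrable (n + 1)).sub (hf.integrable n)) (hA n)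
    have h2 : P[f (n + 1) - f n | 𝓕 n] =ᵐ[P] P[f (n + 1) | 𝓕 n] - P[f n | 𝓕 n] :=
      condExp_sub (hf.integrable _) (hf.integrable _) _
    filter_upwards [h1, h2, hf.condExp_ae_eq n.le_succ, hf.condExp_ae_eq (le_refl n)]
      with ω h1 h2 h3 h4
    rw [h1]
    by_cases hω : ω ∈ A n
    · rw [Set.indicator_of_mem hω, h2, Pi.sub_apply, h3, h4]
      simp
    · simp [hω]

lemma condIncr_transform {A : ℕ → Set Ω} (hA : ∀ n, MeasurableSet[𝓕 n] (A n)) (n : ℕ) :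
    condIncr 𝓕 P (transform A f) n =ᵐ[P] (A n).indicator (condIncr 𝓕 P f n) := by
  refine EventuallyEq.trans (condLExp_congr_ae (Eventually.of_forall fun ω => ?_))
    (condLExp_indicator (𝓕.le n) _ (hA n))
  simp only [transform_succ_sub]
  by_cases hω : ω ∈ A n <;> simp [hω]

lemma condVar_transform_le {A : ℕ → Set Ω} (hA : ∀ n, MeasurableSet[𝓕 n] (A n)) :
    condVar 𝓕 P (transform A f) ≤ᵐ[P] condVar 𝓕 P f := by
  filter_upwards [ae_all_iff.2 (condIncr_transform (P := P) (f := f) hA)] with ω hω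
  refine condVar_le_of_tsum_le ?_
  rw [condVar_sq]
  refine ENNReal.tsum_le_tsum fun n => ?_
  rw [hω n]
  exact Set.indicator_le_self _ _ _

/-- Terms of a series that are kept only as long as the partial sums stay below `L` sum to at
most `L`. -/
lemma tsum_ite_le (e : ℕ → ℝ≥0∞) (L : ℝ≥0∞) :
    ∑' n, (if ∑ i ∈ Finset.range (n + 1), e i ≤ L then e n else 0) ≤ L := by
  refine ENNReal.tsum_le_of_sum_range_le fun N => ?_
  suffices h : (∑ n ∈ Finset.range N, if ∑ i ∈ Finset.range (n + 1), e i ≤ L then e n else 0) ≤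
      ∑ i ∈ Finset.range N, e i ∧
      (∑ n ∈ Finset.range N, if ∑ i ∈ Finset.range (n + 1), e i ≤ L then e n else 0) ≤ L from h.2
  induction N with
  | zero => simp
  | succ N ih =>
    rw [Finset.sum_range_succ]
    split_ifs with h
    · have h1 : (∑ n ∈ Finset.range N, if ∑ i ∈ Finset.range (n + 1), e i ≤ L then e n else 0) +
          e N ≤ ∑ i ∈ Finset.range (N + 1), e i := by
        rw [Finset.sum_range_succ]
        exact add_le_add ih.1 le_rfl
      exact ⟨h1, h1.trans h⟩
    · rw [add_zero]
      refine ⟨ih.1.trans ?_, ih.2⟩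
      rw [Finset.sum_range_succ]
      exact le_self_add

end CondVar

/-! ### The duality estimate -/

section Pairing

variable {Ω : Type*} [mΩ : MeasurableSpace Ω] {P : Measure Ω} {𝓕 : Filtration ℕ mΩ}

lemma tsum_lintegral_mul_le {μ : ℕ → Measure Ω} {F G : ℕ → Ω → ℝ≥0∞}
    (hF : ∀ n, AEMeasurable (F n) (μ n)) (hG : ∀ n, AEMeasurable (G n) (μ n)) :
    ∑' n, ∫⁻ ω, F n ω * G n ω ∂(μ n) ≤
      (∑' n, ∫⁻ ω, F n ω ^ 2 ∂(μ n)) ^ (1 / 2 : ℝ) *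
        (∑' n, ∫⁻ ω, G n ω ^ 2 ∂(μ n)) ^ (1 / 2 : ℝ) := by
  have h1 : ∀ n, ∫⁻ ω, F n ω * G n ω ∂(μ n) ≤
      (∫⁻ ω, F n ω ^ 2 ∂(μ n)) ^ (1 / 2 : ℝ) * (∫⁻ ω, G n ω ^ 2 ∂(μ n)) ^ (1 / 2 : ℝ) := by
    intro n
    simpa using ENNReal.lintegral_mul_le_Lp_mul_Lq (μ n) Real.HolderConjugate.two_two (hF n) (hG n)
  have h2 := ENNReal.lintegral_mul_le_Lp_mul_Lq (Measure.count (α := ℕ))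
    Real.HolderConjugate.two_two
    (f := fun n => (∫⁻ ω, F n ω ^ 2 ∂(μ n)) ^ (1 / 2 : ℝ))
    (g := fun n => (∫⁻ ω, G n ω ^ 2 ∂(μ n)) ^ (1 / 2 : ℝ))
    (measurable_of_countable _).aemeasurable (measurable_of_countable _).aemeasurable
  simp only [lintegral_count, Pi.mul_apply, ← ENNReal.rpow_mul, one_div,
    inv_mul_cancel₀ (two_ne_zero' ℝ), ENNReal.rpow_one] at h2
  refine (ENNReal.tsum_le_tsum h1).trans ?_
  simpa using h2

/-- An increasing sequence of events `D_n ∈ 𝓕_n` is the sequence `{ν ≤ n}` of a stopping time. -/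
lemma exists_isStoppingTime_of_monotone {D : ℕ → Set Ω} (hD : ∀ n, MeasurableSet[𝓕 n] (D n))
    (hmono : Monotone D) : ∃ ν : Ω → WithTop ℕ, IsStoppingTime 𝓕 ν ∧
      (∀ n : ℕ, {ω | ν ω ≤ WithTop.some n} = D n) ∧ {ω | ν ω < ⊤} = ⋃ n, D n := by
  classical
  set ν : Ω → WithTop ℕ := fun ω =>
    if h : ∃ n, ω ∈ D n then WithTop.some (Nat.find h) else ⊤ with hν
  have hle : ∀ n : ℕ, {ω | ν ω ≤ WithTop.some n} = D n := by
    intro n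
    ext ω
    simp only [Set.mem_ofPred_eq, hν]
    constructor
    · intro h
      split_ifs at h with hex
      · exact hmono (WithTop.coe_le_coe.1 h) (Nat.find_spec hex)
      · exact absurd h (not_le.2 (WithTop.coe_lt_top n))
    · intro h
      have hex : ∃ n, ω ∈ D n := ⟨n, h⟩
      rw [dif_pos hex]
      exact WithTop.coe_le_coe.2 (Nat.find_min' hex h)
  refine ⟨ν, fun n => ?_, hle, ?_⟩
  · have := hD n
    rwa [← hle n] at this
  · ext ω
    simp only [Set.mem_ofPred_eq, Set.mem_iUnion, hν]
    split_ifs with hex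
    · exact iff_of_true (WithTop.coe_lt_top _) hex
    · exact iff_of_false (lt_irrefl _) hex

variable [IsProbabilityMeasure P] {ℓ : ℝ} {Φ : ℝ → ℝ} {f : ℕ → Ω → ℝ} {g : Ω → ℝ}

/-- The contribution to the pairing of the part of the martingale `f` that starts with the events
`D_n` and ends when the variation exceeds `L`; in the atomic decomposition of `f` this part is
(a multiple of) an atom. -/
lemma tsum_setLIntegral_mul_le_oscillation (h𝓕 : ⨆ n, 𝓕 n = mΩ) (hf : ∀ n, Measurable (f n))
    (hg : MemLp g 2 P) {D : ℕ → Set Ω} (hD : ∀ n, MeasurableSet[𝓕 n] (D n)) (hmono : Monotone D)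
    {x : ℝ} (hx : P (⋃ n, D n) ≤ ENNReal.ofReal x) (L : ℝ≥0∞) :
    ∑' n, ∫⁻ ω in D n ∩ {ω | partialVar 𝓕 P f n ω ≤ L},
      ‖f (n + 1) ω - f n ω‖ₑ * ‖(P[g | 𝓕 (n + 1)]) ω - (P[g | 𝓕 n]) ω‖ₑ ∂P ≤
      (L * ENNReal.ofReal x) ^ (1 / 2 : ℝ) * oscillation 𝓕 P g x := by
  have hB : ∀ n, MeasurableSet[𝓕 n] (D n ∩ {ω | partialVar 𝓕 P f n ω ≤ L}) := fun n =>
    (hD n).inter (measurable_partialVar n measurableSet_Iic)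
  have hDU : MeasurableSet (⋃ n, D n) := MeasurableSet.iUnion fun n => 𝓕.le n _ (hD n)
  refine (tsum_lintegral_mul_le (fun n => ((hf (n + 1)).sub (hf n)).enorm.aemeasurable)
    fun n => ?_).trans (mul_le_mul' (ENNReal.rpow_le_rpow ?_ (by norm_num)) ?_)
  · have h1 : ∀ k, Measurable (P[g | 𝓕 k]) := fun k =>
      (stronglyMeasurable_condExp.mono (𝓕.le k)).measurable
    exact ((h1 (n + 1)).sub (h1 n)).enorm.aemeasurable
  · calc ∑' n, ∫⁻ ω in D n ∩ {ω | partialVar 𝓕 P f n ω ≤ L}, ‖f (n + 1) ω - f n ω‖ₑ ^ 2 ∂P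
        = ∑' n, ∫⁻ ω, (D n ∩ {ω | partialVar 𝓕 P f n ω ≤ L}).indicator
            (condIncr 𝓕 P f n) ω ∂P := by
          refine tsum_congr fun n => ?_
          rw [lintegral_indicator (𝓕.le n _ (hB n))]
          exact (setLIntegral_condLExp (𝓕.le n) P _ (hB n)).symm
      _ = ∫⁻ ω, ∑' n, (D n ∩ {ω | partialVar 𝓕 P f n ω ≤ L}).indicator
            (condIncr 𝓕 P f n) ω ∂P :=
          (lintegral_tsum fun n =>
            ((measurable_condIncr n).indicator (𝓕.le n _ (hB n))).aemeasurable).symm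
      _ ≤ ∫⁻ ω, (⋃ n, D n).indicator (fun _ => L) ω ∂P := by
          refine lintegral_mono fun ω => ?_
          by_cases hω : ω ∈ ⋃ n, D n
          · rw [Set.indicator_of_mem hω]
            refine le_trans (ENNReal.tsum_le_tsum fun n => ?_)
              (tsum_ite_le (fun n => condIncr 𝓕 P f n ω) L)
            by_cases hωn : partialVar 𝓕 P f n ω ≤ L
            · rw [if_pos (by exact hωn)]
              exact Set.indicator_le_self _ _ _
            · rw [Set.indicator_of_notMem fun h => hωn h.2]
              exact bot_le
          · rw [Set.indicator_of_notMem hω]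
            refine le_of_eq (ENNReal.tsum_eq_zero.2 fun n => ?_)
            exact Set.indicator_of_notMem (fun h => hω (Set.mem_iUnion.2 ⟨n, h.1⟩)) _
      _ = L * P (⋃ n, D n) := by rw [lintegral_indicator_const hDU]
      _ ≤ L * ENNReal.ofReal x := by gcongr
  · obtain ⟨ν, hν, hle, hfin⟩ := exists_isStoppingTime_of_monotone hD hmono
    have h1 : ∑' n, ∫⁻ ω in D n ∩ {ω | partialVar 𝓕 P f n ω ≤ L},
        ‖(P[g | 𝓕 (n + 1)]) ω - (P[g | 𝓕 n]) ω‖ₑ ^ 2 ∂P ≤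
        eLpNorm (fun ω => g ω - stopped 𝓕 P g ν ω) 2 P ^ 2 := by
      refine le_trans (ENNReal.tsum_le_tsum fun n => ?_) (tsum_setLIntegral_increment_le h𝓕 hν hg)
      rw [hle n]
      exact lintegral_mono_set Set.inter_subset_left
    have h2 : eLpNorm (fun ω => g ω - stopped 𝓕 P g ν ω) 2 P ≤ oscillation 𝓕 P g x :=
      le_iSup₂_of_le ν ⟨hν, by rwa [hfin]⟩ le_rfl
    calc _ ≤ (eLpNorm (fun ω => g ω - stopped 𝓕 P g ν ω) 2 P ^ 2) ^ (1 / 2 : ℝ) :=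
          ENNReal.rpow_le_rpow h1 (by norm_num)
      _ = eLpNorm (fun ω => g ω - stopped 𝓕 P g ν ω) 2 P := by
          rw [← ENNReal.rpow_natCast, ← ENNReal.rpow_mul]
          norm_num
      _ ≤ _ := h2

/-- The pairing of `f` and `g` converges absolutely, with a bound by the dyadic form of the
Campanato norm. The pairs `(n, ω)` are sorted by the dyadic level of `s_{n+1}(f)(ω)`. -/
lemma tsum_lintegral_mul_le_tsum_weight (h𝓕 : ⨆ n, 𝓕 n = mΩ) (hΦ : MemG ℓ Φ)
    (hconc : ConcaveOn ℝ (Set.Ici 0) Φ) {D : ℝ}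
    (hD : ∀ s, 0 ≤ s → inverse Φ (2 * s) ≤ D * inverse Φ s) (hf : ∀ n, Measurable (f n))
    (hg : MemLp g 2 P) {ρ : ℝ} (hρ : weakNorm Φ P (condVar 𝓕 P f) < ENNReal.ofReal ρ) :
    ∑' n, ∫⁻ ω, ‖f (n + 1) ω - f n ω‖ₑ * ‖(P[g | 𝓕 (n + 1)]) ω - (P[g | 𝓕 n]) ω‖ₑ ∂P ≤
      ENNReal.ofReal (ρ * D) *
        ∑' k, ENNReal.ofReal (weight Φ k) * oscillation 𝓕 P g ((1 / 2) ^ k) := by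
  have hρ0 : 0 < ρ := ENNReal.ofReal_pos.1 (bot_le.trans_lt hρ)
  have hmeas := measure_lt_level_le hΦ hconc hρ
  have hlev := level_pos hΦ hconc
  set L : ℕ → ℝ≥0∞ := fun k => ENNReal.ofReal (ρ * level Φ k) ^ 2 with hL
  set A : ℕ → ℕ → Set Ω := fun k n =>
    if k = 0 then Set.univ else {ω | L k < partialVar 𝓕 P f n ω} with hA
  set F : ℕ → Ω → ℝ≥0∞ := fun n ω =>
    ‖f (n + 1) ω - f n ω‖ₑ * ‖(P[g | 𝓕 (n + 1)]) ω - (P[g | 𝓕 n]) ω‖ₑ with hF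
  have hAm : ∀ k n, MeasurableSet[𝓕 n] (A k n) := by
    intro k n
    simp only [hA]
    split_ifs
    · exact MeasurableSet.univ
    · exact measurable_partialVar n measurableSet_Ioi
  have hAmono : ∀ k, Monotone (A k) := by
    intro k m n hmn
    simp only [hA]
    split_ifs
    · exact le_rfl
    · intro ω hω
      rw [Set.mem_ofPred_eq] at hω ⊢
      exact hω.trans_le (partialVar_mono ω hmn)
  have hAP : ∀ k, P (⋃ n, A k n) ≤ ENNReal.ofReal ((1 / 2) ^ k) := by
    intro k
    rcases Nat.eq_zero_or_pos k with rfl | hk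
    · simpa using prob_le_one
    · have e : ENNReal.ofReal ((1 / 2) ^ k) = (1 / 2) ^ k := by
        rw [ENNReal.ofReal_pow (by norm_num), ENNReal.ofReal_div_of_pos (by norm_num)]
        norm_num
      rw [e]
      refine le_trans (measure_mono (Set.iUnion_subset fun n ω hω => ?_)) (hmeas k)
      simp only [hA, if_neg hk.ne', Set.mem_ofPred_eq] at hω ⊢
      exact lt_of_pow_lt_pow_left' 2 (hω.trans_le (partialVar_le_condVar_sq n ω))
  have hBm : ∀ k n, MeasurableSet (A k n ∩ {ω | partialVar 𝓕 P f n ω ≤ L (k + 1)}) :=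
    fun k n => 𝓕.le n _ ((hAm k n).inter (measurable_partialVar n measurableSet_Iic))
  have hfin : ∀ᵐ ω ∂P, condVar 𝓕 P f ω < ∞ := by
    have h0 : P {ω | condVar 𝓕 P f ω = ∞} = 0 := by
      refine le_antisymm (ge_of_tendsto'
        (ENNReal.tendsto_pow_atTop_nhds_zero_of_lt_one (r := 1 / 2) ?_) fun k => ?_) bot_le
      · rw [one_div]
        exact ENNReal.inv_lt_one.2 (by norm_num)
      · refine (measure_mono fun ω hω => ?_).trans (hmeas k)
        rw [Set.mem_ofPred_eq] at hω ⊢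
        rw [hω]
        exact ENNReal.ofReal_lt_top
    rw [ae_iff]
    simpa using h0
  have hcover : ∀ᵐ ω ∂P, ∀ n,
      ∃ k, ω ∈ A k n ∩ {ω | partialVar 𝓕 P f n ω ≤ L (k + 1)} := by
    filter_upwards [hfin] with ω hω n
    have hpv : partialVar 𝓕 P f n ω < ∞ :=
      (partialVar_le_condVar_sq n ω).trans_lt (ENNReal.pow_lt_top hω)
    have hex : ∃ k, partialVar 𝓕 P f n ω ≤ L (k + 1) := by
      have ht : Tendsto L atTop (𝓝 ∞) := by
        have h1 : Tendsto (fun k => ENNReal.ofReal (ρ * level Φ k)) atTop (𝓝 ∞) :=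
          ENNReal.tendsto_ofReal_atTop.comp ((tendsto_level hΦ hconc).const_mul_atTop hρ0)
        simpa using ENNReal.Tendsto.pow (n := 2) h1
      obtain ⟨k, hk⟩ := (((tendsto_add_atTop_iff_nat 1).2 ht).eventually_const_lt hpv).exists
      exact ⟨k, hk.le⟩
    classical
    refine ⟨Nat.find hex, ?_, Nat.find_spec hex⟩
    simp only [hA]
    split_ifs with h0
    · trivial
    · have := Nat.find_min hex (Nat.sub_one_lt h0)
      rw [Nat.sub_add_cancel (Nat.one_le_iff_ne_zero.2 h0), not_le] at this
      exact this
  have hFm : ∀ n, Measurable (F n) := by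
    have h1 : ∀ k, Measurable (P[g | 𝓕 k]) := fun k =>
      (stronglyMeasurable_condExp.mono (𝓕.le k)).measurable
    exact fun n => ((hf (n + 1)).sub (hf n)).enorm.mul ((h1 (n + 1)).sub (h1 n)).enorm
  calc ∑' n, ∫⁻ ω, F n ω ∂P
      ≤ ∑' n, ∫⁻ ω, ∑' k, (A k n ∩ {ω | partialVar 𝓕 P f n ω ≤ L (k + 1)}).indicator
          (F n) ω ∂P := by
        refine ENNReal.tsum_le_tsum fun n => lintegral_mono_ae ?_
        filter_upwards [hcover] with ω hω
        obtain ⟨k, hk⟩ := hω n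
        refine le_trans (le_of_eq ?_) (ENNReal.le_tsum k)
        rw [Set.indicator_of_mem hk]
    _ = ∑' n, ∑' k, ∫⁻ ω in A k n ∩ {ω | partialVar 𝓕 P f n ω ≤ L (k + 1)}, F n ω ∂P := by
        refine tsum_congr fun n => ?_
        rw [lintegral_tsum fun k => ((hFm n).indicator (hBm k n)).aemeasurable]
        exact tsum_congr fun k => lintegral_indicator (hBm k n) _
    _ = ∑' k, ∑' n, ∫⁻ ω in A k n ∩ {ω | partialVar 𝓕 P f n ω ≤ L (k + 1)}, F n ω ∂P :=
        ENNReal.tsum_comm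
    _ ≤ ∑' k, (L (k + 1) * ENNReal.ofReal ((1 / 2) ^ k)) ^ (1 / 2 : ℝ) *
          oscillation 𝓕 P g ((1 / 2) ^ k) :=
        ENNReal.tsum_le_tsum fun k => tsum_setLIntegral_mul_le_oscillation h𝓕 hf hg (hAm k)
          (hAmono k) (hAP k) (L (k + 1))
    _ ≤ ∑' k, ENNReal.ofReal (ρ * D) *
          (ENNReal.ofReal (weight Φ k) * oscillation 𝓕 P g ((1 / 2) ^ k)) := by
        refine ENNReal.tsum_le_tsum fun k => ?_
        rw [← mul_assoc, ← ENNReal.ofReal_mul' (weight_pos hΦ hconc k).le]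
        gcongr
        have hk1 := hlev (k + 1)
        simp only [hL]
        rw [ENNReal.mul_rpow_of_nonneg _ _ (by norm_num), ← ENNReal.rpow_natCast,
          ← ENNReal.rpow_mul, ENNReal.ofReal_rpow_of_pos (p := 1 / 2) (pow_pos (by norm_num) k),
          ← Real.sqrt_eq_rpow, Nat.cast_ofNat, mul_one_div_cancel (two_ne_zero' ℝ),
          ENNReal.rpow_one, ← ENNReal.ofReal_mul (by positivity)]
        refine ENNReal.ofReal_le_ofReal ?_
        rw [weight, ← mul_assoc, mul_assoc ρ D]
        gcongr
        exact level_succ_le hD k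
    _ = _ := ENNReal.tsum_mul_left

end Pairing

/-! ### The weak Orlicz-Hardy space -/

namespace Hardy

variable {Ω : Type*} [mΩ : MeasurableSpace Ω] {ℓ : ℝ} {Φ : ℝ → ℝ} {hΦ : MemG ℓ Φ}
  {𝓕 : Filtration ℕ mΩ} {P : Measure Ω}

lemma martingale_seq (f : Hardy hΦ 𝓕 P) : Martingale f.seq 𝓕 P := f.2.1

lemma seq_zero_ae (f : Hardy hΦ 𝓕 P) : f.seq 0 =ᵐ[P] 0 := f.2.2.1

lemma hasAbsContNorm_condVar (f : Hardy hΦ 𝓕 P) : HasAbsContNorm Φ P (condVar 𝓕 P f.seq) :=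
  f.2.2.2

lemma measurable_seq (f : Hardy hΦ 𝓕 P) (n : ℕ) : Measurable (f.seq n) :=
  ((f.martingale_seq.stronglyMeasurable n).mono (𝓕.le n)).measurable

lemma quasiNorm_lt_top (f : Hardy hΦ 𝓕 P) : quasiNorm f < ∞ := f.hasAbsContNorm_condVar.1

lemma quasiNorm_smul_le {a : ℝ} (ha : 0 < a) (f : Hardy hΦ 𝓕 P) :
    quasiNorm (a • f) ≤ ENNReal.ofReal a * quasiNorm f := by
  refine le_trans (weakNorm_mono ?_) (weakNorm_const_mul_le ha)
  filter_upwards [condVar_smul (P := P) (𝓕 := 𝓕) a f.seq] with ω h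
  rw [show (a • f).seq = a • f.seq from rfl, h, Real.enorm_eq_ofReal ha.le]

/-! ### Continuous linear functionals on the weak Orlicz-Hardy space -/

lemma continuous_of_bound (l : Hardy hΦ 𝓕 P →ₗ[ℝ] ℝ) {M : ℝ≥0∞} (hM : M < ∞)
    (h : ∀ (f : Hardy hΦ 𝓕 P) (ρ : ℝ), quasiNorm f < ENNReal.ofReal ρ →
      ‖l f‖ₑ ≤ ENNReal.ofReal ρ * M) : Continuous l := by
  refine continuous_def.2 fun U hU => ?_
  show ∀ f ∈ l ⁻¹' U, ∃ ε : ℝ≥0∞, 0 < ε ∧ ∀ g, quasiNorm (g - f) < ε → g ∈ l ⁻¹' U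
  intro f hf
  obtain ⟨δ, hδ, hball⟩ := Metric.isOpen_iff.1 hU (l f) hf
  set m := M.toReal with hm
  have hm0 : 0 ≤ m := ENNReal.toReal_nonneg
  refine ⟨ENNReal.ofReal (δ / (m + 1)), ENNReal.ofReal_pos.2 (by positivity), fun g hg => ?_⟩
  refine hball ?_
  have h1 := h _ _ hg
  rw [map_sub, ← ENNReal.ofReal_toReal hM.ne, ← ENNReal.ofReal_mul (by positivity),
    ← ofReal_norm, ENNReal.ofReal_le_ofReal_iff (by positivity)] at h1
  rw [Metric.mem_ball, dist_eq_norm]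
  refine h1.trans_lt ?_
  rw [← hm, div_mul_eq_mul_div, div_lt_iff₀ (by positivity)]
  nlinarith

lemma exists_quasiNorm_lt_imp (l : Hardy hΦ 𝓕 P →L[ℝ] ℝ) {δ : ℝ} (hδ : 0 < δ) :
    ∃ ε : ℝ≥0∞, 0 < ε ∧ ∀ f, quasiNorm f < ε → |l f| < δ := by
  have hopen : IsOpen (l ⁻¹' Metric.ball 0 δ) := Metric.isOpen_ball.preimage l.continuous
  have h0 : (0 : Hardy hΦ 𝓕 P) ∈ l ⁻¹' Metric.ball 0 δ := by simpa using hδ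
  obtain ⟨ε, hε, h⟩ := (show ∀ f ∈ l ⁻¹' Metric.ball 0 δ, ∃ ε : ℝ≥0∞, 0 < ε ∧
    ∀ g, quasiNorm (g - f) < ε → g ∈ l ⁻¹' Metric.ball 0 δ from hopen) 0 h0
  refine ⟨ε, hε, fun f hf => ?_⟩
  have := h f (by rwa [sub_zero])
  simpa using this

lemma dualNorm_lt_top (l : Hardy hΦ 𝓕 P →L[ℝ] ℝ) : dualNorm l < ∞ := by
  obtain ⟨ε, hε, h⟩ := exists_quasiNorm_lt_imp l one_pos
  obtain ⟨b, hb0, hb⟩ := ENNReal.lt_iff_exists_nnreal_btwn.1 hε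
  have hb0' : (0 : ℝ) < b := by exact_mod_cast hb0
  refine lt_of_le_of_lt (iSup₂_le fun f hf => ?_) (ENNReal.ofReal_lt_top (r := 1 / b))
  have h1 : quasiNorm ((b : ℝ) • f) < ε := by
    refine (quasiNorm_smul_le hb0' f).trans_lt (lt_of_le_of_lt ?_ hb)
    rw [ENNReal.ofReal_coe_nnreal]
    exact mul_le_of_le_one_right bot_le hf
  have h2 := h _ h1
  rw [map_smul, smul_eq_mul, abs_mul, abs_of_pos hb0'] at h2
  rw [← ofReal_norm, Real.norm_eq_abs]
  refine ENNReal.ofReal_le_ofReal ?_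
  rw [le_div_iff₀ hb0', mul_comm]
  exact h2.le

lemma enorm_apply_le (l : Hardy hΦ 𝓕 P →L[ℝ] ℝ) {f : Hardy hΦ 𝓕 P} {ρ : ℝ}
    (h : quasiNorm f < ENNReal.ofReal ρ) : ‖l f‖ₑ ≤ ENNReal.ofReal ρ * dualNorm l := by
  have hρ : 0 < ρ := ENNReal.ofReal_pos.1 (bot_le.trans_lt h)
  have h1 : quasiNorm (ρ⁻¹ • f) ≤ 1 := by
    refine (quasiNorm_smul_le (inv_pos.2 hρ) f).trans ?_
    calc ENNReal.ofReal ρ⁻¹ * quasiNorm f ≤ ENNReal.ofReal ρ⁻¹ * ENNReal.ofReal ρ := by gcongr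
      _ = 1 := by rw [← ENNReal.ofReal_mul (by positivity), inv_mul_cancel₀ hρ.ne']; simp
  have h2 : ‖l (ρ⁻¹ • f)‖ₑ ≤ dualNorm l := le_iSup₂_of_le _ h1 le_rfl
  have h3 : l f = ρ * l (ρ⁻¹ • f) := by
    rw [map_smul, smul_eq_mul, mul_inv_cancel_left₀ hρ.ne']
  rw [h3, enorm_mul, Real.enorm_eq_ofReal hρ.le]
  gcongr

/-- Continuous linear functionals do not distinguish martingales whose difference has no
variation. -/
lemma apply_eq_of_condVar_sub_eq_zero (l : Hardy hΦ 𝓕 P →L[ℝ] ℝ) {f f' : Hardy hΦ 𝓕 P}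
    (h : condVar 𝓕 P (f - f').seq =ᵐ[P] 0) : l f = l f' := by
  have h0 : quasiNorm (f - f') = 0 :=
    le_antisymm ((weakNorm_mono h.le).trans_eq (weakNorm_zero Φ P)) bot_le
  rw [← sub_eq_zero, ← map_sub, ← abs_eq_zero]
  refine le_antisymm (le_of_forall_pos_lt_add fun δ hδ => ?_) (abs_nonneg _)
  obtain ⟨ε, hε, H⟩ := exists_quasiNorm_lt_imp l hδ
  rw [zero_add]
  exact H _ (h0 ▸ hε)

lemma apply_eq_of_ae_eq (l : Hardy hΦ 𝓕 P →L[ℝ] ℝ) {f f' : Hardy hΦ 𝓕 P}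
    (h : ∀ n, f.seq n =ᵐ[P] f'.seq n) : l f = l f' := by
  refine apply_eq_of_condVar_sub_eq_zero l ?_
  have h1 : condVar 𝓕 P (f - f').seq =ᵐ[P] condVar 𝓕 P ((0 : ℝ) • f.seq) := by
    refine condVar_congr_of_ae_eq fun n => ?_
    filter_upwards [h n] with ω hω
    show f.seq n ω - f'.seq n ω = (0 : ℝ) • f.seq n ω
    rw [hω, sub_self, zero_smul]
  filter_upwards [h1, condVar_smul (P := P) (𝓕 := 𝓕) 0 f.seq] with ω h1 h2
  rw [h1, h2]
  simp

variable [IsProbabilityMeasure P]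

/-! ### Square integrable functions as elements of the Hardy space -/

lemma lintegral_condVar_sq_condExp_le {h : Ω → ℝ} (hh : MemLp h 2 P) :
    ∫⁻ ω, condVar 𝓕 P (fun n ω => (P[h | 𝓕 n]) ω - (P[h | 𝓕 0]) ω) ω ^ 2 ∂P ≤
      ∫⁻ ω, ‖h ω‖ₑ ^ 2 ∂P := by
  rw [lintegral_condVar_sq]
  simp only [sub_sub_sub_cancel_right]
  exact tsum_lintegral_condExp_sub_sq_le 𝓕 hh

/-- The martingale `E_n h - E_0 h` of a square integrable function `h`. -/
def ofMemLp (hΦ : MemG ℓ Φ) (hconc : ConcaveOn ℝ (Set.Ici 0) Φ) (𝓕 : Filtration ℕ mΩ) {h : Ω → ℝ}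
    (hh : MemLp h 2 P) : Hardy hΦ 𝓕 P :=
  ⟨fun n ω => (P[h | 𝓕 n]) ω - (P[h | 𝓕 0]) ω, by
    refine ⟨?_, Eventually.of_forall fun ω => sub_self _, ?_⟩
    · have h0 : Martingale (fun _ : ℕ => P[h | 𝓕 0]) 𝓕 P :=
        martingale_const_fun 𝓕 P stronglyMeasurable_condExp integrable_condExp
      exact (martingale_condExp h 𝓕 P).sub h0
    · exact hasAbsContNorm_of_lintegral_sq_lt_top hΦ hconc measurable_condVar.aemeasurable
        ((lintegral_condVar_sq_condExp_le hh).trans_lt (lintegral_enorm_sq_lt_top hh))⟩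

variable {hconc : ConcaveOn ℝ (Set.Ici 0) Φ}

lemma ofMemLp_seq {h : Ω → ℝ} (hh : MemLp h 2 P) (n : ℕ) (ω : Ω) :
    (ofMemLp hΦ hconc 𝓕 hh).seq n ω = (P[h | 𝓕 n]) ω - (P[h | 𝓕 0]) ω := rfl

lemma memH2_ofMemLp {h : Ω → ℝ} (hh : MemLp h 2 P) : (ofMemLp hΦ hconc 𝓕 hh).MemH2 :=
  (lintegral_condVar_sq_condExp_le hh).trans_lt (lintegral_enorm_sq_lt_top hh)

lemma quasiNorm_ofMemLp_le {h : Ω → ℝ} (hh : MemLp h 2 P) {a : ℝ} (ha : 0 < a)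
    (h2 : eLpNorm h 2 P ≤ ENNReal.ofReal a) :
    quasiNorm (ofMemLp hΦ hconc 𝓕 hh) ≤ ENNReal.ofReal (a / level Φ 0) := by
  refine weakNorm_le_of_lintegral_sq_le hΦ hconc measurable_condVar.aemeasurable ha ?_
  refine (lintegral_condVar_sq_condExp_le hh).trans ?_
  rw [lintegral_enorm_sq_eq_eLpNorm]
  gcongr

/-! ### Density of square integrable martingales -/

/-- The transform of an element of the Hardy space by predictable events. -/
def trunc (f : Hardy hΦ 𝓕 P) (A : ℕ → Set Ω) (hA : ∀ n, MeasurableSet[𝓕 n] (A n)) :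
    Hardy hΦ 𝓕 P :=
  ⟨transform A f.seq, martingale_transform hA f.martingale_seq,
    Eventually.of_forall fun ω => by simp [transform],
    f.hasAbsContNorm_condVar.mono (condVar_transform_le hA)⟩

lemma condIncr_sub_trunc (f : Hardy hΦ 𝓕 P) {A : ℕ → Set Ω}
    (hA : ∀ n, MeasurableSet[𝓕 n] (A n)) (n : ℕ) :
    condIncr 𝓕 P (f - f.trunc A hA).seq n =ᵐ[P] (A n)ᶜ.indicator (condIncr 𝓕 P f.seq n) := by
  refine EventuallyEq.trans (condLExp_congr_ae (Eventually.of_forall fun ω => ?_))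
    (condIncr_transform (A := fun n => (A n)ᶜ) (fun n => (hA n).compl) n)
  have h1 : ∀ k, (f - f.trunc A hA).seq k ω = f.seq k ω - transform A f.seq k ω := fun _ => rfl
  have h2 := transform_succ_sub A f.seq n ω
  have h3 := transform_succ_sub (fun n => (A n)ᶜ) f.seq n ω
  dsimp only
  rw [h1, h1, h3, sub_sub_sub_comm, h2]
  by_cases hω : ω ∈ A n <;> simp [hω]

/-- Truncating when the variation exceeds a high level changes an element of the Hardy space
little: this is where the absolute continuity of the quasi-norm enters. -/
lemma exists_trunc_quasiNorm_sub_lt (hconc : ConcaveOn ℝ (Set.Ici 0) Φ) (f : Hardy hΦ 𝓕 P)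
    {ε : ℝ≥0∞} (hε : 0 < ε) : ∃ (c : ℝ≥0∞) (A : ℕ → Set Ω)
      (hA : ∀ n, MeasurableSet[𝓕 n] (A n)), c < ∞ ∧
      (∀ᵐ ω ∂P, condVar 𝓕 P (f.trunc A hA).seq ω ^ 2 ≤ c) ∧
      quasiNorm (f - f.trunc A hA) < ε := by
  obtain ⟨δ, hδ, H⟩ := f.hasAbsContNorm_condVar.2 ε hε
  obtain ⟨r, hr, -⟩ := ENNReal.lt_iff_exists_nnreal_btwn.1 f.quasiNorm_lt_top
  obtain ⟨k, hk⟩ := ((ENNReal.tendsto_pow_atTop_nhds_zero_of_lt_one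
    (r := 1 / 2) (by rw [one_div]; exact ENNReal.inv_lt_one.2 (by norm_num))).eventually_lt_const
    hδ).exists
  set b : ℝ≥0∞ := ENNReal.ofReal (r * level Φ k) with hb
  have hPb : P {ω | b < condVar 𝓕 P f.seq ω} < δ := by
    refine (measure_lt_level_le hΦ hconc (ρ := r) ?_ k).trans_lt hk
    rwa [ENNReal.ofReal_coe_nnreal]
  have hA : ∀ n, MeasurableSet[𝓕 n] {ω | partialVar 𝓕 P f.seq n ω ≤ b ^ 2} := fun n =>
    measurable_partialVar n measurableSet_Iic
  refine ⟨b ^ 2, fun n => {ω | partialVar 𝓕 P f.seq n ω ≤ b ^ 2}, hA,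
    ENNReal.pow_lt_top ENNReal.ofReal_lt_top, ?_, ?_⟩
  · filter_upwards [ae_all_iff.2 (condIncr_transform (P := P) (f := f.seq) hA)] with ω hω
    rw [condVar_sq]
    refine le_trans (ENNReal.tsum_le_tsum fun n => ?_)
      (tsum_ite_le (fun n => condIncr 𝓕 P f.seq n ω) (b ^ 2))
    refine (hω n).le.trans ?_
    by_cases hωn : partialVar 𝓕 P f.seq n ω ≤ b ^ 2
    · rw [if_pos (by exact hωn)]
      exact Set.indicator_le_self _ _ _
    · rw [Set.indicator_of_notMem (s := {ω | partialVar 𝓕 P f.seq n ω ≤ b ^ 2}) hωn]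
      exact bot_le
  · refine lt_of_le_of_lt (weakNorm_mono ?_)
      (H {ω | b < condVar 𝓕 P f.seq ω} (measurable_condVar measurableSet_Ioi) hPb)
    filter_upwards [ae_all_iff.2 (condIncr_sub_trunc f hA)] with ω hω
    refine condVar_le_of_tsum_le ?_
    simp_rw [hω]
    by_cases hωb : b < condVar 𝓕 P f.seq ω
    · rw [Set.indicator_of_mem (by exact hωb), condVar_sq]
      exact ENNReal.tsum_le_tsum fun n => Set.indicator_le_self _ _ _
    · refine le_of_eq_of_le (ENNReal.tsum_eq_zero.2 fun n => ?_) bot_le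
      have hmem : ω ∈ {ω | partialVar 𝓕 P f.seq n ω ≤ b ^ 2} := by
        refine (partialVar_le_condVar_sq n ω).trans ?_
        gcongr
        exact not_lt.1 hωb
      exact Set.indicator_of_notMem (Set.notMem_compl_iff.2 hmem) _

/-- A square integrable martingale is close to a martingale that is constant from some index on. -/
lemma exists_trunc_range_quasiNorm_sub_lt (hconc : ConcaveOn ℝ (Set.Ici 0) Φ) (f : Hardy hΦ 𝓕 P)
    (hf : f.MemH2) {ε : ℝ≥0∞} (hε : 0 < ε) : ∃ (N : ℕ) (A : ℕ → Set Ω)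
      (hA : ∀ n, MeasurableSet[𝓕 n] (A n)), (∀ n, N ≤ n → A n = ∅) ∧
      quasiNorm (f - f.trunc A hA) < ε := by
  obtain ⟨η, hη, H⟩ := weakNorm_lt_of_lintegral_sq_lt (Ω := Ω) (P := P) hΦ hconc hε
  have hfin : ∑' n, ∫⁻ ω, condIncr 𝓕 P f.seq n ω ∂P ≠ ∞ := by
    rw [← lintegral_tsum fun n => (measurable_condIncr n).aemeasurable]
    simp_rw [← condVar_sq]
    exact hf.ne
  obtain ⟨N, hN⟩ := ((ENNReal.tendsto_sum_nat_add _ hfin).eventually_lt_const hη).exists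
  obtain ⟨A, hA1, hA0⟩ : ∃ A : ℕ → Set Ω, (∀ n, n < N → A n = Set.univ) ∧
      ∀ n, N ≤ n → A n = ∅ :=
    ⟨fun n => if n < N then Set.univ else ∅, fun n hn => if_pos hn,
      fun n hn => if_neg (not_lt.2 hn)⟩
  have hA : ∀ n, MeasurableSet[𝓕 n] (A n) := by
    intro n
    rcases lt_or_ge n N with hn | hn
    · rw [hA1 n hn]
      exact @MeasurableSet.univ _ (𝓕 n)
    · rw [hA0 n hn]
      exact @MeasurableSet.empty _ (𝓕 n)
  refine ⟨N, A, hA, hA0, ?_⟩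
  refine H _ measurable_condVar.aemeasurable (lt_of_eq_of_lt ?_ hN)
  simp_rw [condVar_sq]
  rw [lintegral_tsum fun n => (measurable_condIncr n).aemeasurable]
  have h1 : ∀ n, ∫⁻ ω, condIncr 𝓕 P (f - f.trunc A hA).seq n ω ∂P =
      ∫⁻ ω, (A n)ᶜ.indicator (condIncr 𝓕 P f.seq n) ω ∂P := fun n =>
    lintegral_congr_ae (condIncr_sub_trunc f hA n)
  have h2 : ∀ n, n < N → ∫⁻ ω, (A n)ᶜ.indicator (condIncr 𝓕 P f.seq n) ω ∂P = 0 := by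
    intro n hn
    rw [hA1 n hn]
    simp
  have h3 : ∀ n, ∫⁻ ω, (A (n + N))ᶜ.indicator (condIncr 𝓕 P f.seq (n + N)) ω ∂P =
      ∫⁻ ω, condIncr 𝓕 P f.seq (n + N) ω ∂P := by
    intro n
    rw [hA0 (n + N) (Nat.le_add_left _ _)]
    simp
  rw [tsum_congr h1, ← Summable.sum_add_tsum_nat_add' (k := N) ENNReal.summable, tsum_congr h3,
    Finset.sum_eq_zero fun n hn => h2 n (Finset.mem_range.1 hn), zero_add]

/-- A continuous linear functional is determined by its values on the martingales of square
integrable functions that are measurable at a finite time. -/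
lemma eq_zero_of_forall_ofMemLp (hconc : ConcaveOn ℝ (Set.Ici 0) Φ) (l : Hardy hΦ 𝓕 P →L[ℝ] ℝ)
    (hl : ∀ (N : ℕ) (h : Ω → ℝ) (hh : MemLp h 2 P), StronglyMeasurable[𝓕 N] h →
      l (ofMemLp hΦ hconc 𝓕 hh) = 0) : l = 0 := by
  ext f
  rw [zero_apply, ← abs_eq_zero]
  refine le_antisymm (le_of_forall_pos_lt_add fun δ hδ => ?_) (abs_nonneg _)
  obtain ⟨ε, hε, H⟩ := exists_quasiNorm_lt_imp l (half_pos hδ)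
  obtain ⟨c, A, hA, hc, hbound, h1⟩ := f.exists_trunc_quasiNorm_sub_lt hconc hε
  set f₁ := f.trunc A hA with hf₁
  have hf₁2 : f₁.MemH2 := by
    refine (lintegral_mono_ae hbound).trans_lt ?_
    simpa using hc
  obtain ⟨N, A', hA', hN, h2⟩ := f₁.exists_trunc_range_quasiNorm_sub_lt hconc hf₁2 hε
  set f₂ := f₁.trunc A' hA' with hf₂
  have hincr : ∀ n, MemLp (fun ω => f₁.seq (n + 1) ω - f₁.seq n ω) 2 P := by
    intro n
    refine memLp_two_of_lintegral_lt_top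
      ((f₁.measurable_seq _).sub (f₁.measurable_seq _)).aestronglyMeasurable ?_
    have h3 : ∑' n, ∫⁻ ω, ‖f₁.seq (n + 1) ω - f₁.seq n ω‖ₑ ^ 2 ∂P < ∞ := by
      rw [← lintegral_condVar_sq (𝓕 := 𝓕)]
      exact hf₁2
    exact (ENNReal.le_tsum n).trans_lt h3
  have hmem : MemLp (f₂.seq N) 2 P := by
    have e : f₂.seq N = fun ω => ∑ i ∈ Finset.range N,
        (A' i).indicator (fun ω => f₁.seq (i + 1) ω - f₁.seq i ω) ω := rfl
    rw [e]
    exact memLp_finsetSum _ fun i _ => (hincr i).indicator (𝓕.le i _ (hA' i))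
  have hconst : ∀ n, N ≤ n → f₂.seq n = f₂.seq N := by
    intro n hn
    induction n, hn using Nat.le_induction with
    | base => rfl
    | succ n hn ih =>
      rw [← ih]
      ext ω
      have := transform_succ_sub A' f₁.seq n ω
      rw [hN n hn, Set.indicator_empty] at this
      exact sub_eq_zero.1 this
  have hzero : l f₂ = 0 := by
    rw [← hl N (f₂.seq N) hmem (f₂.martingale_seq.stronglyMeasurable N)]
    refine apply_eq_of_ae_eq l fun n => ?_
    have h0 : P[f₂.seq N | 𝓕 0] =ᵐ[P] 0 :=
      (f₂.martingale_seq.condExp_ae_eq (Nat.zero_le N)).trans f₂.seq_zero_ae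
    have hn : P[f₂.seq N | 𝓕 n] =ᵐ[P] f₂.seq n := by
      rcases le_total n N with hnN | hnN
      · exact f₂.martingale_seq.condExp_ae_eq hnN
      · rw [← hconst n hnN]
        exact f₂.martingale_seq.condExp_ae_eq le_rfl
    filter_upwards [h0, hn] with ω h0 hn
    rw [ofMemLp_seq, h0, hn]
    simp
  have e : l f = l (f - f₁) + l (f₁ - f₂) := by
    rw [← map_add, sub_add_sub_cancel, map_sub, hzero, sub_zero]
  rw [e, zero_add]
  refine (abs_add_le _ _).trans_lt ?_
  linarith [H _ h1, H _ h2]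

end Hardy

/-! ### The functional represented by an element of the Campanato space -/

namespace Hardy

variable {Ω : Type*} [mΩ : MeasurableSpace Ω] {ℓ : ℝ} {Φ : ℝ → ℝ} {hΦ : MemG ℓ Φ}
  {𝓕 : Filtration ℕ mΩ} {P : Measure Ω} {g : Ω → ℝ}

lemma measurable_pairingTerm (f : Hardy hΦ 𝓕 P) (g : Ω → ℝ) (n : ℕ) :
    Measurable (pairingTerm 𝓕 P f.seq g n) := by
  have h1 : ∀ k, Measurable (P[g | 𝓕 k]) := fun k =>
    (stronglyMeasurable_condExp.mono (𝓕.le k)).measurable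
  exact ((f.measurable_seq _).sub (f.measurable_seq _)).mul ((h1 _).sub (h1 _))

lemma ae_summable_pairingTerm (f : Hardy hΦ 𝓕 P)
    (h : ∑' n, ∫⁻ ω, ‖pairingTerm 𝓕 P f.seq g n ω‖ₑ ∂P < ∞) :
    ∀ᵐ ω ∂P, Summable fun n => pairingTerm 𝓕 P f.seq g n ω := by
  rw [← lintegral_tsum fun n => (f.measurable_pairingTerm g n).enorm.aemeasurable] at h
  have hm : Measurable fun ω => ∑' n, ‖pairingTerm 𝓕 P f.seq g n ω‖ₑ :=
    Measurable.tsum fun n => (f.measurable_pairingTerm g n).enorm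
  filter_upwards [ae_lt_top hm h.ne] with ω hω
  exact (tsum_enorm_ne_top_iff_summable_norm.1 hω.ne).of_norm

lemma integrable_tsum_pairingTerm (f : Hardy hΦ 𝓕 P)
    (h : ∑' n, ∫⁻ ω, ‖pairingTerm 𝓕 P f.seq g n ω‖ₑ ∂P < ∞) :
    Integrable (fun ω => ∑' n, pairingTerm 𝓕 P f.seq g n ω) P := by
  refine ⟨?_, ?_⟩
  · refine aestronglyMeasurable_of_tendsto_ae atTop
      (f := fun N ω => ∑ n ∈ Finset.range N, pairingTerm 𝓕 P f.seq g n ω) (fun N => ?_) ?_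
    · exact (Finset.measurable_fun_sum _ fun n _ =>
        f.measurable_pairingTerm g n).aestronglyMeasurable
    · filter_upwards [f.ae_summable_pairingTerm h] with ω hω
      exact hω.hasSum.tendsto_sum_nat
  · refine lt_of_le_of_lt (lintegral_mono fun ω => enorm_tsum_le_tsum_enorm) ?_
    rwa [lintegral_tsum fun n => (f.measurable_pairingTerm g n).enorm.aemeasurable]

lemma enorm_integral_tsum_pairingTerm_le (f : Hardy hΦ 𝓕 P) :
    ‖∫ ω, ∑' n, pairingTerm 𝓕 P f.seq g n ω ∂P‖ₑ ≤
      ∑' n, ∫⁻ ω, ‖pairingTerm 𝓕 P f.seq g n ω‖ₑ ∂P := by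
  rw [← lintegral_tsum fun n => (f.measurable_pairingTerm g n).enorm.aemeasurable]
  exact (enorm_integral_le_lintegral_enorm _).trans
    (lintegral_mono fun ω => enorm_tsum_le_tsum_enorm)

variable [IsProbabilityMeasure P]

lemma tsum_lintegral_pairingTerm_le (h𝓕 : ⨆ n, 𝓕 n = mΩ) (hconc : ConcaveOn ℝ (Set.Ici 0) Φ)
    {D : ℝ} (hD1 : 1 ≤ D) (hD : ∀ s, 0 ≤ s → inverse Φ (2 * s) ≤ D * inverse Φ s)
    (hg : MemLp g 2 P) (f : Hardy hΦ 𝓕 P) {ρ : ℝ} (hρ : quasiNorm f < ENNReal.ofReal ρ) :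
    ∑' n, ∫⁻ ω, ‖pairingTerm 𝓕 P f.seq g n ω‖ₑ ∂P ≤
      ENNReal.ofReal ρ * (ENNReal.ofReal (2 * D ^ 2) * campanatoNorm 𝓕 P (phi Φ) g) := by
  have hρ0 : 0 < ρ := ENNReal.ofReal_pos.1 (bot_le.trans_lt hρ)
  have h1 := tsum_lintegral_mul_le_tsum_weight h𝓕 hΦ hconc hD f.measurable_seq hg hρ
  have h2 := tsum_weight_mul_oscillation_le (𝓕 := 𝓕) (P := P) (g := g) hΦ hconc hD1 hD
  simp only [pairingTerm, enorm_mul]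
  refine h1.trans ?_
  calc _ ≤ ENNReal.ofReal (ρ * D) *
        (ENNReal.ofReal (2 * D) * campanatoNorm 𝓕 P (phi Φ) g) := by gcongr
    _ = _ := by
      rw [← mul_assoc, ← mul_assoc, ← ENNReal.ofReal_mul (by positivity),
        ← ENNReal.ofReal_mul hρ0.le]
      congr 2
      ring

lemma tsum_lintegral_pairingTerm_lt_top (h𝓕 : ⨆ n, 𝓕 n = mΩ)
    (hconc : ConcaveOn ℝ (Set.Ici 0) Φ) (g : Campanato 𝓕 P (phi Φ)) (f : Hardy hΦ 𝓕 P) :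
    ∑' n, ∫⁻ ω, ‖pairingTerm 𝓕 P f.seq g n ω‖ₑ ∂P < ∞ := by
  obtain ⟨D, hD1, hD⟩ := hΦ.exists_doubling hconc
  obtain ⟨r, hr, -⟩ := ENNReal.lt_iff_exists_nnreal_btwn.1 f.quasiNorm_lt_top
  rw [← ENNReal.ofReal_coe_nnreal] at hr
  refine (tsum_lintegral_pairingTerm_le h𝓕 hconc hD1 hD (Lp.memLp _) f hr).trans_lt ?_
  exact ENNReal.mul_lt_top ENNReal.ofReal_lt_top
    (ENNReal.mul_lt_top ENNReal.ofReal_lt_top g.2.2)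

/-- The linear functional `f ↦ E ∑ df_n dg_n` on the whole Hardy space; the integrand converges
absolutely for all its elements, not only for the square integrable ones. -/
def pairing (h𝓕 : ⨆ n, 𝓕 n = mΩ) (hconc : ConcaveOn ℝ (Set.Ici 0) Φ)
    (g : Campanato 𝓕 P (phi Φ)) : Hardy hΦ 𝓕 P →ₗ[ℝ] ℝ where
  toFun f := ∫ ω, ∑' n, pairingTerm 𝓕 P f.seq g n ω ∂P
  map_add' f f' := by
    have h := fun f : Hardy hΦ 𝓕 P => tsum_lintegral_pairingTerm_lt_top h𝓕 hconc g f
    rw [← integral_add (f.integrable_tsum_pairingTerm (h f))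
      (f'.integrable_tsum_pairingTerm (h f'))]
    refine integral_congr_ae ?_
    filter_upwards [f.ae_summable_pairingTerm (h f), f'.ae_summable_pairingTerm (h f')]
      with ω h1 h2
    rw [← h1.tsum_add h2]
    refine tsum_congr fun n => ?_
    simp only [pairingTerm, show (f + f').seq = f.seq + f'.seq from rfl, Pi.add_apply]
    ring
  map_smul' a f := by
    rw [RingHom.id_apply, smul_eq_mul, ← integral_const_mul]
    refine integral_congr_ae (Eventually.of_forall fun ω => ?_)
    dsimp only
    rw [← tsum_mul_left]
    refine tsum_congr fun n => ?_
    simp only [pairingTerm, show (a • f).seq = a • f.seq from rfl, Pi.smul_apply, smul_eq_mul]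
    ring

lemma enorm_pairing_le (h𝓕 : ⨆ n, 𝓕 n = mΩ) (hconc : ConcaveOn ℝ (Set.Ici 0) Φ)
    {D : ℝ} (hD1 : 1 ≤ D) (hD : ∀ s, 0 ≤ s → inverse Φ (2 * s) ≤ D * inverse Φ s)
    (g : Campanato 𝓕 P (phi Φ)) (f : Hardy hΦ 𝓕 P) {ρ : ℝ}
    (hρ : quasiNorm f < ENNReal.ofReal ρ) :
    ‖pairing h𝓕 hconc g f‖ₑ ≤
      ENNReal.ofReal ρ * (ENNReal.ofReal (2 * D ^ 2) * campanatoNorm 𝓕 P (phi Φ) g) :=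
  f.enorm_integral_tsum_pairingTerm_le.trans
    (tsum_lintegral_pairingTerm_le h𝓕 hconc hD1 hD (Lp.memLp _) f hρ)

lemma continuous_pairing (h𝓕 : ⨆ n, 𝓕 n = mΩ) (hconc : ConcaveOn ℝ (Set.Ici 0) Φ)
    (g : Campanato 𝓕 P (phi Φ)) : Continuous (pairing (hΦ := hΦ) h𝓕 hconc g) := by
  obtain ⟨D, hD1, hD⟩ := hΦ.exists_doubling hconc
  exact continuous_of_bound _ (ENNReal.mul_lt_top ENNReal.ofReal_lt_top g.2.2)
    fun f ρ hρ => enorm_pairing_le h𝓕 hconc hD1 hD g f hρ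

/-- The duality map from the Campanato space to the dual of the Hardy space. -/
def dualMap (hΦ : MemG ℓ Φ) (h𝓕 : ⨆ n, 𝓕 n = mΩ) (hconc : ConcaveOn ℝ (Set.Ici 0) Φ) :
    Campanato 𝓕 P (phi Φ) →ₗ[ℝ] (Hardy hΦ 𝓕 P →L[ℝ] ℝ) where
  toFun g := ⟨pairing h𝓕 hconc g, continuous_pairing h𝓕 hconc g⟩
  map_add' g g' := by
    ext f
    have h := fun g : Campanato 𝓕 P (phi Φ) => tsum_lintegral_pairingTerm_lt_top h𝓕 hconc g f
    show ∫ ω, ∑' n, pairingTerm 𝓕 P f.seq (g + g' : Campanato 𝓕 P (phi Φ)) n ω ∂P =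
      (∫ ω, ∑' n, pairingTerm 𝓕 P f.seq g n ω ∂P) + ∫ ω, ∑' n, pairingTerm 𝓕 P f.seq g' n ω ∂P
    rw [← integral_add (f.integrable_tsum_pairingTerm (h g))
      (f.integrable_tsum_pairingTerm (h g'))]
    refine integral_congr_ae ?_
    have hE : ∀ n, P[((g + g' : Campanato 𝓕 P (phi Φ)) : Lp ℝ 2 P) | 𝓕 n] =ᵐ[P]
        P[(g : Lp ℝ 2 P) | 𝓕 n] + P[(g' : Lp ℝ 2 P) | 𝓕 n] := fun n =>
      (condExp_congr_ae (Lp.coeFn_add (g : Lp ℝ 2 P) g')).trans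
        (condExp_add ((Lp.memLp _).integrable one_le_two)
          ((Lp.memLp _).integrable one_le_two) _)
    filter_upwards [f.ae_summable_pairingTerm (h g), f.ae_summable_pairingTerm (h g'),
      ae_all_iff.2 hE] with ω h1 h2 h3
    rw [← h1.tsum_add h2]
    refine tsum_congr fun n => ?_
    simp only [pairingTerm, h3, Pi.add_apply]
    ring
  map_smul' a g := by
    ext f
    show ∫ ω, ∑' n, pairingTerm 𝓕 P f.seq (a • g : Campanato 𝓕 P (phi Φ)) n ω ∂P =
      a * ∫ ω, ∑' n, pairingTerm 𝓕 P f.seq g n ω ∂P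
    rw [← integral_const_mul]
    refine integral_congr_ae ?_
    have hE : ∀ n, P[((a • g : Campanato 𝓕 P (phi Φ)) : Lp ℝ 2 P) | 𝓕 n] =ᵐ[P]
        a • P[(g : Lp ℝ 2 P) | 𝓕 n] := fun n =>
      (condExp_congr_ae (Lp.coeFn_smul a (g : Lp ℝ 2 P))).trans (condExp_smul a _ _)
    filter_upwards [ae_all_iff.2 hE] with ω h3
    rw [← tsum_mul_left]
    refine tsum_congr fun n => ?_
    simp only [pairingTerm, h3, Pi.smul_apply, smul_eq_mul]
    ring

lemma dualMap_apply (h𝓕 : ⨆ n, 𝓕 n = mΩ) (hconc : ConcaveOn ℝ (Set.Ici 0) Φ)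
    (g : Campanato 𝓕 P (phi Φ)) (f : Hardy hΦ 𝓕 P) :
    dualMap hΦ h𝓕 hconc g f = ∫ ω, ∑' n, pairingTerm 𝓕 P f.seq g n ω ∂P := rfl

lemma integral_condExp_sub_mul (n : ℕ) {h : Ω → ℝ} (hh : MemLp h 2 P) (hg : MemLp g 2 P) :
    ∫ ω, ((P[h | 𝓕 (n + 1)]) ω - (P[h | 𝓕 n]) ω) *
        ((P[g | 𝓕 (n + 1)]) ω - (P[g | 𝓕 n]) ω) ∂P =
      ∫ ω, (P[h | 𝓕 (n + 1)]) ω * (P[g | 𝓕 (n + 1)]) ω ∂P -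
        ∫ ω, (P[h | 𝓕 n]) ω * (P[g | 𝓕 n]) ω ∂P := by
  have hH : ∀ k, MemLp (P[h | 𝓕 k]) 2 P := fun k => hh.condExp one_le_two
  have hG : ∀ k, MemLp (P[g | 𝓕 k]) 2 P := fun k => hg.condExp one_le_two
  have hi : ∀ j k, Integrable (fun ω => (P[h | 𝓕 j]) ω * (P[g | 𝓕 k]) ω) P := fun j k =>
    (hH j).integrable_mul (hG k)
  have hth : P[P[h | 𝓕 (n + 1)] | 𝓕 n] =ᵐ[P] P[h | 𝓕 n] :=
    condExp_condExp_of_le (𝓕.mono n.le_succ) (𝓕.le _)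
  have htg : P[P[g | 𝓕 (n + 1)] | 𝓕 n] =ᵐ[P] P[g | 𝓕 n] :=
    condExp_condExp_of_le (𝓕.mono n.le_succ) (𝓕.le _)
  have h1 : ∫ ω, (P[h | 𝓕 (n + 1)]) ω * (P[g | 𝓕 n]) ω ∂P =
      ∫ ω, (P[h | 𝓕 n]) ω * (P[g | 𝓕 n]) ω ∂P := by
    rw [integral_mul_condExp (𝓕.le n) (hH (n + 1)) hg]
    refine integral_congr_ae ?_
    filter_upwards [hth] with ω hω
    rw [hω]
  have h2 : ∫ ω, (P[h | 𝓕 n]) ω * (P[g | 𝓕 (n + 1)]) ω ∂P =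
      ∫ ω, (P[h | 𝓕 n]) ω * (P[g | 𝓕 n]) ω ∂P := by
    have := integral_mul_condExp (𝓕.le n) (hG (n + 1)) hh
    simp_rw [mul_comm ((P[h | 𝓕 n]) _)]
    rw [this]
    refine integral_congr_ae ?_
    filter_upwards [htg] with ω hω
    rw [hω]
  have e : ∀ ω, ((P[h | 𝓕 (n + 1)]) ω - (P[h | 𝓕 n]) ω) *
        ((P[g | 𝓕 (n + 1)]) ω - (P[g | 𝓕 n]) ω) =
      ((P[h | 𝓕 (n + 1)]) ω * (P[g | 𝓕 (n + 1)]) ω - (P[h | 𝓕 (n + 1)]) ω * (P[g | 𝓕 n]) ω) -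
      ((P[h | 𝓕 n]) ω * (P[g | 𝓕 (n + 1)]) ω - (P[h | 𝓕 n]) ω * (P[g | 𝓕 n]) ω) :=
    fun ω => by ring
  have hi2 : ∀ i j k, Integrable
      (fun ω => (P[h | 𝓕 i]) ω * (P[g | 𝓕 j]) ω - (P[h | 𝓕 i]) ω * (P[g | 𝓕 k]) ω) P :=
    fun i j k => (hi i j).sub (hi i k)
  simp_rw [e]
  rw [integral_sub (hi2 _ _ _) (hi2 _ _ _), integral_sub (hi _ _) (hi _ _),
    integral_sub (hi _ _) (hi _ _), h1, h2]
  ring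

/-- On square integrable functions that are measurable at a finite time the functional of `g` is
the inner product with `g`. -/
lemma dualMap_ofMemLp (h𝓕 : ⨆ n, 𝓕 n = mΩ) (hconc : ConcaveOn ℝ (Set.Ici 0) Φ)
    (g : Campanato 𝓕 P (phi Φ)) {N : ℕ} {h : Ω → ℝ} (hh : MemLp h 2 P)
    (hN : StronglyMeasurable[𝓕 N] h) :
    dualMap hΦ h𝓕 hconc g (ofMemLp hΦ hconc 𝓕 hh) = ∫ ω, (g : Lp ℝ 2 P) ω * h ω ∂P := by
  have hg : MemLp (g : Lp ℝ 2 P) 2 P := Lp.memLp _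
  set F := ofMemLp hΦ hconc 𝓕 hh with hF
  have hterm : ∀ n ω, pairingTerm 𝓕 P F.seq g n ω =
      ((P[h | 𝓕 (n + 1)]) ω - (P[h | 𝓕 n]) ω) *
        ((P[(g : Lp ℝ 2 P) | 𝓕 (n + 1)]) ω - (P[(g : Lp ℝ 2 P) | 𝓕 n]) ω) := by
    intro n ω
    rw [pairingTerm, hF, ofMemLp_seq, ofMemLp_seq, sub_sub_sub_cancel_right]
  have hE : ∀ n, N ≤ n → P[h | 𝓕 n] = h := fun n hn =>
    condExp_of_stronglyMeasurable (𝓕.le n) (hN.mono (𝓕.mono hn)) (hh.integrable one_le_two)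
  rw [dualMap_apply, integral_tsum
    (fun n => (F.measurable_pairingTerm _ n).aestronglyMeasurable)
    (tsum_lintegral_pairingTerm_lt_top h𝓕 hconc g F).ne]
  rw [tsum_eq_sum (s := Finset.range N) fun n hn => by
    have hn' : N ≤ n := by simpa using hn
    simp_rw [hterm, hE n hn', hE (n + 1) (hn'.trans n.le_succ)]
    simp]
  simp_rw [hterm, integral_condExp_sub_mul _ hh hg]
  rw [Finset.sum_range_sub (fun n => ∫ ω, (P[h | 𝓕 n]) ω * (P[(g : Lp ℝ 2 P) | 𝓕 n]) ω ∂P)]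
  have h0 : ∫ ω, (P[h | 𝓕 0]) ω * (P[(g : Lp ℝ 2 P) | 𝓕 0]) ω ∂P = 0 := by
    rw [integral_eq_zero_of_ae]
    filter_upwards [g.2.1] with ω hω
    rw [hω]
    simp
  have h1 := integral_mul_condExp (𝓕.le N) hg hh
  rw [hE N le_rfl] at h1
  rw [h0, sub_zero, hE N le_rfl, h1]
  simp_rw [mul_comm]

end Hardy

/-! ### Lower bound for the norm of a functional -/

section LowerBound

variable {Ω : Type*} [mΩ : MeasurableSpace Ω] {P : Measure Ω} [IsProbabilityMeasure P]
  {𝓕 : Filtration ℕ mΩ} {ℓ : ℝ} {Φ : ℝ → ℝ} {hΦ : MemG ℓ Φ}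
  {hconc : ConcaveOn ℝ (Set.Ici 0) Φ} {g : Ω → ℝ}

lemma sum_filter_half_pow_le (m N : ℕ) :
    ∑ k ∈ Finset.range N with m < k, (1 / 2 : ℝ) ^ k ≤ (1 / 2) ^ m := by
  have h : ∀ i, ∑ k ∈ Finset.range (m + 1 + i) with m < k, (1 / 2 : ℝ) ^ k =
      (1 / 2) ^ m - (1 / 2) ^ (m + i) := by
    intro i
    induction i with
    | zero =>
      rw [Finset.filter_false_of_mem fun k hk => by
        have := Finset.mem_range.1 hk
        omega]
      simp
    | succ i ih =>
      rw [Finset.sum_filter] at ih ⊢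
      rw [← add_assoc, Finset.sum_range_succ, ih, if_pos (by omega),
        show m + 1 + i = m + i + 1 by omega, ← add_assoc, pow_succ]
      ring
  calc _ ≤ ∑ k ∈ Finset.range (m + 1 + N) with m < k, (1 / 2 : ℝ) ^ k := by
        refine Finset.sum_le_sum_of_subset_of_nonneg ?_ fun _ _ _ => by positivity
        exact Finset.filter_subset_filter _ (Finset.range_mono (by omega))
    _ ≤ _ := by
        rw [h]
        have : (0 : ℝ) ≤ (1 / 2) ^ (m + N) := by positivity
        linarith

lemma oscillation_lt_top (h𝓕 : ⨆ n, 𝓕 n = mΩ) (hg : MemLp g 2 P) (x : ℝ) :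
    oscillation 𝓕 P g x < ∞ := by
  refine lt_of_le_of_lt (iSup₂_le fun ν hν => ?_)
    (ENNReal.add_lt_top.2 ⟨hg.2, hg.2⟩)
  have h1 := stopped_ae_eq_condExp h𝓕 hν.1 hg
  refine (eLpNorm_sub_le hg.1 ((memLp_congr_ae h1).2 (hg.condExp one_le_two)).1
    one_le_two).trans ?_
  gcongr
  rw [eLpNorm_congr_ae h1]
  exact eLpNorm_condExp_le_eLpNorm g one_le_two

lemma exists_stopping_half_oscillation (h𝓕 : ⨆ n, 𝓕 n = mΩ) (hg : MemLp g 2 P) (x : ℝ) :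
    ∃ ν : Ω → WithTop ℕ, IsStoppingTime 𝓕 ν ∧ P {ω | ν ω < ⊤} ≤ ENNReal.ofReal x ∧
      oscillation 𝓕 P g x ≤ 2 * eLpNorm (fun ω => g ω - stopped 𝓕 P g ν ω) 2 P := by
  rcases eq_or_ne (oscillation 𝓕 P g x) 0 with h0 | h0
  · obtain ⟨ν, hν, -, hfin⟩ := exists_isStoppingTime_of_monotone (𝓕 := 𝓕) (D := fun _ => ∅)
      (fun n => @MeasurableSet.empty _ (𝓕 n)) monotone_const
    refine ⟨ν, hν, ?_, by rw [h0]; exact bot_le⟩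
    rw [hfin]
    simp
  · have h := ENNReal.half_lt_self h0 (oscillation_lt_top h𝓕 hg x).ne
    conv_rhs at h => rw [oscillation]
    simp only [lt_iSup_iff, exists_prop] at h
    obtain ⟨ν, hν, hlt⟩ := h
    refine ⟨ν, hν.1, hν.2, ?_⟩
    rw [mul_comm, ← ENNReal.div_le_iff_le_mul (by simp) (by simp)]
    exact hlt.le

/-- A combination of differences `g - g^{ν_k}` has no variation where all `ν_k` are infinite. -/
lemma condVar_sum_sub_stopped_eq_zero (h𝓕 : ⨆ n, 𝓕 n = mΩ) (hg : MemLp g 2 P)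
    {ν : ℕ → Ω → WithTop ℕ} (hν : ∀ k, IsStoppingTime 𝓕 (ν k)) (β : ℕ → ℝ) (s : Finset ℕ)
    {h : Ω → ℝ} (hh : MemLp h 2 P)
    (hdef : h = ∑ k ∈ s, β k • fun ω => g ω - stopped 𝓕 P g (ν k) ω) :
    ∀ᵐ ω ∂P, (∀ k ∈ s, ν k ω = ⊤) →
      condVar 𝓕 P (Hardy.ofMemLp hΦ hconc 𝓕 hh).seq ω = 0 := by
  set b : ℕ → Ω → ℝ := fun k ω => g ω - stopped 𝓕 P g (ν k) ω with hb
  have hbi : ∀ k, Integrable (b k) P := fun k =>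
    (memLp_sub_stopped h𝓕 (hν k) hg).integrable one_le_two
  have hE : ∀ m, ∀ᵐ ω ∂P, (∀ k ∈ s, WithTop.some m ≤ ν k ω) → (P[h | 𝓕 m]) ω = 0 := by
    intro m
    have h1 : P[h | 𝓕 m] =ᵐ[P] ∑ k ∈ s, P[β k • b k | 𝓕 m] := by
      rw [hdef]
      exact condExp_finsetSum (fun k _ => (hbi k).smul (β k)) _
    have h2 : ∀ k, P[β k • b k | 𝓕 m] =ᵐ[P] β k • P[b k | 𝓕 m] := fun k => condExp_smul _ _ _
    filter_upwards [h1, ae_all_iff.2 h2,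
      ae_all_iff.2 fun k => condExp_sub_stopped_eq_zero h𝓕 (hν k) hg m] with ω h1 h2 h3 hω
    rw [h1, Finset.sum_apply]
    refine Finset.sum_eq_zero fun k hk => ?_
    rw [h2, Pi.smul_apply, h3 k (hω k hk), smul_zero]
  have hA : ∀ n, MeasurableSet[𝓕 n] {ω | ∀ k ∈ s, WithTop.some n < ν k ω} := by
    intro n
    have : {ω | ∀ k ∈ s, WithTop.some n < ν k ω} = ⋂ k ∈ s, {ω | ν k ω ≤ WithTop.some n}ᶜ := by
      ext ω
      simp
    rw [this]
    exact Finset.measurableSet_biInter s fun k _ => ((hν k).measurableSet_le n).compl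
  have hinc : ∀ n, ∀ᵐ ω ∂P, ω ∈ {ω | ∀ k ∈ s, WithTop.some n < ν k ω} →
      (Hardy.ofMemLp hΦ hconc 𝓕 hh).seq (n + 1) ω = (Hardy.ofMemLp hΦ hconc 𝓕 hh).seq n ω := by
    intro n
    filter_upwards [hE n, hE (n + 1)] with ω h1 h2 hω
    rw [Hardy.ofMemLp_seq, Hardy.ofMemLp_seq, h1 fun k hk => (hω k hk).le,
      h2 fun k hk => ?_]
    have h3 := hω k hk
    rcases eq_or_ne (ν k ω) ⊤ with h | h
    · rw [h]
      exact le_top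
    · obtain ⟨m, hm⟩ := WithTop.ne_top_iff_exists.1 h
      rw [← hm, WithTop.coe_lt_coe] at h3
      rw [← hm, WithTop.coe_le_coe]
      exact h3
  filter_upwards [condVar_eq_zero hA hinc] with ω h1 hω
  refine h1 fun n k hk => ?_
  rw [hω k hk]
  exact WithTop.coe_lt_top n

lemma eLpNorm_sum_le_sum_weight {Ω : Type*} [MeasurableSpace Ω] {P : Measure Ω} {w β : ℕ → ℝ}
    {b : ℕ → Ω → ℝ} (hb : ∀ k, MemLp (b k) 2 P)
    (hβ : ∀ k, eLpNorm (β k • b k) 2 P ≤ ENNReal.ofReal (w k)) (hw : ∀ k, 0 ≤ w k)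
    (s : Finset ℕ) :
    eLpNorm (∑ k ∈ s, β k • b k) 2 P ≤ ENNReal.ofReal (∑ k ∈ s, w k) := by
  refine (eLpNorm_sum_le (fun k _ => ((hb k).const_smul (β k)).1) one_le_two).trans ?_
  rw [ENNReal.ofReal_sum_of_nonneg fun k _ => hw k]
  exact Finset.sum_le_sum fun k _ => hβ k

/-- The test function `∑ w_k (g - g^{ν_k}) / ‖g - g^{ν_k}‖_2` has bounded quasi-norm in the Hardy
space. At the level `Φ⁻¹(2 ^ j)`, the variation of the terms with `k > j + 1` lives on a set of
probability at most `2 ^ (-j - 1)`, and Chebyshev's inequality applies to the others. -/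
lemma quasiNorm_sum_sub_stopped_le (h𝓕 : ⨆ n, 𝓕 n = mΩ) {D : ℝ} (hD1 : 1 ≤ D)
    (hD : ∀ s, 0 ≤ s → inverse Φ (2 * s) ≤ D * inverse Φ s) (hg : MemLp g 2 P)
    {ν : ℕ → Ω → WithTop ℕ} (hν : ∀ k, IsStoppingTime 𝓕 (ν k))
    (hνP : ∀ k, P {ω | ν k ω < ⊤} ≤ ENNReal.ofReal ((1 / 2) ^ k)) (β : ℕ → ℝ)
    (hβ : ∀ k, eLpNorm (β k • fun ω => g ω - stopped 𝓕 P g (ν k) ω) 2 P ≤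
      ENNReal.ofReal (weight Φ k)) (N : ℕ)
    (hh : MemLp (∑ k ∈ Finset.range N, β k • fun ω => g ω - stopped 𝓕 P g (ν k) ω) 2 P) :
    (Hardy.ofMemLp hΦ hconc 𝓕 hh).quasiNorm ≤ ENNReal.ofReal (16 * D ^ 2) := by
  set b : ℕ → Ω → ℝ := fun k ω => g ω - stopped 𝓕 P g (ν k) ω with hb
  have hbm : ∀ k, MemLp (b k) 2 P := fun k => memLp_sub_stopped h𝓕 (hν k) hg
  have hsum : ∀ s : Finset ℕ, MemLp (∑ k ∈ s, β k • b k) 2 P := fun s => by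
    have := memLp_finsetSum s (f := fun k => β k • b k) fun k _ => (hbm k).const_smul (β k)
    convert this using 1
    ext ω
    simp
  have hw := fun k => (weight_pos hΦ hconc k).le
  have key : ∀ j : ℕ, P {ω | ENNReal.ofReal (16 * D * level Φ j) <
      condVar 𝓕 P (Hardy.ofMemLp hΦ hconc 𝓕 hh).seq ω} ≤ (1 / 2) ^ j := by
    intro j
    set s₁ := (Finset.range N).filter fun k => ¬ j + 1 < k with hs₁
    set s₂ := (Finset.range N).filter fun k => j + 1 < k with hs₂
    set F₁ := Hardy.ofMemLp hΦ hconc 𝓕 (hsum s₁) with hF₁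
    set F₂ := Hardy.ofMemLp hΦ hconc 𝓕 (hsum s₂) with hF₂
    set F := Hardy.ofMemLp hΦ hconc 𝓕 hh with hF
    have hlev := level_pos hΦ hconc j
    -- the variation of a sum is at most twice the sum of the variations, so the terms of `s₁` have
    -- to stay below half of the level `16 * D * level Φ j`
    have hsplit : condVar 𝓕 P F.seq =ᵐ[P] condVar 𝓕 P (F₁.seq + F₂.seq) := by
      refine condVar_congr_of_ae_eq fun n => ?_
      have hE : ∀ m, P[∑ k ∈ Finset.range N, β k • b k | 𝓕 m] =ᵐ[P]
          P[∑ k ∈ s₁, β k • b k | 𝓕 m] + P[∑ k ∈ s₂, β k • b k | 𝓕 m] := by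
        intro m
        have e : ∑ k ∈ Finset.range N, β k • b k =
            ∑ k ∈ s₁, β k • b k + ∑ k ∈ s₂, β k • b k := by
          rw [add_comm]
          exact (Finset.sum_filter_add_sum_filter_not _ _ _).symm
        rw [e]
        exact condExp_add ((hsum s₁).integrable one_le_two) ((hsum s₂).integrable one_le_two) _
      filter_upwards [hE n, hE 0] with ω h1 h2
      rw [hF, Hardy.ofMemLp_seq, h1, h2, Pi.add_apply, Pi.add_apply, Pi.add_apply, Pi.add_apply,
        hF₁, hF₂, Hardy.ofMemLp_seq, Hardy.ofMemLp_seq]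
      ring
    have hle := condVar_add_le (P := P) (𝓕 := 𝓕) (f := F₁.seq) (g := F₂.seq) F₁.martingale_seq
    have hzero := condVar_sum_sub_stopped_eq_zero (hΦ := hΦ) (hconc := hconc) h𝓕 hg hν β s₂
      (hsum s₂) rfl
    have hsub : {ω | ENNReal.ofReal (16 * D * level Φ j) < condVar 𝓕 P F.seq ω} ≤ᵐ[P]
        ((⋃ k ∈ s₂, {ω | ν k ω < ⊤}) ∪
          {ω | ENNReal.ofReal (8 * D * level Φ j) < condVar 𝓕 P F₁.seq ω} : Set Ω) := by
      filter_upwards [hsplit, hle, hzero] with ω h1 h2 h3 hω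
      by_contra hcon
      replace hcon : ω ∉ ((⋃ k ∈ s₂, {ω | ν k ω < ⊤}) ∪
          {ω | ENNReal.ofReal (8 * D * level Φ j) < condVar 𝓕 P F₁.seq ω} : Set Ω) := hcon
      simp only [Set.mem_union, Set.mem_iUnion, not_or, not_exists, Set.mem_ofPred_eq,
        not_lt, top_le_iff] at hcon
      have h4 := h3 hcon.1
      have h5 : condVar 𝓕 P F.seq ω ≤ ENNReal.ofReal (16 * D * level Φ j) := by
        rw [h1]
        refine h2.trans ?_
        rw [h4, add_zero]
        calc ((2 : ℕ) : ℝ≥0∞) * condVar 𝓕 P F₁.seq ω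
            ≤ ENNReal.ofReal 2 * ENNReal.ofReal (8 * D * level Φ j) := by
              rw [ENNReal.ofReal_ofNat, Nat.cast_ofNat]
              gcongr
              exact hcon.2
          _ = _ := by
              rw [← ENNReal.ofReal_mul (by norm_num)]
              congr 1
              ring
      exact absurd hω (not_lt.2 h5)
    have hP2 : P (⋃ k ∈ s₂, {ω | ν k ω < ⊤}) ≤ ENNReal.ofReal ((1 / 2) ^ (j + 1)) := by
      refine (measure_biUnion_finset_le _ _).trans ?_
      refine (Finset.sum_le_sum fun k _ => hνP k).trans ?_
      rw [← ENNReal.ofReal_sum_of_nonneg fun k _ => by positivity]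
      exact ENNReal.ofReal_le_ofReal (sum_filter_half_pow_le _ _)
    have hnorm : eLpNorm (∑ k ∈ s₁, β k • b k) 2 P ≤
        ENNReal.ofReal (8 * D * level Φ j * √((1 / 2) ^ (j + 1))) := by
      refine (eLpNorm_sum_le_sum_weight hbm hβ hw s₁).trans (ENNReal.ofReal_le_ofReal ?_)
      have h1 : ∑ k ∈ s₁, weight Φ k ≤ ∑ k ∈ Finset.range (j + 1 + 1), weight Φ k := by
        refine Finset.sum_le_sum_of_subset_of_nonneg (fun k hk => ?_) fun k _ _ => hw k
        have := (Finset.mem_filter.1 hk).2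
        exact Finset.mem_range.2 (by omega)
      refine h1.trans ((sum_weight_le hΦ hconc (j + 1)).trans ?_)
      rw [weight, ← mul_assoc]
      refine mul_le_mul_of_nonneg_right ?_ (Real.sqrt_nonneg _)
      have := level_succ_le hD j
      nlinarith [mul_pos (by linarith : 0 < D) hlev]
    have hP1 : P {ω | ENNReal.ofReal (8 * D * level Φ j) < condVar 𝓕 P F₁.seq ω} ≤
        ENNReal.ofReal ((1 / 2) ^ (j + 1)) := by
      have h1 : ∫⁻ ω, condVar 𝓕 P F₁.seq ω ^ 2 ∂P ≤
          ENNReal.ofReal (8 * D * level Φ j * √((1 / 2) ^ (j + 1))) ^ 2 := by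
        refine (Hardy.lintegral_condVar_sq_condExp_le (hsum s₁)).trans ?_
        rw [lintegral_enorm_sq_eq_eLpNorm]
        gcongr
      have h2 := measure_lt_le_of_lintegral_sq_le measurable_condVar.aemeasurable
        (by positivity) (t := 8 * D * level Φ j) (by positivity) h1
      rwa [mul_div_cancel_left₀ _ (by positivity), Real.sq_sqrt (by positivity)] at h2
    calc _ ≤ P ((⋃ k ∈ s₂, {ω | ν k ω < ⊤}) ∪
          {ω | ENNReal.ofReal (8 * D * level Φ j) < condVar 𝓕 P F₁.seq ω}) := measure_mono_ae hsub
      _ ≤ ENNReal.ofReal ((1 / 2) ^ (j + 1)) + ENNReal.ofReal ((1 / 2) ^ (j + 1)) :=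
          (measure_union_le _ _).trans (add_le_add hP2 hP1)
      _ = (1 / 2) ^ j := by
          rw [← ENNReal.ofReal_add (by positivity) (by positivity), pow_succ,
            show (1 / 2 : ℝ) ^ j * (1 / 2) + (1 / 2) ^ j * (1 / 2) = (1 / 2) ^ j by ring,
            ENNReal.ofReal_pow (by norm_num), ENNReal.ofReal_div_of_pos (by norm_num)]
          norm_num
  refine (weakNorm_le_of_measure_lt_level_le hΦ hconc hD1 hD (by positivity) key).trans_eq ?_
  congr 1
  ring

/-- If a functional is given on square integrable functions by the inner product with `g`, then
the Campanato norm of `g` is bounded by the norm of the functional. -/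
lemma campanatoNorm_le_dualNorm (h𝓕 : ⨆ n, 𝓕 n = mΩ) {D : ℝ} (hD1 : 1 ≤ D)
    (hD : ∀ s, 0 ≤ s → inverse Φ (2 * s) ≤ D * inverse Φ s) (hg : MemLp g 2 P)
    (l : Hardy hΦ 𝓕 P →L[ℝ] ℝ) (hl : ∀ (h : Ω → ℝ) (hh : MemLp h 2 P),
      l (Hardy.ofMemLp hΦ hconc 𝓕 hh) = ∫ ω, g ω * h ω ∂P) :
    campanatoNorm 𝓕 P (phi Φ) g ≤
      ENNReal.ofReal ((D + 2) * (34 * D ^ 2)) * Hardy.dualNorm l := by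
  choose ν hν hνP hνosc using fun k : ℕ =>
    exists_stopping_half_oscillation (𝓕 := 𝓕) h𝓕 hg ((1 / 2) ^ k)
  set b : ℕ → Ω → ℝ := fun k ω => g ω - stopped 𝓕 P g (ν k) ω with hb
  have hbm : ∀ k, MemLp (b k) 2 P := fun k => memLp_sub_stopped h𝓕 (hν k) hg
  set nb : ℕ → ℝ := fun k => (eLpNorm (b k) 2 P).toReal with hnb
  have hnb0 : ∀ k, 0 ≤ nb k := fun k => ENNReal.toReal_nonneg
  have hnbE : ∀ k, eLpNorm (b k) 2 P = ENNReal.ofReal (nb k) := fun k =>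
    (ENNReal.ofReal_toReal (hbm k).2.ne).symm
  have hw0 := fun k => (weight_pos hΦ hconc k).le
  -- where `nb k = 0` the division gives the coefficient `0`
  set β : ℕ → ℝ := fun k => weight Φ k / nb k with hβ
  have hβ0 : ∀ k, 0 ≤ β k := fun k => div_nonneg (hw0 k) (hnb0 k)
  have hβb : ∀ k, eLpNorm (β k • b k) 2 P ≤ ENNReal.ofReal (weight Φ k) := by
    intro k
    rw [eLpNorm_const_smul, hnbE, Real.enorm_eq_ofReal (hβ0 k), ← ENNReal.ofReal_mul (hβ0 k)]
    refine ENNReal.ofReal_le_ofReal ?_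
    rcases (hnb0 k).eq_or_lt with h | h
    · rw [← h, mul_zero]
      exact hw0 k
    · rw [hβ]
      dsimp only
      rw [div_mul_cancel₀ _ h.ne']
  have hpair : ∀ k, ∫ ω, g ω * (β k * b k ω) ∂P = weight Φ k * nb k := by
    intro k
    have h1 : ∫ ω, b k ω * g ω ∂P = nb k ^ 2 := by
      rw [integral_sub_stopped_mul h𝓕 (hν k) hg]
      have h2 := lintegral_enorm_sq_eq_ofReal (hbm k)
      rw [lintegral_enorm_sq_eq_eLpNorm, hnbE, ← ENNReal.ofReal_pow (hnb0 k)] at h2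
      exact ((ENNReal.ofReal_eq_ofReal_iff (sq_nonneg _)
        (integral_nonneg fun ω => sq_nonneg _)).1 h2).symm
    have e : ∀ ω, g ω * (β k * b k ω) = β k * (b k ω * g ω) := fun ω => by ring
    simp_rw [e]
    rw [integral_const_mul, h1]
    rcases (hnb0 k).eq_or_lt with h | h
    · rw [← h]
      ring
    · simp only [hβ]
      field_simp
  have hN : ∀ N : ℕ, ∑ k ∈ Finset.range N,
      ENNReal.ofReal (weight Φ k) * oscillation 𝓕 P g ((1 / 2) ^ k) ≤
        ENNReal.ofReal (34 * D ^ 2) * Hardy.dualNorm l := by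
    intro N
    have hh : MemLp (∑ k ∈ Finset.range N, β k • b k) 2 P := by
      have := memLp_finsetSum (Finset.range N) (f := fun k => β k • b k)
        fun k _ => (hbm k).const_smul (β k)
      convert this using 1
      ext ω
      simp
    have hval : l (Hardy.ofMemLp hΦ hconc 𝓕 hh) = ∑ k ∈ Finset.range N, weight Φ k * nb k := by
      rw [hl]
      have e : ∀ ω, g ω * (∑ k ∈ Finset.range N, β k • b k) ω =
          ∑ k ∈ Finset.range N, g ω * (β k * b k ω) := by
        intro ω
        simp [Finset.mul_sum]
      simp_rw [e]
      have hi : ∀ k ∈ Finset.range N, Integrable (fun ω => g ω * (β k * b k ω)) P :=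
        fun k _ => hg.integrable_mul ((hbm k).const_smul (β k))
      rw [integral_finsetSum _ hi]
      exact Finset.sum_congr rfl fun k _ => hpair k
    have hq : (Hardy.ofMemLp hΦ hconc 𝓕 hh).quasiNorm < ENNReal.ofReal (17 * D ^ 2) := by
      refine (quasiNorm_sum_sub_stopped_le h𝓕 hD1 hD hg hν hνP β hβb N hh).trans_lt ?_
      rw [ENNReal.ofReal_lt_ofReal_iff (by positivity)]
      nlinarith [sq_nonneg D]
    have h1 := Hardy.enorm_apply_le l hq
    rw [hval, Real.enorm_eq_ofReal
      (Finset.sum_nonneg fun k _ => mul_nonneg (hw0 k) (hnb0 k))] at h1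
    calc _ ≤ ∑ k ∈ Finset.range N, ENNReal.ofReal 2 * ENNReal.ofReal (weight Φ k * nb k) := by
          refine Finset.sum_le_sum fun k _ => ?_
          rw [ENNReal.ofReal_mul (hw0 k), mul_left_comm, ENNReal.ofReal_ofNat, ← hnbE]
          gcongr
          exact hνosc k
      _ = ENNReal.ofReal 2 * ENNReal.ofReal (∑ k ∈ Finset.range N, weight Φ k * nb k) := by
          rw [← Finset.mul_sum, ENNReal.ofReal_sum_of_nonneg
            fun k _ => mul_nonneg (hw0 k) (hnb0 k)]
      _ ≤ ENNReal.ofReal 2 * (ENNReal.ofReal (17 * D ^ 2) * Hardy.dualNorm l) := by gcongr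
      _ = _ := by
          rw [← mul_assoc, ← ENNReal.ofReal_mul (by norm_num)]
          congr 2
          ring
  calc _ ≤ ENNReal.ofReal (D + 2) *
        ∑' k, ENNReal.ofReal (weight Φ k) * oscillation 𝓕 P g ((1 / 2) ^ k) :=
        campanatoNorm_le_tsum hΦ hconc hD1 hD
    _ ≤ ENNReal.ofReal (D + 2) * (ENNReal.ofReal (34 * D ^ 2) * Hardy.dualNorm l) := by
        gcongr
        exact ENNReal.tsum_le_of_sum_range_le hN
    _ = _ := by rw [← mul_assoc, ← ENNReal.ofReal_mul (by positivity)]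

end LowerBound

/-! ### Representation of functionals -/

namespace Hardy

variable {Ω : Type*} [mΩ : MeasurableSpace Ω] {P : Measure Ω} [IsProbabilityMeasure P]
  {𝓕 : Filtration ℕ mΩ} {ℓ : ℝ} {Φ : ℝ → ℝ} {hΦ : MemG ℓ Φ}

lemma apply_ofMemLp_congr {hconc : ConcaveOn ℝ (Set.Ici 0) Φ} (l : Hardy hΦ 𝓕 P →L[ℝ] ℝ)
    {h h' : Ω → ℝ} (hh : MemLp h 2 P) (hh' : MemLp h' 2 P) (e : h =ᵐ[P] h') :
    l (ofMemLp hΦ hconc 𝓕 hh) = l (ofMemLp hΦ hconc 𝓕 hh') := by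
  refine apply_eq_of_ae_eq l fun n => ?_
  filter_upwards [condExp_congr_ae (m := 𝓕 n) e, condExp_congr_ae (m := 𝓕 0) e] with ω h1 h2
  rw [ofMemLp_seq, ofMemLp_seq, h1, h2]

/-- The restriction of a continuous linear functional to `L_2`. -/
def toL2 (hconc : ConcaveOn ℝ (Set.Ici 0) Φ) (l : Hardy hΦ 𝓕 P →L[ℝ] ℝ) :
    Lp ℝ 2 P →L[ℝ] ℝ :=
  LinearMap.mkContinuous
    { toFun := fun h => l (ofMemLp hΦ hconc 𝓕 (Lp.memLp h))
      map_add' := by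
        intro h h'
        rw [← map_add]
        refine apply_eq_of_ae_eq l fun n => ?_
        have hE : ∀ m, P[(h + h' : Lp ℝ 2 P) | 𝓕 m] =ᵐ[P] P[h | 𝓕 m] + P[h' | 𝓕 m] := fun m =>
          (condExp_congr_ae (Lp.coeFn_add h h')).trans
            (condExp_add ((Lp.memLp _).integrable one_le_two)
              ((Lp.memLp _).integrable one_le_two) _)
        filter_upwards [hE n, hE 0] with ω h1 h2
        have e : (ofMemLp hΦ hconc 𝓕 (Lp.memLp h) + ofMemLp hΦ hconc 𝓕 (Lp.memLp h')).seq n ω =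
            (ofMemLp hΦ hconc 𝓕 (Lp.memLp h)).seq n ω +
              (ofMemLp hΦ hconc 𝓕 (Lp.memLp h')).seq n ω := rfl
        rw [e, ofMemLp_seq, ofMemLp_seq, ofMemLp_seq, h1, h2, Pi.add_apply, Pi.add_apply]
        ring
      map_smul' := by
        intro a h
        rw [RingHom.id_apply, ← map_smul]
        refine apply_eq_of_ae_eq l fun n => ?_
        have hE : ∀ m, P[(a • h : Lp ℝ 2 P) | 𝓕 m] =ᵐ[P] a • P[h | 𝓕 m] := fun m =>
          (condExp_congr_ae (Lp.coeFn_smul a h)).trans (condExp_smul a _ _)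
        filter_upwards [hE n, hE 0] with ω h1 h2
        have e : (a • ofMemLp hΦ hconc 𝓕 (Lp.memLp h)).seq n ω =
            a * (ofMemLp hΦ hconc 𝓕 (Lp.memLp h)).seq n ω := rfl
        rw [e, ofMemLp_seq, ofMemLp_seq, h1, h2, Pi.smul_apply, Pi.smul_apply, smul_eq_mul,
          smul_eq_mul]
        ring }
    (2 / level Φ 0 * (dualNorm l).toReal) (by
      intro h
      have hlev := level_pos hΦ hconc 0
      have hM : (0 : ℝ) ≤ (dualNorm l).toReal := ENNReal.toReal_nonneg
      show ‖l (ofMemLp hΦ hconc 𝓕 (Lp.memLp h))‖ ≤ _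
      rcases (norm_nonneg h).eq_or_lt with h0 | h0
      · have hz : (h : Ω → ℝ) =ᵐ[P] 0 := by
          rw [norm_eq_zero.1 h0.symm]
          exact Lp.coeFn_zero ℝ 2 P
        have : l (ofMemLp hΦ hconc 𝓕 (Lp.memLp h)) = l 0 := by
          refine apply_eq_of_ae_eq l fun n => ?_
          filter_upwards [condExp_congr_ae (m := 𝓕 n) hz, condExp_congr_ae (m := 𝓕 0) hz]
            with ω h1 h2
          rw [ofMemLp_seq, h1, h2, condExp_zero, condExp_zero]
          exact sub_self _
        rw [this, map_zero, norm_zero]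
        positivity
      · have h2 : eLpNorm h 2 P ≤ ENNReal.ofReal ‖h‖ := by
          rw [Lp.norm_def, ENNReal.ofReal_toReal (Lp.memLp h).2.ne]
        have h3 : quasiNorm (ofMemLp hΦ hconc 𝓕 (Lp.memLp h)) <
            ENNReal.ofReal (2 / level Φ 0 * ‖h‖) := by
          refine (quasiNorm_ofMemLp_le _ h0 h2).trans_lt ?_
          rw [ENNReal.ofReal_lt_ofReal_iff (by positivity), div_mul_eq_mul_div]
          gcongr
          linarith
        have h4 := enorm_apply_le l h3
        rw [← ENNReal.ofReal_toReal (dualNorm_lt_top l).ne, ← ENNReal.ofReal_mul (by positivity),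
          ← ofReal_norm, ENNReal.ofReal_le_ofReal_iff (by positivity)] at h4
        linarith)

lemma toL2_apply (hconc : ConcaveOn ℝ (Set.Ici 0) Φ) (l : Hardy hΦ 𝓕 P →L[ℝ] ℝ)
    (h : Lp ℝ 2 P) : toL2 hconc l h = l (ofMemLp hΦ hconc 𝓕 (Lp.memLp h)) := rfl

/-- The Riesz representation of the restriction of a functional to `L_2`. -/
lemma exists_riesz (hconc : ConcaveOn ℝ (Set.Ici 0) Φ) (l : Hardy hΦ 𝓕 P →L[ℝ] ℝ) :
    ∃ g : Lp ℝ 2 P, P[g | 𝓕 0] =ᵐ[P] 0 ∧ ∀ (h : Ω → ℝ) (hh : MemLp h 2 P),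
      l (ofMemLp hΦ hconc 𝓕 hh) = ∫ ω, g ω * h ω ∂P := by
  set g : Lp ℝ 2 P := (InnerProductSpace.toDual ℝ (Lp ℝ 2 P)).symm (toL2 hconc l) with hgdef
  have hrepr : ∀ (h : Ω → ℝ) (hh : MemLp h 2 P),
      l (ofMemLp hΦ hconc 𝓕 hh) = ∫ ω, g ω * h ω ∂P := by
    intro h hh
    rw [apply_ofMemLp_congr l hh (Lp.memLp (hh.toLp h)) hh.coeFn_toLp.symm,
      ← toL2_apply, ← InnerProductSpace.toDual_symm_apply, ← hgdef, L2.inner_def]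
    refine integral_congr_ae ?_
    filter_upwards [hh.coeFn_toLp] with ω hω
    rw [hω]
    simp [mul_comm]
  refine ⟨g, ?_, hrepr⟩
  have hg : MemLp g 2 P := Lp.memLp g
  have hE : MemLp (P[g | 𝓕 0]) 2 P := hg.condExp one_le_two
  have h1 := hrepr _ hE
  have h2 : l (ofMemLp hΦ hconc 𝓕 hE) = l 0 := by
    refine apply_eq_of_ae_eq l fun n => Eventually.of_forall fun ω => ?_
    have e : ∀ m, P[P[g | 𝓕 0] | 𝓕 m] = P[g | 𝓕 0] := fun m =>
      condExp_of_stronglyMeasurable (𝓕.le m)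
        (stronglyMeasurable_condExp.mono (𝓕.mono (Nat.zero_le m))) integrable_condExp
    rw [ofMemLp_seq, e, e]
    exact sub_self _
  rw [h2, map_zero, integral_mul_condExp (𝓕.le 0) hg hg] at h1
  have h3 := (integral_eq_zero_iff_of_nonneg (fun ω => mul_self_nonneg _)
    (hE.integrable_mul hE)).1 h1.symm
  filter_upwards [h3] with ω hω
  exact mul_self_eq_zero.1 hω

lemma exists_dualMap_eq (h𝓕 : ⨆ n, 𝓕 n = mΩ) (hconc : ConcaveOn ℝ (Set.Ici 0) Φ) {D : ℝ}
    (hD1 : 1 ≤ D) (hD : ∀ s, 0 ≤ s → inverse Φ (2 * s) ≤ D * inverse Φ s)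
    (l : Hardy hΦ 𝓕 P →L[ℝ] ℝ) : ∃ g : Campanato 𝓕 P (phi Φ), dualMap hΦ h𝓕 hconc g = l ∧
      campanatoNorm 𝓕 P (phi Φ) g ≤ ENNReal.ofReal ((D + 2) * (34 * D ^ 2)) * dualNorm l := by
  obtain ⟨g, hg0, hg⟩ := exists_riesz hconc l
  have hbound := campanatoNorm_le_dualNorm h𝓕 hD1 hD (Lp.memLp g) l hg
  refine ⟨⟨g, hg0, hbound.trans_lt (ENNReal.mul_lt_top ENNReal.ofReal_lt_top
    (dualNorm_lt_top l))⟩, ?_, hbound⟩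
  rw [← sub_eq_zero]
  refine eq_zero_of_forall_ofMemLp hconc _ fun N h hh hN => ?_
  rw [_root_.sub_apply, dualMap_ofMemLp h𝓕 hconc _ hh hN, hg h hh, sub_self]

/-- By Lévy's upward theorem, `g` is determined by the conditional expectations `E_N g`, and
these are seen by the functional. -/
lemma dualMap_injective (h𝓕 : ⨆ n, 𝓕 n = mΩ) (hconc : ConcaveOn ℝ (Set.Ici 0) Φ) :
    Function.Injective (dualMap (P := P) hΦ h𝓕 hconc) := by
  refine (injective_iff_map_eq_zero _).2 fun g hg => ?_
  have hgm : MemLp (g : Lp ℝ 2 P) 2 P := Lp.memLp _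
  have hE : ∀ N, P[(g : Lp ℝ 2 P) | 𝓕 N] =ᵐ[P] 0 := by
    intro N
    have hm : MemLp (P[(g : Lp ℝ 2 P) | 𝓕 N]) 2 P := hgm.condExp one_le_two
    have h1 := dualMap_ofMemLp (hΦ := hΦ) h𝓕 hconc g hm stronglyMeasurable_condExp
    rw [hg, zero_apply, integral_mul_condExp (𝓕.le N) hgm hgm] at h1
    have h3 := (integral_eq_zero_iff_of_nonneg (fun ω => mul_self_nonneg _)
      (hm.integrable_mul hm)).1 h1.symm
    filter_upwards [h3] with ω hω
    exact mul_self_eq_zero.1 hω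
  have hlim := tendsto_ae_condExp (μ := P) (ℱ := 𝓕) (g : Lp ℝ 2 P)
  have hself : P[(g : Lp ℝ 2 P) | ⨆ n, 𝓕 n] =ᵐ[P] (g : Lp ℝ 2 P) := by
    rw [h𝓕]
    exact condExp_of_aestronglyMeasurable' le_rfl hgm.1 (hgm.integrable one_le_two)
  refine Subtype.ext (Lp.ext ?_)
  refine EventuallyEq.trans ?_ (Lp.coeFn_zero ℝ 2 P).symm
  filter_upwards [hlim, hself, ae_all_iff.2 hE] with ω h1 h2 h3
  simp_rw [h3] at h1
  rw [h2] at h1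
  exact (tendsto_nhds_unique tendsto_const_nhds h1).symm

end Hardy

end WeakOrlicz

end

theorem theorem5p1 {ℓ : ℝ} {Φ : ℝ → ℝ} (hΦ : MemG ℓ Φ)
    (hconc : ConcaveOn ℝ (Set.Ici 0) Φ) (hq : upperIndex (inverse Φ) < ⊤) :
    ∃ C : ℝ≥0, ∀ (Ω : Type*) [mΩ : MeasurableSpace Ω] (P : Measure Ω) [IsProbabilityMeasure P]
      (𝓕 : Filtration ℕ mΩ), (⨆ n, 𝓕 n) = mΩ →
      ∃ T : Campanato 𝓕 P (phi Φ) ≃ₗ[ℝ] (Hardy hΦ 𝓕 P →L[ℝ] ℝ),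
        (∀ g : Campanato 𝓕 P (phi Φ), ∀ f : Hardy hΦ 𝓕 P, f.MemH2 →
          (∀ᵐ ω ∂P, Summable fun n => pairingTerm 𝓕 P f.seq g n ω) ∧
          Integrable (fun ω => ∑' n, pairingTerm 𝓕 P f.seq g n ω) P ∧
          T g f = ∫ ω, ∑' n, pairingTerm 𝓕 P f.seq g n ω ∂P) ∧
        (∀ g : Campanato 𝓕 P (phi Φ), ∀ l : Hardy hΦ 𝓕 P →L[ℝ] ℝ,
          (∀ f : Hardy hΦ 𝓕 P, f.MemH2 → l f = ∫ ω, ∑' n, pairingTerm 𝓕 P f.seq g n ω ∂P) →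
          l = T g) ∧
        ∀ g : Campanato 𝓕 P (phi Φ),
          Hardy.dualNorm (T g) ≤
              C * campanatoNorm 𝓕 P (phi Φ) g ∧
            campanatoNorm 𝓕 P (phi Φ) g ≤
              C * Hardy.dualNorm (T g) := by
  obtain ⟨D, hD1, hD⟩ := hΦ.exists_doubling hconc
  -- `4 * D ^ 2` bounds the functional of `g` on the unit ball, and the other term comes from the
  -- lower bound `campanatoNorm_le_dualNorm`
  have hC0 : 0 ≤ (D + 2) * (34 * D ^ 2) := by positivity
  refine ⟨(4 * D ^ 2 + (D + 2) * (34 * D ^ 2)).toNNReal, fun Ω mΩ P _ 𝓕 h𝓕 => ?_⟩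
  have hC : ∀ c, c ≤ 4 * D ^ 2 + (D + 2) * (34 * D ^ 2) → ENNReal.ofReal c ≤
      (((4 * D ^ 2 + (D + 2) * (34 * D ^ 2)).toNNReal : ℝ≥0) : ℝ≥0∞) :=
    fun c hc => ENNReal.ofReal_le_ofReal hc
  have hinj := Hardy.dualMap_injective (P := P) (hΦ := hΦ) h𝓕 hconc
  have hsurj := Hardy.exists_dualMap_eq (P := P) (hΦ := hΦ) h𝓕 hconc hD1 hD
  have hfin := Hardy.tsum_lintegral_pairingTerm_lt_top (P := P) (hΦ := hΦ) h𝓕 hconc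
  have hbij : Function.Bijective (Hardy.dualMap (P := P) hΦ h𝓕 hconc) :=
    ⟨hinj, fun l => (hsurj l).imp fun g hg => hg.1⟩
  refine ⟨LinearEquiv.ofBijective (Hardy.dualMap hΦ h𝓕 hconc) hbij, fun g f _ =>
    ⟨f.ae_summable_pairingTerm (hfin g f), f.integrable_tsum_pairingTerm (hfin g f), rfl⟩,
    fun g l hl => ?_, fun g => ⟨?_, ?_⟩⟩
  · rw [LinearEquiv.ofBijective_apply, ← sub_eq_zero]
    refine Hardy.eq_zero_of_forall_ofMemLp hconc _ fun N h hh _ => ?_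
    rw [_root_.sub_apply, Hardy.dualMap_apply, hl _ (Hardy.memH2_ofMemLp hh), sub_self]
  · rw [LinearEquiv.ofBijective_apply]
    refine iSup₂_le fun f hf => ?_
    -- the estimate of the pairing needs a strict bound for the quasi-norm; `2` serves
    have hρ : f.quasiNorm < ENNReal.ofReal 2 := hf.trans_lt (by norm_num)
    refine (Hardy.enorm_pairing_le h𝓕 hconc hD1 hD g f hρ).trans ?_
    rw [← mul_assoc, ← ENNReal.ofReal_mul (by norm_num)]
    gcongr
    exact hC _ (by linarith)
  · rw [LinearEquiv.ofBijective_apply]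
    obtain ⟨g', hg', hle⟩ := hsurj (Hardy.dualMap hΦ h𝓕 hconc g)
    rw [hinj hg'] at hle
    refine hle.trans ?_
    gcongr
    exact hC _ (by nlinarith [sq_nonneg D])
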